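/- Let $(N,h)$ be a compact smooth Riemannian manifold without boundary, isometrically embedded in a Euclidean space $\mathbb{R}^k$. There is a constant $C_N>0$, depending only on $N\subset\mathbb{R}^k$, with the following property. Let $(M,g)$ be a compact smooth Riemannian manifold, possibly with boundary, with volume element $dg$, and let $p\ge 2$. Let $W^{1,p}(M,\mathbb{R}^k)$ be the usual Sobolev space (the completion of $C^\infty(M,\mathbb{R}^k)$ in the $W^{1,p}$-norm), let $C_0^\infty(M,\mathbb{R}^k)$ be the space of smooth maps with compact support in the interior of $M$, let $W^{1,p}_0(M,\mathbb{R}^k)$ be its closure in $W^{1,p}(M,\mathbb{R}^k)$, and let $W^{1,p}(M,N)$ be the set of $u\in W^{1,p}(M,\mathbb{R}^k)$ with $u(x)\in N$ for a.e. $x$. Write $|\nabla u|^2=\sum_{j=1}^k|\nabla u^j|_g^2$ and $E_p(u)=\frac1p\int_M|\nabla u|^p\,dg$ (with $|\nabla u|^{p-2}=1$ when $p=2$). A map $u\in W^{1,p}(M,N)$ is called $p$-harmonic if it is a critical point of $E_p$ for the variations $\Pi_N(u+t\varphi)$, that is, $\frac{d}{dt}\big|_{t=0}E_p(\Pi_N(u+t\varphi))=0$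 for all $\varphi\in C_0^\infty(M,\mathbb{R}^k)$, where $\Pi_N$ is the nearest point projection from a tubular neighbourhood of $N$ in $\mathbb{R}^k$ onto $N$. If $u\in W^{1,p}(M,N)$ is a $p$-harmonic map such that, for some $P_0\in N$ and some $0<r<C_N$, $u(x)$ lies in the open Euclidean ball $B(P_0,r)\subset\mathbb{R}^k$ for a.e. $x\in M$, then for every $\varphi\in W^{1,p}_0(M,\mathbb{R}^k)$ both of the following integrals are finite and $$\int_M|\nabla u|^p|\varphi|^2\,dg\le 16\,r^2\int_M|\nabla u|^{p-2}|\nabla\varphi|^2\,dg .$$ -/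

import Mathlib

open Set Filter Topology MeasureTheory
open scoped Manifold ContDiff ENNReal RealInnerProductSpace

namespace PHarmonic

noncomputable section

/-- The Euclidean space `ℝᵏ`. -/
abbrev Euc (k : ℕ) : Type := EuclideanSpace ℝ (Fin k)

/-- Smooth Riemannian metrics on a manifold modelled on `ℝᵐ` through the model `I`
(for instance `I = 𝓡 m` without boundary, `I = 𝓡∂ m` with boundary). -/
abbrev Metric {m : ℕ} {H : Type*} [TopologicalSpace H] (I : ModelWithCorners ℝ (Euc m) H)
    (M : Type*) [TopologicalSpace M] [ChartedSpace H M] [IsManifold I ∞ M] : Type _ :=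
  Bundle.ContMDiffRiemannianMetric (IB := I) (n := ∞) (F := Euc m)
    (E := fun x : M => TangentSpace I x)

section Manifold

variable {m k : ℕ} {H : Type*} [TopologicalSpace H] {I : ModelWithCorners ℝ (Euc m) H}
  {M : Type*} [TopologicalSpace M] [ChartedSpace H M] [IsManifold I ∞ M]

/-- The matrix `g_{αβ} = g(e_α, e_β)` of the metric at `x` for a family `e` of tangent vectors. -/
def gram (g : Metric I M) (x : M) (e : Fin m → TangentSpace I x) : Matrix (Fin m) (Fin m) ℝ :=
  Matrix.of fun α β => g.inner x (e α) (e β)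

/-- The coordinate vectors `∂/∂x_α` at the point with coordinates `z` in the chart around `x₀`. -/
def coordVec (I : ModelWithCorners ℝ (Euc m) H) (x₀ : M) (z : Euc m) (α : Fin m) :
    TangentSpace I ((extChartAt I x₀).symm z) :=
  mfderivWithin 𝓘(ℝ, Euc m) I (extChartAt I x₀).symm (range I) z
    (EuclideanSpace.single α (1 : ℝ) : Euc m)

/-- The measure `√det(g_{αβ}) dx` of the chart around `x₀`, as a measure on `M`. -/
def chartVolume [MeasurableSpace M] (g : Metric I M) (x₀ : M) : Measure M :=
  Measure.map (extChartAt I x₀).symm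
    ((volume.restrict (extChartAt I x₀).target).withDensity fun z =>
      ENNReal.ofReal (Real.sqrt (gram g ((extChartAt I x₀).symm z) (coordVec I x₀ z)).det))

/-- A smooth partition of unity `(ρ_i)_{i ∈ M}` subordinate to the chart domains. -/
def chartPartition (I : ModelWithCorners ℝ (Euc m) H) (M : Type*) [TopologicalSpace M]
    [ChartedSpace H M] [IsManifold I ∞ M] [T2Space M] [SigmaCompactSpace M] :
    SmoothPartitionOfUnity M I M univ :=
  Classical.choose (SmoothPartitionOfUnity.exists_isSubordinate_chartAt_source I M)

/-- The Riemannian volume measure `dg = ∑_i ρ_i √det(g_{αβ}) dx`. -/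
def vol [T2Space M] [SigmaCompactSpace M] [MeasurableSpace M] (g : Metric I M) : Measure M :=
  Measure.sum fun i : M =>
    (chartVolume g i).withDensity fun x => ENNReal.ofReal (chartPartition I M i x)

/-- The standard basis of `T_x M`, that is, the coordinate basis of the preferred chart at `x`. -/
def stdVec (I : ModelWithCorners ℝ (Euc m) H) (x : M) (α : Fin m) : TangentSpace I x :=
  (EuclideanSpace.single α (1 : ℝ) : Euc m)

/-- `|D|_g = (g^{αβ} D(e_α) · D(e_β))^{1/2}` for a linear map `D : T_x M → ℝᵏ`; here `(g^{αβ})` is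
the inverse of the matrix of `g` in the basis `(e_α)`, and the value is the same in all bases. -/
def gnorm (g : Metric I M) (x : M) (D : TangentSpace I x →L[ℝ] Euc k) : ℝ :=
  Real.sqrt (∑ α, ∑ β, (gram g x (stdVec I x))⁻¹ α β * ⟪D (stdVec I x α), D (stdVec I x β)⟫)

/-- The differential of a smooth map `w : M → ℝᵏ`. -/
def dif (I : ModelWithCorners ℝ (Euc m) H) (w : M → Euc k) (x : M) :
    TangentSpace I x →L[ℝ] Euc k :=
  mfderiv I 𝓘(ℝ, Euc k) w x

/-- `C^∞(M, ℝᵏ)` (smooth up to the boundary). -/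
def smoothMaps (I : ModelWithCorners ℝ (Euc m) H) (M : Type*) [TopologicalSpace M]
    [ChartedSpace H M] (k : ℕ) : Set (M → Euc k) :=
  {w | ContMDiff I 𝓘(ℝ, Euc k) ∞ w}

/-- `C_0^∞(M, ℝᵏ)`: smooth maps with compact support in the interior of `M`. -/
def testMaps (I : ModelWithCorners ℝ (Euc m) H) (M : Type*) [TopologicalSpace M]
    [ChartedSpace H M] (k : ℕ) : Set (M → Euc k) :=
  {w | ContMDiff I 𝓘(ℝ, Euc k) ∞ w ∧ HasCompactSupport w ∧ tsupport w ⊆ I.interior M}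

variable [T2Space M] [SigmaCompactSpace M] [MeasurableSpace M]

/-- The pair `(u, D)` is a limit of pairs `(w, dw)` with `w ∈ A` in the norm of `W^{1,p}`, that is,
`w → u` and `dw → D` in `Lᵖ`. -/
def IsSobolevLimit (g : Metric I M) (p : ℝ) (A : Set (M → Euc k)) (u : M → Euc k)
    (D : ∀ x : M, TangentSpace I x →L[ℝ] Euc k) : Prop :=
  ∃ w : ℕ → M → Euc k, (∀ j, w j ∈ A) ∧
    (∀ j, MemLp (fun x => w j x - u x) (ENNReal.ofReal p) (vol g)) ∧
    (∀ j, MemLp (fun x => gnorm g x (dif I (w j) x - D x)) (ENNReal.ofReal p) (vol g)) ∧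
    Tendsto (fun j => eLpNorm (fun x => w j x - u x) (ENNReal.ofReal p) (vol g)) atTop (𝓝 0) ∧
    Tendsto (fun j => eLpNorm (fun x => gnorm g x (dif I (w j) x - D x)) (ENNReal.ofReal p) (vol g))
      atTop (𝓝 0)

/-- `u ∈ W^{1,p}(M, ℝᵏ)` with weak differential `D` (unique up to null sets). On the compact
manifold `M` the space `W^{1,p}(M, ℝᵏ)` is the completion of `C^∞(M, ℝᵏ)`. -/
def IsW1p (g : Metric I M) (p : ℝ) (u : M → Euc k)
    (D : ∀ x : M, TangentSpace I x →L[ℝ] Euc k) : Prop :=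
  IsSobolevLimit g p (smoothMaps I M k) u D

/-- `φ ∈ W^{1,p}_0(M, ℝᵏ)`, the closure of `C_0^∞(M, ℝᵏ)`, with weak differential `D`. -/
def IsW1pZero (g : Metric I M) (p : ℝ) (φ : M → Euc k)
    (D : ∀ x : M, TangentSpace I x →L[ℝ] Euc k) : Prop :=
  IsSobolevLimit g p (testMaps I M k) φ D

/-- `v ∈ W^{1,p}(M, ℝᵏ)` and its `p`-energy `(1/p) ∫_M |∇v|^p dg` is `c`. -/
def HasEnergy (g : Metric I M) (p : ℝ) (v : M → Euc k) (c : ℝ) : Prop :=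
  ∃ D : ∀ x : M, TangentSpace I x →L[ℝ] Euc k, IsW1p g p v D ∧
    c = (1 / p) * ∫ x, gnorm g x (D x) ^ p ∂(vol g)

open Classical in
/-- The nearest point projection onto `S`: a point of `S` at minimal distance from `z`. For a compact
submanifold `S` this point is unique when `z` lies in a tubular neighbourhood of `S`. -/
def nearestPoint (S : Set (Euc k)) (z : Euc k) : Euc k :=
  if h : ∃ y ∈ S, ∀ y' ∈ S, dist z y ≤ dist z y' then Classical.choose h else z

/-- `p`-harmonic maps `u : M → S ⊆ ℝᵏ`: maps `u ∈ W^{1,p}(M, S)` that are critical points of the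
`p`-energy for the variations `Π_S(u + tφ)`, `φ ∈ C_0^∞(M, ℝᵏ)`, where `Π_S` is the nearest point
projection: if `e t` is the `p`-energy of `Π_S(u + tφ)` for all small `t`, then `e' 0 = 0`. -/
def IsPHarmonic (g : Metric I M) (p : ℝ) (S : Set (Euc k)) (u : M → Euc k) : Prop :=
  (∃ D, IsW1p g p u D) ∧ (∀ᵐ x ∂(vol g), u x ∈ S) ∧
    ∀ φ ∈ testMaps I M k, ∀ e : ℝ → ℝ,
      (∀ᶠ t in 𝓝 0, HasEnergy g p (fun x => nearestPoint S (u x + t • φ x)) (e t)) →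
        HasDerivAt e 0 0

end Manifold

/-- `ι` is an isometric embedding of the boundaryless Riemannian manifold `(N, h)` into `ℝᵏ`. -/
structure IsIsometricEmbedding {n k : ℕ} {N : Type*} [TopologicalSpace N]
    [ChartedSpace (Euc n) N] [IsManifold (𝓡 n) ∞ N] (h : Metric (𝓡 n) N) (ι : N → Euc k) :
    Prop where
  contMDiff : ContMDiff (𝓡 n) 𝓘(ℝ, Euc k) ∞ ι
  isEmbedding : IsEmbedding ι
  isometric : ∀ (y : N) (v w : TangentSpace (𝓡 n) y),
    ⟪dif (𝓡 n) ι y v, dif (𝓡 n) ι y w⟫ = h.inner y v w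

end

end PHarmonic

/-!
The estimate is a Caccioppoli inequality for the Euler–Lagrange equation of `p`-harmonic maps.

Let `F` be a compactly supported smooth map which agrees with the nearest point projection near the
compact submanifold `S = ι(N)` (`exists_smooth_extension_nearestPoint`; smoothness of the projection
comes from the implicit function theorem). For `x` with `u(x) ∈ S`, the differential `dF(u)` is the
orthogonal projection onto the tangent space, and `dF(u) ∘ du = du` because `F ∘ u = u`. Critical
points of `t ↦ (1/p) ∫ |d(F(u + tψ))|ᵖ` satisfy, for all test maps `ψ`,
`∫ |du|ᵖ⁻² ⟪du, d²F(u)(ψ, du) + dψ⟫ = 0`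
(`IsPHarmonic.integral_elDensity_eq_zero`). With `ψ = |φ|² (u - P)` the second term produces
`|φ|² |du|ᵖ` and a mixed term with `2 ⟪φ, dφ⟫ (u - P)`, which Young's inequality bounds by
`¼ |φ|² |du|ᵖ + 4 r² |du|ᵖ⁻² |dφ|²`. The first term is at most `K r |φ|² |du|ᵖ`, where `K` bounds
`d²F`, so it is absorbed when `K r ≤ 1/2` (`le_elDensity`). This leaves
`¼ ∫ |du|ᵖ |φ|² ≤ 4 r² ∫ |du|ᵖ⁻² |dφ|²`, whence the constant `16 r²`, and `C_N = 1 / (2 (K + 1))`.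

Most of the work makes this rigorous for Sobolev maps, which are given here as limits of smooth maps.
A measurable orthonormal frame (`exists_isFrame`, from a Cholesky decomposition of the inverse metric
in charts) turns differentials into functions with values in the Hilbert space `Fld k m`, and
convergence in `W^{1,p}` is replaced by almost everywhere convergence of a subsequence with a
dominating function (`IsDominatedLimit`). Such limits are stable under the chain rule, so `F ∘ u` has
the weak differential `dF(u) ∘ du`, the energy of the variation can be differentiated under the
integral, and the maps `|φ|² (F(w_j) - P)` with smooth `w_j → u` are admissible test maps that tend
to `|φ|² (u - P)`. That `dF(u) ∘ du = du` requires the weak differential to be unique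
(`IsDominatedLimit.ae_eq`), which is integration by parts in charts (`ae_gnorm_eq_zero`); there the
boundary of `M` is negligible since the range of the model with corners is convex.
-/


namespace PHarmonic

noncomputable section

/-! ### The nearest point projection is smooth near a compact submanifold -/

/-- The implicit function theorem with smoothness on a whole neighbourhood: `ContDiffAt ℝ ∞` at the
base point alone only gives neighbourhoods that depend on the order of differentiability. -/
theorem exists_implicit_eventually_contDiffAt {E₁ E₂ F : Type*}
    [NormedAddCommGroup E₁] [NormedSpace ℝ E₁] [CompleteSpace E₁]
    [NormedAddCommGroup E₂] [NormedSpace ℝ E₂] [CompleteSpace E₂]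
    [NormedAddCommGroup F] [NormedSpace ℝ F] [CompleteSpace F]
    {f : E₁ × E₂ → F} {O : Set (E₁ × E₂)} (hO : IsOpen O) (hf : ContDiffOn ℝ ∞ f O)
    {u : E₁ × E₂} (hu : u ∈ O) (hinv : (fderiv ℝ f u ∘L .inr ℝ E₁ E₂).IsInvertible) :
    ∃ ψ : E₁ → E₂, ψ u.1 = u.2 ∧ (∀ᶠ x in 𝓝 u.1, ContDiffAt ℝ ∞ ψ x) ∧
      ∀ᶠ v in 𝓝 u, f v = f u → ψ v.1 = v.2 := by
  have hfa : ∀ v ∈ O, ContDiffAt ℝ ∞ f v := fun v hv => hf.contDiffAt (hO.mem_nhds hv)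
  have hn : (∞ : WithTop ℕ∞) ≠ 0 := by simp
  set ψ := (hfa u hu).implicitFunction hn hinv with hψ
  have hψu : ψ u.1 = u.2 := (hfa u hu).implicitFunction_apply_self hn hinv
  have hψs : ContDiffAt ℝ ∞ ψ u.1 := (hfa u hu).contDiffAt_implicitFunction hn hinv
  refine ⟨ψ, hψu, ?_, ?_⟩
  · have hiff := (hfa u hu).eventually_apply_eq_iff_implicitFunction hn hinv
    have hinv' : ∀ᶠ v in 𝓝 u, (fderiv ℝ f v ∘L .inr ℝ E₁ E₂).IsInvertible := by
      have hc : ContinuousAt (fun v => fderiv ℝ f v ∘L .inr ℝ E₁ E₂) u := by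
        have : ContinuousAt (fderiv ℝ f) u :=
          ((hfa u hu).fderiv_right (m := 0) (by simp)).continuousAt
        exact (this.clm_comp continuousAt_const)
      obtain ⟨e, he⟩ := hinv
      have := e.nhds
      rw [he] at this
      filter_upwards [hc.preimage_mem_nhds this] with v hv
      exact hv
    have hW : ∀ᶠ v in 𝓝 u, v ∈ O ∧ (fderiv ℝ f v ∘L .inr ℝ E₁ E₂).IsInvertible ∧
        ∀ᶠ w in 𝓝 v, (f w = f u ↔ ψ w.1 = w.2) :=
      (hO.eventually_mem hu).and (hinv'.and hiff.eventually_nhds)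
    have hcont : Tendsto (fun x => (x, ψ x)) (𝓝 u.1) (𝓝 u) := by
      have : ContinuousAt (fun x => (x, ψ x)) u.1 := continuousAt_id.prodMk hψs.continuousAt
      have h2 := this.tendsto
      simpa [hψu] using h2
    filter_upwards [hcont.eventually hW] with x ⟨hxO, hxinv, hxe⟩
    have hfx : f (x, ψ x) = f u := hxe.self_of_nhds.2 rfl
    set ψ' := (hfa _ hxO).implicitFunction hn hxinv
    have hψ'x : ψ' x = ψ x := (hfa _ hxO).implicitFunction_apply_self hn hxinv
    have hψ's : ContDiffAt ℝ ∞ ψ' x := (hfa _ hxO).contDiffAt_implicitFunction hn hxinv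
    have hcont' : Tendsto (fun y => (y, ψ' y)) (𝓝 x) (𝓝 (x, ψ x)) := by
      have h1 : ContinuousAt (fun y => (y, ψ' y)) x := continuousAt_id.prodMk hψ's.continuousAt
      have h2 := h1.tendsto
      simpa [hψ'x] using h2
    have heq : ∀ᶠ y in 𝓝 x, f (y, ψ' y) = f (x, ψ x) :=
      (hfa _ hxO).eventually_apply_implicitFunction hn hxinv
    refine hψ's.congr_of_eventuallyEq ?_
    filter_upwards [heq, hcont'.eventually hxe] with y hy hy'
    exact hy'.1 (hy.trans hfx)
  · filter_upwards [(hfa u hu).eventually_apply_eq_iff_implicitFunction hn hinv] with v hv h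
    exact hv.1 h

section NearestPoint

variable {k : ℕ} {S : Set (Euc k)}

theorem nearestPoint_spec (hS : IsCompact S) (hne : S.Nonempty) (z : Euc k) :
    nearestPoint S z ∈ S ∧ ∀ y ∈ S, dist z (nearestPoint S z) ≤ dist z y := by
  have h : ∃ y ∈ S, ∀ y' ∈ S, dist z y ≤ dist z y' := by
    obtain ⟨y, hy, hmin⟩ := hS.exists_isMinOn hne (f := fun y => dist z y) (by fun_prop)
    exact ⟨y, hy, fun y' hy' => hmin hy'⟩
  rw [nearestPoint, dif_pos h]
  exact Classical.choose_spec h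

theorem nearestPoint_mem (hS : IsCompact S) (hne : S.Nonempty) (z : Euc k) :
    nearestPoint S z ∈ S := (nearestPoint_spec hS hne z).1

theorem norm_sub_nearestPoint_le (hS : IsCompact S) (hne : S.Nonempty) (z : Euc k) {y : Euc k}
    (hy : y ∈ S) : ‖z - nearestPoint S z‖ ≤ ‖z - y‖ := by
  simpa [dist_eq_norm] using (nearestPoint_spec hS hne z).2 y hy

theorem nearestPoint_of_mem (hS : IsCompact S) {y : Euc k} (hy : y ∈ S) :
    nearestPoint S y = y := by
  have := norm_sub_nearestPoint_le hS ⟨y, hy⟩ y hy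
  rw [sub_self, norm_zero, norm_le_zero_iff, sub_eq_zero] at this
  exact this.symm

/-- Near a point of `S` with a local parametrization `f`, the parameter `x` of the nearest point of
`z` solves `f'(x)ᵀ (f x - z) = 0`. The derivative of the left side in `x` at a point with `f x = z`
is `f'(x)ᵀ f'(x)`, so the implicit function theorem makes the nearest point a smooth function of
`z`. -/
theorem eventually_contDiffAt_nearestPoint {n : ℕ} (hS : IsCompact S) {f : Euc n → Euc k}
    {U : Set (Euc n)} (hU : IsOpen U) (hf : ContDiffOn ℝ ∞ f U) (hfS : MapsTo f U S)
    {x₀ : Euc n} (hx₀ : x₀ ∈ U) (hinj : Function.Injective (fderiv ℝ f x₀))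
    (hopen : ∀ V ∈ 𝓝 x₀, f '' V ∈ 𝓝[S] (f x₀)) :
    ∀ᶠ z in 𝓝 (f x₀), ContDiffAt ℝ ∞ (nearestPoint S) z := by
  have hne : S.Nonempty := ⟨_, hfS hx₀⟩
  have hfa : ∀ x ∈ U, ContDiffAt ℝ ∞ f x := fun v hv => hf.contDiffAt (hU.mem_nhds hv)
  let adj : (Euc n →L[ℝ] Euc k) →L[ℝ] (Euc k →L[ℝ] Euc n) :=
    LinearMap.toContinuousLinearMap
      { toFun := fun A => ContinuousLinearMap.adjoint A
        map_add' := fun A B => map_add _ A B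
        map_smul' := fun c A => by simp }
  have hadj : ∀ (A : Euc n →L[ℝ] Euc k) (v : Euc k) (w : Euc n), ⟪adj A v, w⟫ = ⟪v, A w⟫ :=
    fun A v w => ContinuousLinearMap.adjoint_inner_left A w v
  let G : Euc k × Euc n → Euc n := fun q => adj (fderiv ℝ f q.2) (f q.2 - q.1)
  have hdf : ContDiffOn ℝ ∞ (fderiv ℝ f) U := hf.fderiv_of_isOpen hU (by simp)
  have hGs : ContDiffOn ℝ ∞ G (univ ×ˢ U) := by
    have h2 : MapsTo (Prod.snd : Euc k × Euc n → Euc n) (univ ×ˢ U) U := fun q hq => hq.2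
    have h3 : ContDiffOn ℝ ∞ (fun q : Euc k × Euc n => adj (fderiv ℝ f q.2)) (univ ×ˢ U) :=
      adj.contDiff.comp_contDiffOn (hdf.comp contDiffOn_snd h2)
    exact h3.clm_apply ((hf.comp contDiffOn_snd h2).sub contDiffOn_fst)
  have hGd : ∀ w, (fderiv ℝ G (f x₀, x₀) ∘L .inr ℝ (Euc k) (Euc n)) w
      = adj (fderiv ℝ f x₀) (fderiv ℝ f x₀ w) := by
    intro w
    have hO : IsOpen ((univ : Set (Euc k)) ×ˢ U) := isOpen_univ.prod hU
    have hd : HasFDerivAt G (fderiv ℝ G (f x₀, x₀)) (f x₀, x₀) :=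
      ((hGs.contDiffAt (hO.mem_nhds ⟨trivial, hx₀⟩)).differentiableAt (by simp)).hasFDerivAt
    have hc : HasFDerivAt (fun x : Euc n => G (f x₀, x))
        (fderiv ℝ G (f x₀, x₀) ∘L .inr ℝ (Euc k) (Euc n)) x₀ :=
      HasFDerivAt.comp (f := fun x : Euc n => (f x₀, x)) x₀ hd (hasFDerivAt_prodMk_right _ _)
    have hadjd : HasFDerivAt (fun x => adj (fderiv ℝ f x))
        (adj ∘L fderiv ℝ (fderiv ℝ f) x₀) x₀ :=
      adj.hasFDerivAt.comp x₀ (((hdf.contDiffAt (hU.mem_nhds hx₀)).differentiableAt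
        (by simp)).hasFDerivAt)
    have hfd : HasFDerivAt (fun x => f x - f x₀) (fderiv ℝ f x₀) x₀ :=
      (((hfa x₀ hx₀).differentiableAt (by simp)).hasFDerivAt).sub_const _
    have := hc.unique (hadjd.clm_apply hfd)
    rw [this]
    simp
  have hinv : (fderiv ℝ G (f x₀, x₀) ∘L .inr ℝ (Euc k) (Euc n)).IsInvertible := by
    set B := fderiv ℝ G (f x₀, x₀) ∘L .inr ℝ (Euc k) (Euc n)
    have hBi : Function.Injective B := by
      rw [injective_iff_map_eq_zero]
      intro w hw
      rw [hGd] at hw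
      have h1 : ⟪adj (fderiv ℝ f x₀) (fderiv ℝ f x₀ w), w⟫ = 0 := by rw [hw, inner_zero_left]
      rw [hadj, inner_self_eq_zero] at h1
      exact (injective_iff_map_eq_zero _).1 hinj w h1
    exact ⟨(LinearEquiv.ofInjectiveEndo (B : Euc n →ₗ[ℝ] Euc n) hBi).toContinuousLinearEquiv,
      by ext w; rfl⟩
  obtain ⟨ψ, hψ0, hψs, hψ⟩ := exists_implicit_eventually_contDiffAt (isOpen_univ.prod hU) hGs
    (u := (f x₀, x₀)) ⟨trivial, hx₀⟩ hinv
  have hG0 : G (f x₀, x₀) = 0 := by simp [G]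
  rw [hG0, nhds_prod_eq] at hψ
  obtain ⟨pa, hA, pb, hB, hAB⟩ := eventually_prod_iff.1 hψ
  have hV : {x | pb x ∧ x ∈ U} ∈ 𝓝 x₀ := hB.and (hU.eventually_mem hx₀)
  obtain ⟨ε, hε, hball⟩ := Metric.mem_nhdsWithin_iff.1 (hopen _ hV)
  have heq : ∀ᶠ z in 𝓝 (f x₀), nearestPoint S z = f (ψ z) := by
    filter_upwards [hA, Metric.ball_mem_nhds (f x₀) (half_pos hε)] with z hz hzε
    have hzs := nearestPoint_spec hS hne z
    have h1 : nearestPoint S z ∈ Metric.ball (f x₀) ε := by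
      have h2 := hzs.2 _ (hfS hx₀)
      rw [Metric.mem_ball] at hzε ⊢
      linarith [dist_triangle_left (nearestPoint S z) (f x₀) z]
    obtain ⟨b, ⟨hb, hbU⟩, hbz⟩ := hball ⟨h1, hzs.1⟩
    have hmin : IsLocalMin (fun x => ‖f x - z‖ ^ 2) b := by
      filter_upwards [hU.mem_nhds hbU] with x hx
      have h3 := hzs.2 _ (hfS hx)
      rw [← hbz, dist_comm, dist_comm z, dist_eq_norm, dist_eq_norm] at h3
      gcongr
    have hder : HasFDerivAt (fun x => f x - z) (fderiv ℝ f b) b :=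
      (((hfa b hbU).differentiableAt (by simp)).hasFDerivAt).sub_const _
    have h4 := hmin.hasFDerivAt_eq_zero hder.norm_sq
    have hGb : G (z, b) = 0 := by
      refine ext_inner_right ℝ fun w => ?_
      have h5 := congrArg (fun L => L w) h4
      simp only [G, hadj, inner_zero_left, inner_sub_left]
      simpa [inner_sub_left] using h5
    have h6 : ψ z = b := hAB hz hb hGb
    rw [h6, hbz]
  have hψc : Tendsto ψ (𝓝 (f x₀)) (𝓝 x₀) := by
    have := hψs.self_of_nhds.continuousAt.tendsto
    simpa [hψ0] using this
  filter_upwards [heq.eventually_nhds, hψs, hψc.eventually (hU.eventually_mem hx₀)] with z h1 h2 h3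
  exact ((hfa _ h3).comp z h2).congr_of_eventuallyEq h1

end NearestPoint

section Cutoff

variable {k : ℕ} {S : Set (Euc k)}

/-- A globally smooth, compactly supported map which is the nearest point projection near `S`. -/
theorem exists_smooth_extension_nearestPoint (hS : IsCompact S)
    (hsm : ∀ y ∈ S, ∀ᶠ z in 𝓝 y, ContDiffAt ℝ ∞ (nearestPoint S) z) :
    ∃ F : Euc k → Euc k, ContDiff ℝ ∞ F ∧ HasCompactSupport F ∧ ∃ δ > 0, ∀ y ∈ S, ∀ z,
      ‖z - y‖ < δ → F z = nearestPoint S z := by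
  set O : Set (Euc k) := interior {z | ContDiffAt ℝ ∞ (nearestPoint S) z}
  have hSO : S ⊆ O := fun y hy => mem_interior_iff_mem_nhds.2 (hsm y hy)
  obtain ⟨δ, hδ, hδO⟩ := hS.exists_cthickening_subset_open isOpen_interior hSO
  have ht : IsCompact (Metric.cthickening δ S) := hS.cthickening
  have hSi : S ⊆ interior (Metric.cthickening δ S) :=
    (Metric.self_subset_thickening hδ S).trans (Metric.thickening_subset_interior_cthickening δ S)
  obtain ⟨χ, hχ1, hχ0, -⟩ :=
    exists_contMDiffMap_one_nhds_of_subset_interior (n := (⊤ : ℕ∞)) 𝓘(ℝ, Euc k) hS.isClosed hSi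
  have hχs : ContDiff ℝ ∞ χ := χ.contMDiff.contDiff
  have hsupp : tsupport χ ⊆ Metric.cthickening δ S := by
    refine closure_minimal (fun z hz => ?_) Metric.isClosed_cthickening
    by_contra h
    exact hz (hχ0 z h)
  refine ⟨fun z => χ z • nearestPoint S z, ?_, ?_, ?_⟩
  · refine contDiff_iff_contDiffAt.2 fun z => ?_
    by_cases hz : z ∈ tsupport χ
    · exact hχs.contDiffAt.smul (interior_subset (hδO (hsupp hz)))
    · refine contDiffAt_const (c := (0 : Euc k)) |>.congr_of_eventuallyEq ?_
      filter_upwards [(isClosed_tsupport _).isOpen_compl.mem_nhds hz] with w hw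
      rw [image_eq_zero_of_notMem_tsupport hw, zero_smul]
  · exact (HasCompactSupport.intro' ht Metric.isClosed_cthickening fun z hz => by
      rw [hχ0 z hz, zero_smul])
  · obtain ⟨W, hWo, hSW, hW⟩ := eventually_nhdsSet_iff_exists.1 hχ1
    obtain ⟨ε, hε, hεW⟩ := hS.exists_thickening_subset_open hWo hSW
    refine ⟨ε, hε, fun y hy z hz => ?_⟩
    have : z ∈ Metric.thickening ε S :=
      Metric.mem_thickening_iff.2 ⟨y, hy, by rwa [dist_eq_norm]⟩
    simp only [hW z (hεW this), one_smul]

/-- An idempotent `P` with `‖1 - P‖ ≤ 1` is an orthogonal projection. -/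
theorem inner_apply_comm_of_idempotent {E : Type*} [NormedAddCommGroup E] [InnerProductSpace ℝ E]
    {P : E →L[ℝ] E} (hP : ∀ v, P (P v) = P v) (hle : ∀ v, ‖v - P v‖ ≤ ‖v‖) (v w : E) :
    ⟪P v, w⟫ = ⟪v, P w⟫ := by
  have key : ∀ a b : E, ⟪P a, b - P b⟫ = 0 := by
    intro a b
    by_contra hne
    set c := ⟪P a, b - P b⟫ with hc
    -- `s ↦ ‖b - P b + s P a‖²` is minimal at `s = 0`
    have hmin : ∀ s : ℝ, 0 ≤ 2 * s * c + s ^ 2 * ‖P a‖ ^ 2 := by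
      intro s
      have h1 := hle (b - P b + s • P a)
      have h2 : b - P b + s • P a - P (b - P b + s • P a) = b - P b := by
        simp [hP]
      rw [h2] at h1
      have h3 : ‖b - P b‖ ^ 2 ≤ ‖b - P b + s • P a‖ ^ 2 := by gcongr
      rw [norm_add_sq_real, inner_smul_right, norm_smul, mul_pow, Real.norm_eq_abs, sq_abs,
        real_inner_comm, ← hc] at h3
      linarith
    have hPa : 0 < ‖P a‖ ^ 2 := by
      have : P a ≠ 0 := fun h => hne (by rw [hc, h, inner_zero_left])
      positivity
    have h4 := hmin (-(c / ‖P a‖ ^ 2))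
    have h5 : 2 * -(c / ‖P a‖ ^ 2) * c + (-(c / ‖P a‖ ^ 2)) ^ 2 * ‖P a‖ ^ 2
        = -(c ^ 2 / ‖P a‖ ^ 2) := by field_simp; ring
    rw [h5] at h4
    have : 0 < c ^ 2 / ‖P a‖ ^ 2 := by positivity
    linarith
  have h1 := key v w
  have h2 := key w v
  rw [inner_sub_right] at h1 h2
  have h3 : ⟪P w, v⟫ = ⟪v, P w⟫ := real_inner_comm _ _
  have h4 : ⟪P w, P v⟫ = ⟪P v, P w⟫ := real_inner_comm _ _
  linarith

theorem eq_self_of_mem (hS : IsCompact S) {F : Euc k → Euc k} {δ : ℝ} (hδ : 0 < δ)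
    (hFn : ∀ y ∈ S, ∀ z, ‖z - y‖ < δ → F z = nearestPoint S z) {y : Euc k} (hy : y ∈ S) :
    F y = y := by
  rw [hFn y hy y (by simpa using hδ), nearestPoint_of_mem hS hy]

/-- The differential of the nearest point projection at a point of `S` is self-adjoint: it is
idempotent because `Π ∘ Π = Π`, and `‖v - P v‖ ≤ ‖v‖` is the limit of `|z - Π z| ≤ |z - y|`. -/
theorem inner_fderiv_comm (hS : IsCompact S) {F : Euc k → Euc k} (hF : ContDiff ℝ ∞ F) {δ : ℝ}
    (hδ : 0 < δ) (hFn : ∀ y ∈ S, ∀ z, ‖z - y‖ < δ → F z = nearestPoint S z) {y : Euc k}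
    (hy : y ∈ S) (v w : Euc k) : ⟪fderiv ℝ F y v, w⟫ = ⟪v, fderiv ℝ F y w⟫ := by
  have hne : S.Nonempty := ⟨y, hy⟩
  have hd : ∀ z, HasFDerivAt F (fderiv ℝ F z) z := fun z =>
    (hF.differentiable (by simp) z).hasFDerivAt
  have hFy : F y = y := eq_self_of_mem hS hδ hFn hy
  have hnear : ∀ᶠ z in 𝓝 y, F z = nearestPoint S z := by
    filter_upwards [Metric.ball_mem_nhds y hδ] with z hz
    exact hFn y hy z (by simpa [dist_eq_norm] using hz)
  refine inner_apply_comm_of_idempotent (P := fderiv ℝ F y) (fun v => ?_) (fun v => ?_) v w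
  · have h1 : HasFDerivAt (F ∘ F) (fderiv ℝ F y ∘L fderiv ℝ F y) y := by
      have := hd (F y)
      rw [hFy] at this
      exact HasFDerivAt.comp y (hFy.symm ▸ this) (hd y)
    have h2 : (F ∘ F) =ᶠ[𝓝 y] F := by
      filter_upwards [hnear] with z hz
      rw [Function.comp_apply, hz]
      exact eq_self_of_mem hS hδ hFn (nearestPoint_mem hS hne z)
    have h3 := (h1.congr_of_eventuallyEq h2.symm).unique (hd y)
    exact congrArg (fun L => L v) h3
  · have hl : HasDerivAt (fun t : ℝ => y + t • v) v 0 := by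
      simpa using ((hasDerivAt_id (0 : ℝ)).smul_const v).const_add y
    have hFl : HasDerivAt (fun t : ℝ => F (y + t • v)) (fderiv ℝ F y v) 0 := by
      have h0 : HasFDerivAt F (fderiv ℝ F y) (y + (0 : ℝ) • v) := by simpa using hd y
      exact h0.comp_hasDerivAt (0 : ℝ) hl
    have hs := (hl.sub hFl).tendsto_slope_zero
    simp only [zero_add, zero_smul, add_zero, hFy, sub_self, sub_zero, Pi.sub_apply] at hs
    have hc : Tendsto (fun t : ℝ => y + t • v) (𝓝[≠] 0) (𝓝 y) := by
      have := hl.continuousAt.tendsto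
      simp only [zero_smul, add_zero] at this
      exact this.mono_left nhdsWithin_le_nhds
    refine le_of_tendsto hs.norm ?_
    filter_upwards [hc.eventually hnear, self_mem_nhdsWithin] with t ht ht0
    have h1 := norm_sub_nearestPoint_le hS hne (y + t • v) hy
    rw [← ht, add_sub_cancel_left, norm_smul] at h1
    rw [norm_smul, norm_inv]
    rwa [inv_mul_le_iff₀ (norm_pos_iff.2 ht0)]

end Cutoff

/-- The nearest point projection onto an isometrically embedded compact manifold is smooth near
the manifold. -/
theorem IsIsometricEmbedding.eventually_contDiffAt_nearestPoint {n k : ℕ} {N : Type*}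
    [TopologicalSpace N] [ChartedSpace (Euc n) N] [IsManifold (𝓡 n) ∞ N] [CompactSpace N]
    {h : Metric (𝓡 n) N} {ι : N → Euc k} (hι : IsIsometricEmbedding h ι) (q : N) :
    ∀ᶠ z in 𝓝 (ι q), ContDiffAt ℝ ∞ (nearestPoint (range ι)) z := by
  set c := extChartAt (𝓡 n) q
  have hq : c.symm (c q) = q := extChartAt_to_inv q
  have hsm : ContMDiffOn 𝓘(ℝ, Euc n) 𝓘(ℝ, Euc k) ∞ (ι ∘ c.symm) c.target :=
    hι.contMDiff.comp_contMDiffOn (contMDiffOn_extChartAt_symm q)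
  have hU : IsOpen c.target := isOpen_extChartAt_target q
  have hmem : c q ∈ c.target := mem_extChartAt_target q
  have key := PHarmonic.eventually_contDiffAt_nearestPoint (isCompact_range hι.contMDiff.continuous)
    hU (contMDiffOn_iff_contDiffOn.1 hsm) (fun x _ => mem_range_self _) hmem ?_ ?_
  · simpa [hq] using key
  · have hcs : MDifferentiableAt 𝓘(ℝ, Euc n) (𝓡 n) c.symm (c q) :=
      ((contMDiffOn_extChartAt_symm q).contMDiffAt (hU.mem_nhds hmem)).mdifferentiableAt
        (n := ∞) (by simp)
    have hιd : MDifferentiableAt (𝓡 n) 𝓘(ℝ, Euc k) ι (c.symm (c q)) :=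
      (hι.contMDiff.contMDiffAt).mdifferentiableAt (by simp)
    rw [← mfderiv_eq_fderiv, mfderiv_comp (I' := 𝓡 n) (c q) hιd hcs]
    have hinv : (mfderiv 𝓘(ℝ, Euc n) (𝓡 n) c.symm (c q)).IsInvertible := by
      have := isInvertible_mfderivWithin_extChartAt_symm (I := 𝓡 n) hmem
      rwa [ModelWithCorners.range_eq_univ, mfderivWithin_univ] at this
    have h1 : Function.Injective (mfderiv (𝓡 n) 𝓘(ℝ, Euc k) ι (c.symm (c q))) := by
      refine (injective_iff_map_eq_zero _).2 fun v hv => ?_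
      by_contra hne
      have h2 := h.pos _ v hne
      rw [← hι.isometric] at h2
      have h3 : dif (𝓡 n) ι (c.symm (c q)) v = 0 := hv
      rw [h3, inner_zero_left] at h2
      exact lt_irrefl _ h2
    exact h1.comp hinv.injective
  · intro V hV
    have h1 : c.symm '' V ∈ 𝓝 q := by
      have h2 := map_extChartAt_symm_nhdsWithin_range (I := 𝓡 n) q
      rw [ModelWithCorners.range_eq_univ, nhdsWithin_univ] at h2
      rw [← h2]
      exact image_mem_map hV
    rw [image_comp, Function.comp_apply, hq, ← hι.isEmbedding.map_nhds_eq]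
    exact image_mem_map h1

/-! ### Fields of frame components -/

/-- Linear maps `ℝᵐ → ℝᵏ`, given by their values on a basis, with the Hilbert–Schmidt norm. It is
the space of the components of differentials in an orthonormal frame. (It is not an abbreviation, so
that its topology is found only through its norm.) -/
def Fld (k m : ℕ) : Type := PiLp 2 (fun _ : Fin m => Euc k)

section Fld

variable {k m : ℕ}

instance : NormedAddCommGroup (Fld k m) :=
  inferInstanceAs (NormedAddCommGroup (PiLp 2 (fun _ : Fin m => Euc k)))

instance : InnerProductSpace ℝ (Fld k m) :=
  inferInstanceAs (InnerProductSpace ℝ (PiLp 2 (fun _ : Fin m => Euc k)))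

instance : SecondCountableTopology (Fld k m) :=
  inferInstanceAs (SecondCountableTopology (PiLp 2 (fun _ : Fin m => Euc k)))

/-- The field with the components `f`. -/
def Fld.mk (f : Fin m → Euc k) : Fld k m := WithLp.toLp 2 f

/-- The components of a field. -/
def Fld.comp (A : Fld k m) (i : Fin m) : Euc k := (show PiLp 2 (fun _ : Fin m => Euc k) from A) i

@[simp] theorem Fld.comp_mk (f : Fin m → Euc k) (i : Fin m) : (Fld.mk f).comp i = f i := rfl

@[ext] theorem Fld.ext {A B : Fld k m} (h : ∀ i, A.comp i = B.comp i) : A = B := PiLp.ext h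

@[simp] theorem Fld.comp_add (A B : Fld k m) (i : Fin m) :
    (A + B).comp i = A.comp i + B.comp i := rfl

@[simp] theorem Fld.comp_sub (A B : Fld k m) (i : Fin m) :
    (A - B).comp i = A.comp i - B.comp i := rfl

@[simp] theorem Fld.comp_smul (c : ℝ) (A : Fld k m) (i : Fin m) :
    (c • A).comp i = c • A.comp i := rfl

theorem Fld.inner_eq (A B : Fld k m) : ⟪A, B⟫ = ∑ i, ⟪A.comp i, B.comp i⟫ := rfl

theorem Fld.norm_sq (A : Fld k m) : ‖A‖ ^ 2 = ∑ i, ‖A.comp i‖ ^ 2 := by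
  simp_rw [← real_inner_self_eq_norm_sq, Fld.inner_eq]

theorem Fld.continuous_mk : Continuous (Fld.mk : (Fin m → Euc k) → Fld k m) :=
  PiLp.continuous_toLp 2 _

theorem Fld.continuous_comp (i : Fin m) : Continuous fun A : Fld k m => A.comp i :=
  PiLp.continuous_apply 2 (fun _ : Fin m => Euc k) i

/-- Composition `L ∘ A` of an endomorphism `L` of `ℝᵏ` with `A`, in components. -/
def lift : (Euc k →L[ℝ] Euc k) →L[ℝ] Fld k m →L[ℝ] Fld k m :=
  LinearMap.mkContinuous₂
    (LinearMap.mk₂ ℝ (fun (L : Euc k →L[ℝ] Euc k) (A : Fld k m) => Fld.mk fun i => L (A.comp i))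
      (fun L L' A => by ext; simp) (fun c L A => by ext; simp)
      (fun L A A' => by ext; simp) (fun c L A => by ext; simp)) 1
    (by
      intro L A
      rw [one_mul]
      refine le_of_sq_le_sq ?_ (by positivity)
      rw [mul_pow, Fld.norm_sq, Fld.norm_sq, Finset.mul_sum]
      refine Finset.sum_le_sum fun i _ => ?_
      rw [← mul_pow]
      exact pow_le_pow_left₀ (norm_nonneg _) (L.le_opNorm _) 2)

@[simp] theorem comp_lift (L : Euc k →L[ℝ] Euc k) (A : Fld k m) (i : Fin m) :
    (lift L A).comp i = L (A.comp i) := rfl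

theorem norm_lift_le (L : Euc k →L[ℝ] Euc k) (A : Fld k m) : ‖lift L A‖ ≤ ‖L‖ * ‖A‖ := by
  have h1 : ‖(lift : _ →L[ℝ] Fld k m →L[ℝ] Fld k m) L‖ ≤ 1 * ‖L‖ :=
    (lift.le_opNorm L).trans (by
      gcongr
      exact LinearMap.mkContinuous₂_norm_le _ zero_le_one _)
  rw [one_mul] at h1
  exact ((lift L).le_opNorm A).trans (by gcongr)

theorem inner_lift_comm {L : Euc k →L[ℝ] Euc k} (hL : ∀ v w, ⟪L v, w⟫ = ⟪v, L w⟫) (A B : Fld k m) :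
    ⟪lift L A, B⟫ = ⟪A, lift L B⟫ := by
  simp [Fld.inner_eq, hL]

/-- The components of `v ↦ ⟪z, A v⟫ w`. -/
def tensor (z : Euc k) (A : Fld k m) (w : Euc k) : Fld k m := Fld.mk fun i => ⟪z, A.comp i⟫ • w

@[simp] theorem comp_tensor (z : Euc k) (A : Fld k m) (w : Euc k) (i : Fin m) :
    (tensor z A w).comp i = ⟪z, A.comp i⟫ • w := rfl

theorem norm_tensor_le (z : Euc k) (A : Fld k m) (w : Euc k) :
    ‖tensor z A w‖ ≤ ‖z‖ * ‖A‖ * ‖w‖ := by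
  refine le_of_sq_le_sq ?_ (by positivity)
  rw [mul_pow, mul_pow, Fld.norm_sq (tensor z A w), Fld.norm_sq A, Finset.mul_sum, Finset.sum_mul]
  refine Finset.sum_le_sum fun i _ => ?_
  rw [← mul_pow, ← mul_pow, comp_tensor, norm_smul]
  refine pow_le_pow_left₀ (by positivity) ?_ 2
  gcongr
  exact norm_inner_le_norm _ _

theorem continuous_tensor :
    Continuous fun q : Euc k × Fld k m × Euc k => tensor q.1 q.2.1 q.2.2 := by
  unfold tensor
  refine Fld.continuous_mk.comp (continuous_pi fun i => ?_)
  have := Fld.continuous_comp (k := k) i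
  fun_prop

end Fld

/-! ### Dominated subsequences and the derivative of the energy -/

section Analysis

variable {X : Type*} [MeasurableSpace X] {μ : Measure X}

/-- A sequence which tends to zero in `Lᵖ` has a subsequence which tends to zero almost everywhere
and is dominated by a function in `Lᵖ`: if `∫ |f_j|ᵖ ≤ 2⁻ʲ`, take `h = (∑ |f_j|ᵖ)^(1/p)`. -/
theorem exists_dominated_subseq {p : ℝ} (hp : 0 < p) {f : ℕ → X → ℝ} (hf0 : ∀ j x, 0 ≤ f j x)
    (hfm : ∀ j, AEStronglyMeasurable (f j) μ)
    (hlim : Tendsto (fun j => eLpNorm (f j) (ENNReal.ofReal p) μ) atTop (𝓝 0)) :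
    ∃ ns : ℕ → ℕ, StrictMono ns ∧ ∃ h : X → ℝ, (∀ x, 0 ≤ h x) ∧
      MemLp h (ENNReal.ofReal p) μ ∧ ∀ᵐ x ∂μ, (∀ j, f (ns j) x ≤ h x) ∧
        Tendsto (fun j => f (ns j) x) atTop (𝓝 0) := by
  have hp0 : ENNReal.ofReal p ≠ 0 := by simpa using hp
  have hpt : ENNReal.ofReal p ≠ ⊤ := ENNReal.ofReal_ne_top
  have hpr : (ENNReal.ofReal p).toReal = p := ENNReal.toReal_ofReal hp.le
  set g : ℕ → X → ℝ≥0∞ := fun j x => ENNReal.ofReal (f j x) ^ p with hg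
  have hgm : ∀ j, AEMeasurable (g j) μ := fun j => (hfm j).aemeasurable.ennreal_ofReal.pow_const _
  have hgf : ∀ j x, ((g j x).toReal) ^ (1 / p) = f j x := fun j x => by
    rw [hg, ← ENNReal.toReal_rpow, ENNReal.toReal_ofReal (hf0 j x), ← Real.rpow_mul (hf0 j x),
      mul_one_div_cancel hp.ne', Real.rpow_one]
  have hint : Tendsto (fun j => ∫⁻ x, g j x ∂μ) atTop (𝓝 0) := by
    have h1 : ∀ j, ∫⁻ x, g j x ∂μ = eLpNorm (f j) (ENNReal.ofReal p) μ ^ p := fun j => by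
      rw [eLpNorm_eq_lintegral_rpow_enorm_toReal hp0 hpt, hpr, ← ENNReal.rpow_mul,
        one_div_mul_cancel hp.ne', ENNReal.rpow_one]
      simp only [hg, Real.enorm_of_nonneg (hf0 _ _)]
    simp only [h1]
    have := (ENNReal.continuous_rpow_const (y := p)).tendsto 0 |>.comp hlim
    simpa [ENNReal.zero_rpow_of_pos hp, Function.comp_def] using this
  obtain ⟨ns, hns, hle⟩ := extraction_forall_of_eventually'
    (P := fun j n => ∫⁻ x, g n x ∂μ ≤ (2 : ℝ≥0∞)⁻¹ ^ j) fun j => by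
      have := (hint.eventually_le_const (u := (2 : ℝ≥0∞)⁻¹ ^ j)
        (ENNReal.pow_pos (by simp) j))
      exact eventually_atTop.1 this
  set G : X → ℝ≥0∞ := fun x => ∑' j, g (ns j) x with hG
  have hGm : AEMeasurable G μ := AEMeasurable.tsum fun j => hgm (ns j)
  have hGint : ∫⁻ x, G x ∂μ ≠ ⊤ := by
    rw [lintegral_tsum fun j => hgm (ns j)]
    refine ne_top_of_le_ne_top ?_ (ENNReal.tsum_le_tsum hle)
    rw [ENNReal.tsum_geometric]
    simp
  have hGfin : ∀ᵐ x ∂μ, G x < ⊤ := ae_lt_top' hGm hGint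
  refine ⟨ns, hns, fun x => (G x).toReal ^ (1 / p), fun x => by positivity, ⟨?_, ?_⟩, ?_⟩
  · exact (hGm.ennreal_toReal.pow_const _).aestronglyMeasurable
  · rw [eLpNorm_lt_top_iff_lintegral_rpow_enorm_lt_top hp0 hpt, hpr]
    refine lt_of_le_of_lt (lintegral_mono fun x => ?_) (lt_top_iff_ne_top.2 hGint)
    rw [Real.enorm_of_nonneg (by positivity), ENNReal.ofReal_rpow_of_nonneg (by positivity) hp.le,
      ← Real.rpow_mul (by positivity), one_div_mul_cancel hp.ne', Real.rpow_one]
    exact ENNReal.ofReal_toReal_le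
  · filter_upwards [hGfin] with x hx
    refine ⟨fun j => ?_, ?_⟩
    · rw [← hgf]
      have : g (ns j) x ≤ G x := ENNReal.le_tsum j
      exact Real.rpow_le_rpow (by positivity) (ENNReal.toReal_mono hx.ne this) (by positivity)
    · have h1 := ENNReal.tendsto_atTop_zero_of_tsum_ne_top hx.ne
      have h2 := (ENNReal.tendsto_toReal (by simp : (0 : ℝ≥0∞) ≠ ⊤)).comp h1
      have h3 := (Real.continuous_rpow_const (q := 1 / p) (by positivity)).tendsto 0 |>.comp h2
      rw [Real.zero_rpow (by positivity)] at h3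
      refine h3.congr fun j => ?_
      exact hgf (ns j) x

theorem integrable_rpow_of_memLp {p : ℝ} (hp : 0 < p) {h : X → ℝ} (h0 : ∀ x, 0 ≤ h x)
    (hh : MemLp h (ENNReal.ofReal p) μ) : Integrable (fun x => h x ^ p) μ := by
  have := hh.integrable_norm_rpow (by simpa using hp) ENNReal.ofReal_ne_top
  rw [ENNReal.toReal_ofReal hp.le] at this
  exact this.congr (.of_forall fun x => by simp [abs_of_nonneg (h0 x)])

variable {k m : ℕ}

theorem rpow_sub_two_mul_sq {p s : ℝ} (hp : 2 ≤ p) (hs : 0 ≤ s) : s ^ (p - 2) * s ^ 2 = s ^ p := by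
  rw [← Real.rpow_natCast s 2, ← Real.rpow_add' hs (by norm_num; linarith)]
  norm_num

theorem aestronglyMeasurable_lift {L : X → Euc k →L[ℝ] Euc k} {A : X → Fld k m}
    (hL : AEStronglyMeasurable L μ) (hA : AEStronglyMeasurable A μ) :
    AEStronglyMeasurable (fun x => lift (L x) (A x)) μ :=
  (lift : _ →L[ℝ] Fld k m →L[ℝ] Fld k m).aestronglyMeasurable_comp₂ hL hA

theorem hasDerivAt_norm_rpow_lift {F : Euc k → Euc k} (hF : ContDiff ℝ ∞ F) {p : ℝ} (hp : 1 < p)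
    (a b : Euc k) (A B : Fld k m) (t : ℝ) :
    HasDerivAt (fun t : ℝ => ‖lift (fderiv ℝ F (a + t • b)) (A + t • B)‖ ^ p)
      (p * (‖lift (fderiv ℝ F (a + t • b)) (A + t • B)‖ ^ (p - 2) *
        ⟪lift (fderiv ℝ F (a + t • b)) (A + t • B),
          lift (fderiv ℝ (fderiv ℝ F) (a + t • b) b) (A + t • B) +
            lift (fderiv ℝ F (a + t • b)) B⟫)) t := by
  have hdF : ContDiff ℝ ∞ (fderiv ℝ F) := hF.fderiv_right (by simp)
  have h1 : HasDerivAt (fun t : ℝ => a + t • b) b t := by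
    simpa using ((hasDerivAt_id t).smul_const b).const_add a
  have h2 : HasDerivAt (fun t : ℝ => A + t • B) B t := by
    simpa using ((hasDerivAt_id t).smul_const B).const_add A
  have h3 : HasDerivAt (fun t : ℝ => fderiv ℝ F (a + t • b))
      (fderiv ℝ (fderiv ℝ F) (a + t • b) b) t :=
    ((hdF.differentiable (by simp) _).hasFDerivAt).comp_hasDerivAt t h1
  have h4 := (lift : _ →L[ℝ] Fld k m →L[ℝ] Fld k m).hasFDerivAt.comp_hasDerivAt t h3
  have h5 := h4.clm_apply h2
  have h6 := (hasFDerivAt_norm_rpow _ hp).comp_hasDerivAt t h5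
  exact h6.congr_deriv (mul_assoc _ _ _)

/-- The first variation of `∫ |dF(a + t b)(A + t B)|ᵖ`. -/
theorem hasDerivAt_integral_norm_rpow [IsFiniteMeasure μ] {F : Euc k → Euc k}
    (hF : ContDiff ℝ ∞ F) {K : ℝ}
    (hK1 : ∀ z, ‖fderiv ℝ F z‖ ≤ K) (hK2 : ∀ z, ‖fderiv ℝ (fderiv ℝ F) z‖ ≤ K) {p : ℝ}
    (hp : 2 ≤ p) {a b : X → Euc k} {A B : X → Fld k m} (ha : AEStronglyMeasurable a μ)
    (hb : AEStronglyMeasurable b μ) (hB : AEStronglyMeasurable B μ)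
    (hA : MemLp A (ENNReal.ofReal p) μ) {c : ℝ} (hbc : ∀ x, ‖b x‖ ≤ c) (hBc : ∀ x, ‖B x‖ ≤ c) :
    HasDerivAt (fun t : ℝ => ∫ x, ‖lift (fderiv ℝ F (a x + t • b x)) (A x + t • B x)‖ ^ p ∂μ)
      (∫ x, p * (‖lift (fderiv ℝ F (a x)) (A x)‖ ^ (p - 2) * ⟪lift (fderiv ℝ F (a x)) (A x),
        lift (fderiv ℝ (fderiv ℝ F) (a x) (b x)) (A x) + lift (fderiv ℝ F (a x)) (B x)⟫) ∂μ) 0 := by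
  have hp0 : 0 < p := by linarith
  have hK0 : 0 ≤ K := (norm_nonneg _).trans (hK1 0)
  have hdF : ContDiff ℝ ∞ (fderiv ℝ F) := hF.fderiv_right (by simp)
  have hddF : ContDiff ℝ ∞ (fderiv ℝ (fderiv ℝ F)) := hdF.fderiv_right (by simp)
  let Z : ℝ → X → Fld k m := fun t x => lift (fderiv ℝ F (a x + t • b x)) (A x + t • B x)
  let Z' : ℝ → X → Fld k m := fun t x =>
    lift (fderiv ℝ (fderiv ℝ F) (a x + t • b x) (b x)) (A x + t • B x) +
      lift (fderiv ℝ F (a x + t • b x)) (B x)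
  have hZp : ∀ t x, HasDerivAt (fun t => ‖Z t x‖ ^ p)
      (p * (‖Z t x‖ ^ (p - 2) * ⟪Z t x, Z' t x⟫)) t := fun t x =>
    hasDerivAt_norm_rpow_lift hF (by linarith) _ _ _ _ t
  have hline : ∀ t : ℝ, AEStronglyMeasurable (fun x => a x + t • b x) μ := fun t =>
    ha.add (hb.const_smul t)
  have hLine : ∀ t : ℝ, AEStronglyMeasurable (fun x => A x + t • B x) μ := fun t =>
    hA.1.add (hB.const_smul t)
  have hZm : ∀ t, AEStronglyMeasurable (Z t) μ := fun t =>
    aestronglyMeasurable_lift (hdF.continuous.comp_aestronglyMeasurable (hline t)) (hLine t)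
  have hcont : Continuous fun q : Euc k × Euc k => fderiv ℝ (fderiv ℝ F) q.1 q.2 :=
    (hddF.continuous.comp continuous_fst).clm_apply continuous_snd
  have hZm' : ∀ t, AEStronglyMeasurable (Z' t) μ := fun t =>
    (aestronglyMeasurable_lift
      (hcont.comp_aestronglyMeasurable ((hline t).prodMk hb)) (hLine t)).add
      (aestronglyMeasurable_lift (hdF.continuous.comp_aestronglyMeasurable (hline t)) hB)
  have hpow : ∀ (q : ℝ), 0 ≤ q → ∀ t, AEStronglyMeasurable (fun x => ‖Z t x‖ ^ q) μ :=
    fun q hq t => (Real.continuous_rpow_const hq).comp_aestronglyMeasurable (hZm t).norm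
  let R : X → ℝ := fun x => ‖A x‖ + (|c| + 1)
  have hR0 : ∀ x, 0 ≤ R x := fun x => by positivity
  have hRp : Integrable (fun x => R x ^ p) μ :=
    integrable_rpow_of_memLp hp0 hR0 (hA.norm.add (memLp_const _))
  have hZR : ∀ t ∈ Metric.ball (0 : ℝ) 1, ∀ x, ‖Z t x‖ ≤ K * R x := by
    intro t ht x
    have ht1 : ‖t‖ ≤ 1 := by simpa using (mem_ball_zero_iff.1 ht).le
    calc ‖Z t x‖ ≤ ‖fderiv ℝ F (a x + t • b x)‖ * ‖A x + t • B x‖ := norm_lift_le _ _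
      _ ≤ K * R x := by
        gcongr
        · exact hK1 _
        · calc ‖A x + t • B x‖ ≤ ‖A x‖ + ‖t‖ * ‖B x‖ := by
                rw [← norm_smul]; exact norm_add_le _ _
            _ ≤ ‖A x‖ + 1 * c := by gcongr; exact hBc x
            _ ≤ R x := by simp only [R]; linarith [le_abs_self c]
  have hZR' : ∀ t ∈ Metric.ball (0 : ℝ) 1, ∀ x, ‖Z' t x‖ ≤ K * |c| * R x := by
    intro t ht x
    have ht1 : ‖t‖ ≤ 1 := by simpa using (mem_ball_zero_iff.1 ht).le
    have hc : c ≤ |c| := le_abs_self c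
    have hA' : ‖A x + t • B x‖ ≤ ‖A x‖ + |c| := by
      calc ‖A x + t • B x‖ ≤ ‖A x‖ + ‖t‖ * ‖B x‖ := by
                rw [← norm_smul]; exact norm_add_le _ _
        _ ≤ ‖A x‖ + 1 * |c| := by gcongr; exact (hBc x).trans hc
        _ = _ := by ring
    calc ‖Z' t x‖ ≤ ‖fderiv ℝ (fderiv ℝ F) (a x + t • b x) (b x)‖ * ‖A x + t • B x‖ +
          ‖fderiv ℝ F (a x + t • b x)‖ * ‖B x‖ :=
          (norm_add_le _ _).trans (add_le_add (norm_lift_le _ _) (norm_lift_le _ _))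
      _ ≤ (K * |c|) * (‖A x‖ + |c|) + K * |c| := by
        gcongr
        · exact (ContinuousLinearMap.le_opNorm _ _).trans
            (mul_le_mul (hK2 _) ((hbc x).trans hc) (norm_nonneg _) hK0)
        · exact hK1 _
        · exact (hBc x).trans hc
      _ = K * |c| * R x := by simp only [R]; ring
  have key := hasDerivAt_integral_of_dominated_loc_of_deriv_le (μ := μ) (𝕜 := ℝ)
    (F := fun t x => ‖Z t x‖ ^ p) (F' := fun t x => p * (‖Z t x‖ ^ (p - 2) * ⟪Z t x, Z' t x⟫))
    (x₀ := 0) (s := Metric.ball (0 : ℝ) 1)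
    (bound := fun x => p * (K ^ (p - 2) * K * (K * |c|)) * R x ^ p)
    (Metric.ball_mem_nhds _ one_pos) (.of_forall fun t => hpow p hp0.le t) ?_
    (((hpow (p - 2) (by linarith) 0).mul ((hZm 0).inner (hZm' 0))).const_mul p) ?_
    (hRp.const_mul _) (.of_forall fun x t _ => hZp t x)
  · have h0 := key.2
    simpa [Z, Z'] using h0
  · refine Integrable.mono' (hRp.const_mul (K ^ p)) (hpow p hp0.le 0) (.of_forall fun x => ?_)
    rw [Real.norm_of_nonneg (by positivity), ← Real.mul_rpow hK0 (hR0 x)]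
    exact Real.rpow_le_rpow (norm_nonneg _) (hZR 0 (by simp) x) hp0.le
  · refine .of_forall fun x t ht => ?_
    have h1 : |⟪Z t x, Z' t x⟫| ≤ (K * R x) * (K * |c| * R x) :=
      (abs_real_inner_le_norm _ _).trans
        (mul_le_mul (hZR t ht x) (hZR' t ht x) (norm_nonneg _) (by have := hR0 x; positivity))
    have h2 : ‖Z t x‖ ^ (p - 2) ≤ (K * R x) ^ (p - 2) :=
      Real.rpow_le_rpow (norm_nonneg _) (hZR t ht x) (by linarith)
    rw [Real.norm_eq_abs, abs_mul, abs_mul, abs_of_pos hp0,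
      abs_of_nonneg (Real.rpow_nonneg (norm_nonneg _) _)]
    calc p * (‖Z t x‖ ^ (p - 2) * |⟪Z t x, Z' t x⟫|)
        ≤ p * ((K * R x) ^ (p - 2) * ((K * R x) * (K * |c| * R x))) := by
          gcongr
      _ = p * (K ^ (p - 2) * K * (K * |c|)) * (R x ^ (p - 2) * R x ^ 2) := by
          rw [Real.mul_rpow hK0 (hR0 x)]; ring
      _ = _ := by rw [rpow_sub_two_mul_sq hp (hR0 x)]

end Analysis

/-! ### The energy estimate for component fields -/

section EulerLagrange

variable {X : Type*} [MeasurableSpace X] {μ : Measure X} {k m : ℕ}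

/-- The integrand of the first variation of the `p`-energy of `F (u + t ψ)`, where `U` and `Ψ` are
the differentials of `u` and `ψ`. -/
def elDensity (p : ℝ) (F : Euc k → Euc k) (u : Euc k) (U : Fld k m) (ψ : Euc k) (Ψ : Fld k m) : ℝ :=
  ‖lift (fderiv ℝ F u) U‖ ^ (p - 2) * ⟪lift (fderiv ℝ F u) U,
    lift (fderiv ℝ (fderiv ℝ F) u ψ) U + lift (fderiv ℝ F u) Ψ⟫

theorem abs_elDensity_le {p K c h : ℝ} (hp : 2 ≤ p) {F : Euc k → Euc k} {u ψ : Euc k}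
    {U Ψ : Fld k m} (hU : lift (fderiv ℝ F u) U = U) (hK1 : ‖fderiv ℝ F u‖ ≤ K)
    (hK2 : ‖fderiv ℝ (fderiv ℝ F) u‖ ≤ K) (hψ : ‖ψ‖ ≤ c) (hΨ : ‖Ψ‖ ≤ h) :
    |elDensity p F u U ψ Ψ| ≤ K * (c + 1) * (‖U‖ + h) ^ p := by
  have hK0 : 0 ≤ K := (norm_nonneg _).trans hK1
  have hc0 : 0 ≤ c := (norm_nonneg _).trans hψ
  have hh0 : 0 ≤ h := (norm_nonneg _).trans hΨ
  have h1 : ‖lift (fderiv ℝ (fderiv ℝ F) u ψ) U + lift (fderiv ℝ F u) Ψ‖ ≤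
      K * (c + 1) * (‖U‖ + h) := by
    calc _ ≤ ‖fderiv ℝ (fderiv ℝ F) u ψ‖ * ‖U‖ + ‖fderiv ℝ F u‖ * ‖Ψ‖ :=
          (norm_add_le _ _).trans (add_le_add (norm_lift_le _ _) (norm_lift_le _ _))
      _ ≤ (K * c) * (‖U‖ + h) + K * (‖U‖ + h) := by
        gcongr
        · exact (ContinuousLinearMap.le_opNorm _ _).trans
            (mul_le_mul hK2 hψ (norm_nonneg _) hK0)
        · linarith
        · linarith [norm_nonneg U]
      _ = _ := by ring
  rw [elDensity, hU, abs_mul, abs_of_nonneg (Real.rpow_nonneg (norm_nonneg _) _)]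
  calc ‖U‖ ^ (p - 2) * |⟪U, lift (fderiv ℝ (fderiv ℝ F) u ψ) U + lift (fderiv ℝ F u) Ψ⟫|
      ≤ (‖U‖ + h) ^ (p - 2) * ((‖U‖ + h) * (K * (c + 1) * (‖U‖ + h))) := by
        refine mul_le_mul (Real.rpow_le_rpow (norm_nonneg _) (by linarith) (by linarith)) ?_
          (abs_nonneg _) (by positivity)
        refine (abs_real_inner_le_norm _ _).trans
          (mul_le_mul (by linarith) h1 (norm_nonneg _) (by positivity))
    _ = K * (c + 1) * ((‖U‖ + h) ^ (p - 2) * (‖U‖ + h) ^ 2) := by ring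
    _ = _ := by rw [rpow_sub_two_mul_sq hp (by positivity)]

theorem aestronglyMeasurable_elDensity {p : ℝ} (hp : 2 ≤ p) {F : Euc k → Euc k}
    (hF : ContDiff ℝ ∞ F) {u ψ : X → Euc k} {U Ψ : X → Fld k m} (hu : AEStronglyMeasurable u μ)
    (hψ : AEStronglyMeasurable ψ μ) (hU : AEStronglyMeasurable U μ)
    (hΨ : AEStronglyMeasurable Ψ μ) :
    AEStronglyMeasurable (fun x => elDensity p F (u x) (U x) (ψ x) (Ψ x)) μ := by
  have hdF : ContDiff ℝ ∞ (fderiv ℝ F) := hF.fderiv_right (by simp)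
  have hddF : ContDiff ℝ ∞ (fderiv ℝ (fderiv ℝ F)) := hdF.fderiv_right (by simp)
  have hcont : Continuous fun q : Euc k × Euc k => fderiv ℝ (fderiv ℝ F) q.1 q.2 :=
    (hddF.continuous.comp continuous_fst).clm_apply continuous_snd
  have h1 := aestronglyMeasurable_lift (hdF.continuous.comp_aestronglyMeasurable hu) hU
  have h2 := aestronglyMeasurable_lift (hdF.continuous.comp_aestronglyMeasurable hu) hΨ
  have h3 := aestronglyMeasurable_lift (hcont.comp_aestronglyMeasurable (hu.prodMk hψ)) hU
  exact ((Real.continuous_rpow_const (by linarith)).comp_aestronglyMeasurable h1.norm).mul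
    (h1.inner (h3.add h2))

theorem tendsto_elDensity {p : ℝ} {F : Euc k → Euc k} {u ψ' : Euc k} {U Ψ' : Fld k m}
    {ψ : ℕ → Euc k} {Ψ : ℕ → Fld k m} (hψ : Tendsto ψ atTop (𝓝 ψ')) (hΨ : Tendsto Ψ atTop (𝓝 Ψ')) :
    Tendsto (fun j => elDensity p F u U (ψ j) (Ψ j)) atTop (𝓝 (elDensity p F u U ψ' Ψ')) := by
  have c1 : Continuous fun v : Euc k => lift (fderiv ℝ (fderiv ℝ F) u v) U :=
    ((lift : _ →L[ℝ] Fld k m →L[ℝ] Fld k m).continuous.comp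
      (fderiv ℝ (fderiv ℝ F) u).continuous).clm_apply continuous_const
  have c2 : Continuous fun V : Fld k m => lift (fderiv ℝ F u) V := (lift (fderiv ℝ F u)).continuous
  have h1 := ((c1.tendsto ψ').comp hψ).add ((c2.tendsto Ψ').comp hΨ)
  have h2 := (tendsto_const_nhds (x := lift (fderiv ℝ F u) U) (f := atTop)).inner (𝕜 := ℝ) h1
  unfold elDensity
  exact h2.const_mul _

/-- The first variation passes to dominated limits of test fields. -/
theorem tendsto_integral_elDensity {p K c : ℝ} (hp : 2 ≤ p) {F : Euc k → Euc k}
    (hF : ContDiff ℝ ∞ F) (hK1 : ∀ z, ‖fderiv ℝ F z‖ ≤ K)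
    (hK2 : ∀ z, ‖fderiv ℝ (fderiv ℝ F) z‖ ≤ K) {u : X → Euc k} {U : X → Fld k m}
    (hu : AEStronglyMeasurable u μ) (hU : MemLp U (ENNReal.ofReal p) μ)
    (hFU : ∀ᵐ x ∂μ, lift (fderiv ℝ F (u x)) (U x) = U x) {ψ : ℕ → X → Euc k}
    {Ψ : ℕ → X → Fld k m} {ψ' : X → Euc k} {Ψ' : X → Fld k m} {h : X → ℝ} (h0 : ∀ x, 0 ≤ h x)
    (hh : MemLp h (ENNReal.ofReal p) μ)
    (hψ : ∀ j, AEStronglyMeasurable (ψ j) μ) (hΨ : ∀ j, AEStronglyMeasurable (Ψ j) μ)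
    (hb : ∀ᵐ x ∂μ, ∀ j, ‖ψ j x‖ ≤ c ∧ ‖Ψ j x‖ ≤ h x)
    (hl : ∀ᵐ x ∂μ, Tendsto (fun j => ψ j x) atTop (𝓝 (ψ' x)) ∧
      Tendsto (fun j => Ψ j x) atTop (𝓝 (Ψ' x))) :
    Tendsto (fun j => ∫ x, elDensity p F (u x) (U x) (ψ j x) (Ψ j x) ∂μ) atTop
      (𝓝 (∫ x, elDensity p F (u x) (U x) (ψ' x) (Ψ' x) ∂μ)) := by
  have hint : Integrable (fun x => (‖U x‖ + h x) ^ p) μ :=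
    integrable_rpow_of_memLp (by linarith) (fun x => add_nonneg (norm_nonneg _) (h0 x))
      (hU.norm.add hh)
  refine tendsto_integral_of_dominated_convergence (fun x => K * (c + 1) * (‖U x‖ + h x) ^ p)
    (fun j => aestronglyMeasurable_elDensity hp hF hu (hψ j) hU.1 (hΨ j)) (hint.const_mul _)
    (fun j => ?_) ?_
  · filter_upwards [hFU, hb] with x h1 h2
    exact abs_elDensity_le hp h1 (hK1 _) (hK2 _) (h2 j).1 (h2 j).2
  · filter_upwards [hl] with x ⟨h1, h2⟩
    exact tendsto_elDensity h1 h2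

/-- The first variation in the direction `ψ = |φ|² (u - P)`, whose differential is
`|φ|² U + 2 ⟪φ, Φ⟫ (u - P)`, controls `|U|ᵖ |φ|²` up to a multiple of `|U|ᵖ⁻² |Φ|²`. -/
theorem le_elDensity {p K r : ℝ} (hp : 2 ≤ p) {F : Euc k → Euc k} {u P φ : Euc k}
    {U Φ : Fld k m} (hU : lift (fderiv ℝ F u) U = U)
    (hsa : ∀ v w, ⟪fderiv ℝ F u v, w⟫ = ⟪v, fderiv ℝ F u w⟫)
    (hK2 : ‖fderiv ℝ (fderiv ℝ F) u‖ ≤ K) (hKr : K * r ≤ 1 / 2) (hur : ‖u - P‖ ≤ r) :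
    1 / 4 * (‖U‖ ^ p * ‖φ‖ ^ 2) - 4 * r ^ 2 * (‖U‖ ^ (p - 2) * ‖Φ‖ ^ 2) ≤
      elDensity p F u U (‖φ‖ ^ 2 • (u - P)) (‖φ‖ ^ 2 • U + (2 : ℝ) • tensor φ Φ (u - P)) := by
  have hK0 : 0 ≤ K := le_trans (norm_nonneg (fderiv ℝ (fderiv ℝ F) u)) hK2
  have hr0 : 0 ≤ r := (norm_nonneg _).trans hur
  -- The curvature term `d²F(ψ, U)` costs at most `K r ≤ 1 / 2` of the main term.
  have h1 : -(1 / 2 * ‖φ‖ ^ 2 * ‖U‖ ^ 2) ≤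
      ⟪U, lift (fderiv ℝ (fderiv ℝ F) u (‖φ‖ ^ 2 • (u - P))) U⟫ := by
    refine neg_le_of_abs_le ((abs_real_inner_le_norm _ _).trans ?_)
    have h2 : ‖fderiv ℝ (fderiv ℝ F) u (‖φ‖ ^ 2 • (u - P))‖ ≤ K * (‖φ‖ ^ 2 * r) := by
      refine (ContinuousLinearMap.le_opNorm _ _).trans (mul_le_mul hK2 ?_ (norm_nonneg _) hK0)
      rw [norm_smul, norm_pow, norm_norm]
      gcongr
    calc ‖U‖ * ‖lift (fderiv ℝ (fderiv ℝ F) u (‖φ‖ ^ 2 • (u - P))) U‖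
        ≤ ‖U‖ * (K * (‖φ‖ ^ 2 * r) * ‖U‖) := by
          gcongr
          exact (norm_lift_le _ _).trans (by gcongr)
      _ = K * r * (‖φ‖ ^ 2 * ‖U‖ ^ 2) := by ring
      _ ≤ 1 / 2 * (‖φ‖ ^ 2 * ‖U‖ ^ 2) := by gcongr
      _ = _ := by ring
  have h3 : ⟪U, lift (fderiv ℝ F u) (‖φ‖ ^ 2 • U + (2 : ℝ) • tensor φ Φ (u - P))⟫ =
      ‖φ‖ ^ 2 * ‖U‖ ^ 2 + 2 * ⟪U, tensor φ Φ (u - P)⟫ := by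
    rw [← inner_lift_comm hsa, hU, inner_add_right, inner_smul_right, inner_smul_right,
      real_inner_self_eq_norm_sq]
  -- Young's inequality, weighted so that `1 - 1 / 2 - 1 / 4` of the main term remains.
  have h4 : -(1 / 4 * ‖φ‖ ^ 2 * ‖U‖ ^ 2 + 4 * r ^ 2 * ‖Φ‖ ^ 2) ≤
      2 * ⟪U, tensor φ Φ (u - P)⟫ := by
    have h5 : |⟪U, tensor φ Φ (u - P)⟫| ≤ ‖U‖ * (‖φ‖ * ‖Φ‖ * r) :=
      (abs_real_inner_le_norm _ _).trans (by
        gcongr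
        exact (norm_tensor_le _ _ _).trans (by gcongr))
    have h6 := neg_le_of_abs_le h5
    nlinarith [sq_nonneg (1 / 2 * ‖φ‖ * ‖U‖ - 2 * r * ‖Φ‖)]
  rw [elDensity, hU, inner_add_right, h3, ← rpow_sub_two_mul_sq hp (norm_nonneg U)]
  have h7 : 1 / 4 * (‖U‖ ^ (p - 2) * ‖U‖ ^ 2 * ‖φ‖ ^ 2) - 4 * r ^ 2 * (‖U‖ ^ (p - 2) * ‖Φ‖ ^ 2) =
      ‖U‖ ^ (p - 2) * (1 / 4 * ‖φ‖ ^ 2 * ‖U‖ ^ 2 - 4 * r ^ 2 * ‖Φ‖ ^ 2) := by ring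
  rw [h7]
  refine mul_le_mul_of_nonneg_left ?_ (by positivity)
  linarith

theorem rpow_sub_two_mul_sq_le {p a b h : ℝ} (hp : 2 ≤ p) (ha : 0 ≤ a) (hb : 0 ≤ b) (hbh : b ≤ h) :
    a ^ (p - 2) * b ^ 2 ≤ (a + h) ^ p := by
  rw [← rpow_sub_two_mul_sq hp (by linarith)]
  exact mul_le_mul (Real.rpow_le_rpow ha (by linarith) (by linarith))
    (pow_le_pow_left₀ hb (by linarith) 2) (by positivity) (Real.rpow_nonneg (by linarith) _)

theorem integrable_rpow_sub_two_mul_sq {p : ℝ} (hp : 2 ≤ p) {U Φ : X → Fld k m} {h : X → ℝ}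
    (hU : MemLp U (ENNReal.ofReal p) μ) (h0 : ∀ x, 0 ≤ h x) (hh : MemLp h (ENNReal.ofReal p) μ)
    (hΦ : AEStronglyMeasurable Φ μ) (hΦh : ∀ᵐ x ∂μ, ‖Φ x‖ ≤ h x) :
    Integrable (fun x => ‖U x‖ ^ (p - 2) * ‖Φ x‖ ^ 2) μ := by
  have hint : Integrable (fun x => (‖U x‖ + h x) ^ p) μ :=
    integrable_rpow_of_memLp (by linarith) (fun x => add_nonneg (norm_nonneg _) (h0 x))
      (hU.norm.add hh)
  refine hint.mono' (((Real.continuous_rpow_const (by linarith)).comp_aestronglyMeasurable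
    hU.1.norm).mul (hΦ.norm.pow 2)) ?_
  filter_upwards [hΦh] with x hx
  rw [Real.norm_of_nonneg (by positivity)]
  exact rpow_sub_two_mul_sq_le hp (norm_nonneg _) (norm_nonneg _) hx

/-- The energy estimate for a bounded test function `φ`, from the Euler–Lagrange equation in the
direction `|φ|² (u - P)`. -/
theorem integral_norm_rpow_mul_sq_le [IsFiniteMeasure μ] {p K r c : ℝ} (hp : 2 ≤ p)
    {F : Euc k → Euc k} (hF : ContDiff ℝ ∞ F) (hK1 : ∀ z, ‖fderiv ℝ F z‖ ≤ K)
    (hK2 : ∀ z, ‖fderiv ℝ (fderiv ℝ F) z‖ ≤ K) {P : Euc k} {u φ : X → Euc k} {U Φ : X → Fld k m}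
    (hu : AEStronglyMeasurable u μ) (hU : MemLp U (ENNReal.ofReal p) μ)
    (hFU : ∀ᵐ x ∂μ, lift (fderiv ℝ F (u x)) (U x) = U x)
    (hsa : ∀ᵐ x ∂μ, ∀ v w, ⟪fderiv ℝ F (u x) v, w⟫ = ⟪v, fderiv ℝ F (u x) w⟫)
    (hKr : K * r ≤ 1 / 2) (hur : ∀ᵐ x ∂μ, ‖u x - P‖ ≤ r)
    (hφ : AEStronglyMeasurable φ μ) (hΦ : AEStronglyMeasurable Φ μ)
    (hφc : ∀ x, ‖φ x‖ ≤ c) (hΦc : ∀ x, ‖Φ x‖ ≤ c)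
    (hEL : ∫ x, elDensity p F (u x) (U x) (‖φ x‖ ^ 2 • (u x - P))
      (‖φ x‖ ^ 2 • U x + (2 : ℝ) • tensor (φ x) (Φ x) (u x - P)) ∂μ = 0) :
    Integrable (fun x => ‖U x‖ ^ p * ‖φ x‖ ^ 2) μ ∧
    ∫ x, ‖U x‖ ^ p * ‖φ x‖ ^ 2 ∂μ ≤ 16 * r ^ 2 * ∫ x, ‖U x‖ ^ (p - 2) * ‖Φ x‖ ^ 2 ∂μ := by
  have hp0 : 0 < p := by linarith
  have hUp : Integrable (fun x => ‖U x‖ ^ p) μ :=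
    integrable_rpow_of_memLp hp0 (fun x => norm_nonneg _) hU.norm
  have hX : Integrable (fun x => ‖U x‖ ^ p * ‖φ x‖ ^ 2) μ := by
    refine (hUp.mul_const (c ^ 2)).mono' (hUp.1.mul (hφ.norm.pow 2)) (.of_forall fun x => ?_)
    rw [Real.norm_of_nonneg (by positivity)]
    gcongr
    exact hφc x
  have hY : Integrable (fun x => ‖U x‖ ^ (p - 2) * ‖Φ x‖ ^ 2) μ :=
    integrable_rpow_sub_two_mul_sq hp hU (h := fun _ => |c|) (fun _ => abs_nonneg c)
      (memLp_const _) hΦ (.of_forall fun x => (hΦc x).trans (le_abs_self c))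
  refine ⟨hX, ?_⟩
  set ψ : X → Euc k := fun x => ‖φ x‖ ^ 2 • (u x - P)
  set Ψ : X → Fld k m := fun x => ‖φ x‖ ^ 2 • U x + (2 : ℝ) • tensor (φ x) (Φ x) (u x - P)
  have hψm : AEStronglyMeasurable ψ μ :=
    (hφ.norm.pow 2).smul (hu.sub aestronglyMeasurable_const)
  have hΨm : AEStronglyMeasurable Ψ μ :=
    ((hφ.norm.pow 2).smul hU.1).add ((continuous_tensor.comp_aestronglyMeasurable
      (hφ.prodMk (hΦ.prodMk (hu.sub aestronglyMeasurable_const)))).const_smul (2 : ℝ))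
  let h : X → ℝ := fun x => c ^ 2 * ‖U x‖ + 2 * (|c| * |c| * |r|)
  have h0 : ∀ x, 0 ≤ h x := fun x => by positivity
  have hh : MemLp h (ENNReal.ofReal p) μ := (hU.norm.const_mul (c ^ 2)).add (memLp_const _)
  have hEi : Integrable (fun x => elDensity p F (u x) (U x) (ψ x) (Ψ x)) μ := by
    have hint : Integrable (fun x => (‖U x‖ + h x) ^ p) μ :=
      integrable_rpow_of_memLp hp0 (fun x => add_nonneg (norm_nonneg _) (h0 x)) (hU.norm.add hh)
    refine (hint.const_mul (K * (c ^ 2 * |r| + 1))).mono'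
      (aestronglyMeasurable_elDensity hp hF hu hψm hU.1 hΨm) ?_
    filter_upwards [hFU, hur] with x h1 h2
    have h2' := h2.trans (le_abs_self r)
    have h3 := hφc x
    have h3' := h3.trans (le_abs_self c)
    have h4 := (hΦc x).trans (le_abs_self c)
    refine abs_elDensity_le hp h1 (hK1 _) (hK2 _) ?_ ?_
    · simp only [ψ]
      rw [norm_smul, norm_pow, norm_norm]
      gcongr
    · refine (norm_add_le _ _).trans (add_le_add ?_ ?_)
      · rw [norm_smul, norm_pow, norm_norm]
        gcongr
      · rw [norm_smul, Real.norm_ofNat]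
        refine mul_le_mul_of_nonneg_left ((norm_tensor_le _ _ _).trans ?_) zero_le_two
        gcongr
  have hle : ∫ x, (1 / 4 * (‖U x‖ ^ p * ‖φ x‖ ^ 2) -
      4 * r ^ 2 * (‖U x‖ ^ (p - 2) * ‖Φ x‖ ^ 2)) ∂μ ≤ 0 := by
    rw [← hEL]
    refine integral_mono_ae ((hX.const_mul _).sub (hY.const_mul _)) hEi ?_
    filter_upwards [hFU, hsa, hur] with x h1 h2 h3
    exact le_elDensity hp h1 h2 (hK2 _) hKr h3
  rw [integral_sub (hX.const_mul _) (hY.const_mul _), integral_const_mul, integral_const_mul] at hle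
  linarith

/-- The energy estimate passes to dominated limits of the test functions: Fatou's lemma on the left,
dominated convergence on the right. -/
theorem integral_le_of_tendsto {p C : ℝ} (hp : 2 ≤ p) {U : X → Fld k m}
    (hU : MemLp U (ENNReal.ofReal p) μ) {φ : ℕ → X → Euc k} {Φ : ℕ → X → Fld k m} {φ' : X → Euc k}
    {Φ' : X → Fld k m} {h : X → ℝ} (h0 : ∀ x, 0 ≤ h x) (hh : MemLp h (ENNReal.ofReal p) μ)
    (hφ : ∀ j, AEStronglyMeasurable (φ j) μ) (hΦ : ∀ j, AEStronglyMeasurable (Φ j) μ)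
    (hb : ∀ᵐ x ∂μ, ∀ j, ‖Φ j x‖ ≤ h x)
    (hl : ∀ᵐ x ∂μ, Tendsto (fun j => φ j x) atTop (𝓝 (φ' x)) ∧
      Tendsto (fun j => Φ j x) atTop (𝓝 (Φ' x)))
    (hle : ∀ j, Integrable (fun x => ‖U x‖ ^ p * ‖φ j x‖ ^ 2) μ ∧
      ∫ x, ‖U x‖ ^ p * ‖φ j x‖ ^ 2 ∂μ ≤ C * ∫ x, ‖U x‖ ^ (p - 2) * ‖Φ j x‖ ^ 2 ∂μ) :
    Integrable (fun x => ‖U x‖ ^ p * ‖φ' x‖ ^ 2) μ ∧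
    Integrable (fun x => ‖U x‖ ^ (p - 2) * ‖Φ' x‖ ^ 2) μ ∧
    ∫ x, ‖U x‖ ^ p * ‖φ' x‖ ^ 2 ∂μ ≤ C * ∫ x, ‖U x‖ ^ (p - 2) * ‖Φ' x‖ ^ 2 ∂μ := by
  have hφ' : AEStronglyMeasurable φ' μ :=
    aestronglyMeasurable_of_tendsto_ae atTop hφ (hl.mono fun x hx => hx.1)
  have hΦ' : AEStronglyMeasurable Φ' μ :=
    aestronglyMeasurable_of_tendsto_ae atTop hΦ (hl.mono fun x hx => hx.2)
  have hUp : AEStronglyMeasurable (fun x => ‖U x‖ ^ p) μ :=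
    (Real.continuous_rpow_const (by linarith)).comp_aestronglyMeasurable hU.1.norm
  have hUp2 : AEStronglyMeasurable (fun x => ‖U x‖ ^ (p - 2)) μ :=
    (Real.continuous_rpow_const (by linarith)).comp_aestronglyMeasurable hU.1.norm
  have hΦb : ∀ᵐ x ∂μ, ‖Φ' x‖ ≤ h x := by
    filter_upwards [hb, hl] with x h1 h2
    exact le_of_tendsto h2.2.norm (.of_forall h1)
  have hY := integrable_rpow_sub_two_mul_sq hp hU h0 hh hΦ' hΦb
  have hYl : Tendsto (fun j => ∫ x, ‖U x‖ ^ (p - 2) * ‖Φ j x‖ ^ 2 ∂μ) atTop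
      (𝓝 (∫ x, ‖U x‖ ^ (p - 2) * ‖Φ' x‖ ^ 2 ∂μ)) := by
    have hint : Integrable (fun x => (‖U x‖ + h x) ^ p) μ :=
      integrable_rpow_of_memLp (by linarith) (fun x => add_nonneg (norm_nonneg _) (h0 x))
        (hU.norm.add hh)
    refine tendsto_integral_of_dominated_convergence (fun x => (‖U x‖ + h x) ^ p)
      (fun j => hUp2.mul ((hΦ j).norm.pow 2)) hint (fun j => ?_) ?_
    · filter_upwards [hb] with x hx
      rw [Real.norm_of_nonneg (by positivity)]
      exact rpow_sub_two_mul_sq_le hp (norm_nonneg _) (norm_nonneg _) (hx j)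
    · filter_upwards [hl] with x hx
      exact (hx.2.norm.pow 2).const_mul _
  set I : ℝ := C * ∫ x, ‖U x‖ ^ (p - 2) * ‖Φ' x‖ ^ 2 ∂μ
  have hfatou : ∫⁻ x, ENNReal.ofReal (‖U x‖ ^ p * ‖φ' x‖ ^ 2) ∂μ ≤ ENNReal.ofReal I := by
    calc ∫⁻ x, ENNReal.ofReal (‖U x‖ ^ p * ‖φ' x‖ ^ 2) ∂μ
        = ∫⁻ x, liminf (fun j => ENNReal.ofReal (‖U x‖ ^ p * ‖φ j x‖ ^ 2)) atTop ∂μ := by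
          refine lintegral_congr_ae ?_
          filter_upwards [hl] with x hx
          exact ((ENNReal.tendsto_ofReal ((hx.1.norm.pow 2).const_mul _)).liminf_eq).symm
      _ ≤ liminf (fun j => ∫⁻ x, ENNReal.ofReal (‖U x‖ ^ p * ‖φ j x‖ ^ 2) ∂μ) atTop :=
          lintegral_liminf_le' fun j => (hle j).1.1.aemeasurable.ennreal_ofReal
      _ ≤ liminf (fun j => ENNReal.ofReal
            (C * ∫ x, ‖U x‖ ^ (p - 2) * ‖Φ j x‖ ^ 2 ∂μ)) atTop := by
          refine liminf_le_liminf (.of_forall fun j => ?_)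
          rw [← ofReal_integral_eq_lintegral_ofReal (hle j).1
            (.of_forall fun x => by positivity)]
          exact ENNReal.ofReal_le_ofReal (hle j).2
      _ = ENNReal.ofReal I := (ENNReal.tendsto_ofReal (hYl.const_mul C)).liminf_eq
  have hX : Integrable (fun x => ‖U x‖ ^ p * ‖φ' x‖ ^ 2) μ :=
    ⟨hUp.mul (hφ'.norm.pow 2), (hasFiniteIntegral_iff_ofReal
      (.of_forall fun x => by positivity)).2 (hfatou.trans_lt ENNReal.ofReal_lt_top)⟩
  refine ⟨hX, hY, ?_⟩
  have hI : 0 ≤ I := by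
    refine ge_of_tendsto (hYl.const_mul C) (.of_forall fun j => ?_)
    exact (integral_nonneg fun x => by positivity).trans (hle j).2
  rw [← ofReal_integral_eq_lintegral_ofReal hX (.of_forall fun x => by positivity)] at hfatou
  exact (ENNReal.ofReal_le_ofReal_iff hI).1 hfatou

end EulerLagrange

/-! ### The norm of a differential in frames -/

/-- The Cholesky decomposition depends continuously on the matrix; the induction takes the Schur
complement of the first diagonal entry. -/
theorem exists_continuousOn_cholesky {T : Type*} [TopologicalSpace T] {O : Set T} :
    ∀ {m : ℕ} (G : T → Matrix (Fin m) (Fin m) ℝ), (∀ i j, ContinuousOn (fun x => G x i j) O) →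
      (∀ x ∈ O, (G x).PosDef) → ∃ L : T → Matrix (Fin m) (Fin m) ℝ,
        (∀ i j, ContinuousOn (fun x => L x i j) O) ∧
        ∀ x ∈ O, ∀ i j, ∑ l, L x i l * L x j l = G x i j
  | 0, _, _, _ => ⟨fun _ => 0, fun i => i.elim0, fun _ _ i => i.elim0⟩
  | m + 1, G, hc, hG => by
    have ha : ∀ x ∈ O, 0 < G x 0 0 := fun x hx => (hG x hx).diag_pos
    have hsym : ∀ x ∈ O, ∀ i j, G x i j = G x j i := fun x hx i j => by
      simpa using congrFun (congrFun (hG x hx).isHermitian j) i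
    let G' : T → Matrix (Fin m) (Fin m) ℝ := fun x => Matrix.of fun i j =>
      G x i.succ j.succ - G x i.succ 0 * G x j.succ 0 / G x 0 0
    have hG' : ∀ x ∈ O, (G' x).PosDef := fun x hx => by
      refine Matrix.PosDef.of_dotProduct_mulVec_pos ?_ fun v hv => ?_
      · ext i j
        simp only [G', Matrix.conjTranspose_apply, Matrix.of_apply, star_trivial]
        rw [hsym x hx i.succ j.succ]
        ring
      · -- the Schur complement is the minimum of the quadratic form over the first coordinate
        set b := ∑ i, G x i.succ 0 * v i with hb
        have hw : (Fin.cons (-b / G x 0 0) v : Fin (m + 1) → ℝ) ≠ 0 := fun h => hv (by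
          ext i
          simpa using congrFun h i.succ)
        have h1 := (hG x hx).dotProduct_mulVec_pos hw
        have ha0 := (ha x hx).ne'
        refine lt_of_lt_of_eq h1 ?_
        simp only [star_trivial, dotProduct, Matrix.mulVec, Fin.sum_univ_succ, Fin.cons_zero,
          Fin.cons_succ, G', Matrix.of_apply]
        have h2 : ∑ i : Fin m, G x 0 i.succ * v i = b :=
          Finset.sum_congr rfl fun i _ => by rw [hsym x hx 0 i.succ]
        rw [h2]
        have h3 : ∀ i : Fin m, ∑ j : Fin m,
            (G x i.succ j.succ - G x i.succ 0 * G x j.succ 0 / G x 0 0) * v j =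
            (∑ j : Fin m, G x i.succ j.succ * v j) - G x i.succ 0 / G x 0 0 * b := fun i => by
          rw [hb, Finset.mul_sum, ← Finset.sum_sub_distrib]
          exact Finset.sum_congr rfl fun j _ => by ring
        simp only [h3, mul_add, mul_sub, Finset.sum_add_distrib, Finset.sum_sub_distrib]
        have h4 : ∑ i : Fin m, v i * (G x i.succ 0 * (-b / G x 0 0)) = -(b * b / G x 0 0) := by
          have : ∑ i : Fin m, v i * (G x i.succ 0 * (-b / G x 0 0)) = b * (-b / G x 0 0) := by
            rw [hb, Finset.sum_mul]
            exact Finset.sum_congr rfl fun j _ => by ring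
          rw [this]; ring
        have h5 : ∑ i : Fin m, v i * (G x i.succ 0 / G x 0 0 * b) = b * b / G x 0 0 := by
          have : ∑ i : Fin m, v i * (G x i.succ 0 / G x 0 0 * b) = b * (b / G x 0 0) := by
            conv_rhs => rw [hb, Finset.sum_mul]
            exact Finset.sum_congr rfl fun j _ => by rw [hb]; ring
          rw [this]; ring
        rw [h4, h5]
        field_simp
        ring
    have hc' : ∀ i j, ContinuousOn (fun x => G' x i j) O := fun i j =>
      (hc _ _).sub (((hc _ _).mul (hc _ _)).div (hc _ _) fun x hx => (ha x hx).ne')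
    obtain ⟨L', hLc, hL⟩ := exists_continuousOn_cholesky G' hc' hG'
    have hs : ContinuousOn (fun x => √(G x 0 0)) O := (hc 0 0).sqrt
    have hs0 : ∀ x ∈ O, √(G x 0 0) ≠ 0 := fun x hx => (Real.sqrt_pos.2 (ha x hx)).ne'
    refine ⟨fun x => Matrix.of (Fin.cons (Fin.cons (√(G x 0 0)) 0)
      fun i => Fin.cons (G x i.succ 0 / √(G x 0 0)) (L' x i)), fun i j => ?_, fun x hx i j => ?_⟩
    · refine Fin.cases ?_ (fun i => ?_) i <;> refine Fin.cases ?_ (fun j => ?_) j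
      · simpa using hs
      · simpa using continuousOn_const
      · exact (hc i.succ 0).div hs hs0
      · simpa using hLc i j
    · have hsq : √(G x 0 0) * √(G x 0 0) = G x 0 0 := Real.mul_self_sqrt (ha x hx).le
      have hsx := hs0 x hx
      rw [Fin.sum_univ_succ]
      refine Fin.cases ?_ (fun i => ?_) i <;> refine Fin.cases ?_ (fun j => ?_) j
      · simpa using hsq
      · simp only [Matrix.of_apply, Fin.cons_zero, Fin.cons_succ, Pi.zero_apply, zero_mul,
          Finset.sum_const_zero, add_zero]
        rw [hsym x hx 0 j.succ]
        field_simp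
      · simp only [Matrix.of_apply, Fin.cons_zero, Fin.cons_succ, Pi.zero_apply, mul_zero,
          Finset.sum_const_zero, add_zero]
        field_simp
      · simp only [Matrix.of_apply, Fin.cons_zero, Fin.cons_succ, hL x hx, G']
        have : G x i.succ 0 / √(G x 0 0) * (G x j.succ 0 / √(G x 0 0)) =
            G x i.succ 0 * G x j.succ 0 / G x 0 0 := by
          rw [div_mul_div_comm, hsq]
        rw [this]
        ring

section Frame

variable {m k : ℕ} {H : Type*} [TopologicalSpace H] {I : ModelWithCorners ℝ (Euc m) H}
  {M : Type*} [TopologicalSpace M] [ChartedSpace H M] [IsManifold I ∞ M]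

theorem gram_posDef (g : Metric I M) {x : M} {e : Fin m → TangentSpace I x}
    (he : LinearIndependent ℝ e) : (gram g x e).PosDef := by
  refine Matrix.PosDef.of_dotProduct_mulVec_pos ?_ fun v hv => ?_
  · ext i j
    simp [gram, g.symm x (e i) (e j)]
  · have h1 : ∑ i, v i • e i ≠ 0 := fun h => hv (funext (Fintype.linearIndependent_iff.1 he v h))
    have h2 := g.pos x _ h1
    refine lt_of_lt_of_eq h2 ?_
    simp only [map_sum, map_smul, _root_.sum_apply, dotProduct, Matrix.mulVec, gram,
      Matrix.of_apply, star_trivial, _root_.smul_apply, smul_eq_mul, Finset.mul_sum]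
    rw [Finset.sum_comm]
    exact Finset.sum_congr rfl fun i _ => Finset.sum_congr rfl fun j _ => by ring

/-- `|D|_g` can be computed in every basis of the tangent space. -/
theorem gnorm_eq (g : Metric I M) {x : M} {e : Fin m → TangentSpace I x}
    (he : LinearIndependent ℝ e) (D : TangentSpace I x →L[ℝ] Euc k) :
    gnorm g x D = √(∑ α, ∑ β, (gram g x e)⁻¹ α β * ⟪D (e α), D (e β)⟫) := by
  let b : Module.Basis (Fin m) ℝ (TangentSpace I x) := (EuclideanSpace.basisFun (Fin m) ℝ).toBasis
  have hb : ∀ α, b α = stdVec I x α := fun α => by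
    simp only [b, stdVec]
    exact EuclideanSpace.basisFun_apply (Fin m) ℝ α
  have hfin : Fintype.card (Fin m) = Module.finrank ℝ (TangentSpace I x) := by
    rw [Module.finrank_eq_card_basis b]
  let b' : Module.Basis (Fin m) ℝ (TangentSpace I x) := by
    haveI : FiniteDimensional ℝ (TangentSpace I x) := inferInstanceAs (FiniteDimensional ℝ (Euc m))
    exact Module.Basis.mk he (he.span_eq_top_of_card_eq_finrank' hfin).ge
  have hb' : ∀ α, b' α = e α := fun α => Module.Basis.mk_apply _ _ α
  set P : Matrix (Fin m) (Fin m) ℝ := b.toMatrix e with hP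
  have hPu : IsUnit P.det := by
    have h1 : P * b'.toMatrix b = 1 := by
      have := b.toMatrix_mul_toMatrix_flip b'
      rwa [show (b' : Fin m → TangentSpace I x) = e from funext hb'] at this
    exact (Matrix.isUnit_iff_isUnit_det P).1 (IsUnit.of_mul_eq_one _ h1)
  have heP : ∀ α, e α = ∑ γ, P γ α • stdVec I x γ := fun α => by
    rw [← b.sum_toMatrix_smul_self e α]
    exact Finset.sum_congr rfl fun γ _ => by rw [hb]
  set G₀ := gram g x (stdVec I x)
  have hgram : gram g x e = P.transpose * G₀ * P := by
    ext α β
    simp only [gram, Matrix.of_apply, Matrix.mul_apply, Matrix.transpose_apply, G₀, heP α, heP β,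
      map_sum, map_smul, _root_.sum_apply, _root_.smul_apply,
      smul_eq_mul, Finset.sum_mul, Finset.mul_sum]
    exact Finset.sum_congr rfl fun i _ => Finset.sum_congr rfl fun j _ => by ring
  have hinv : G₀⁻¹ = P * (gram g x e)⁻¹ * P.transpose := by
    have hPt : IsUnit P.transpose.det := by rwa [Matrix.det_transpose]
    rw [hgram, Matrix.mul_inv_rev, Matrix.mul_inv_rev]
    calc G₀⁻¹ = (P * P⁻¹) * G₀⁻¹ * (P.transpose⁻¹ * P.transpose) := by
          rw [Matrix.mul_nonsing_inv _ hPu, Matrix.nonsing_inv_mul _ hPt]; simp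
      _ = _ := by simp only [Matrix.mul_assoc]
  rw [gnorm]
  congr 1
  rw [show gram g x (stdVec I x) = G₀ from rfl, hinv]
  have hDe : ∀ α, D (e α) = ∑ γ, P γ α • D (stdVec I x γ) := fun α => by
    rw [heP α, map_sum]; simp
  have hR : ∀ α β, (gram g x e)⁻¹ α β * ⟪D (e α), D (e β)⟫ =
      ∑ γ, ∑ δ, P γ α * (gram g x e)⁻¹ α β * P δ β * ⟪D (stdVec I x γ), D (stdVec I x δ)⟫ := by
    intro α β
    rw [hDe, hDe, sum_inner, Finset.mul_sum]
    refine Finset.sum_congr rfl fun γ _ => ?_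
    rw [inner_sum, Finset.mul_sum]
    refine Finset.sum_congr rfl fun δ _ => ?_
    rw [inner_smul_left, inner_smul_right]
    simp only [conj_trivial]
    ring
  have hL : ∀ γ δ, (P * (gram g x e)⁻¹ * P.transpose) γ δ * ⟪D (stdVec I x γ), D (stdVec I x δ)⟫ =
      ∑ α, ∑ β, P γ α * (gram g x e)⁻¹ α β * P δ β * ⟪D (stdVec I x γ), D (stdVec I x δ)⟫ := by
    intro γ δ
    simp only [Matrix.mul_apply, Matrix.transpose_apply, Finset.sum_mul]
    rw [Finset.sum_comm]
  simp only [hR, hL]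
  refine (Finset.sum_congr rfl fun γ _ => Finset.sum_comm).trans (Finset.sum_comm.trans ?_)
  refine Finset.sum_congr rfl fun α _ => ?_
  exact (Finset.sum_congr rfl fun γ _ => Finset.sum_comm).trans Finset.sum_comm

/-- If `L Lᵀ` is the inverse of the matrix of `g` in the basis `e`, then `E_i = ∑ L_{αi} e_α` is an
orthonormal frame: `|D|_g` is the Hilbert–Schmidt norm of the components `D E_i`. -/
theorem gnorm_eq_norm_mk (g : Metric I M) {x : M} {e : Fin m → TangentSpace I x}
    (he : LinearIndependent ℝ e) {L : Matrix (Fin m) (Fin m) ℝ}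
    (hL : ∀ i j, ∑ l, L i l * L j l = (gram g x e)⁻¹ i j) (D : TangentSpace I x →L[ℝ] Euc k) :
    gnorm g x D = ‖(Fld.mk fun i => D (∑ α, L α i • e α) : Fld k m)‖ := by
  set A : Fld k m := Fld.mk fun i => D (∑ α, L α i • e α)
  rw [gnorm_eq g he, ← Real.sqrt_sq (norm_nonneg A), Fld.norm_sq]
  congr 1
  have h1 : ∀ i, ‖A.comp i‖ ^ 2 = ∑ α, ∑ β, L α i * L β i * ⟪D (e α), D (e β)⟫ := fun i => by
    have h2 : A.comp i = ∑ α, L α i • D (e α) := by simp [A]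
    rw [h2, ← real_inner_self_eq_norm_sq, sum_inner]
    refine Finset.sum_congr rfl fun α _ => ?_
    rw [inner_sum]
    refine Finset.sum_congr rfl fun β _ => ?_
    rw [inner_smul_left, inner_smul_right]
    simp only [conj_trivial]
    ring
  simp only [h1, ← hL, Finset.sum_mul]
  symm
  exact Finset.sum_comm.trans (Finset.sum_congr rfl fun α _ => Finset.sum_comm)

end Frame

/-! ### Coordinate frames -/

section Chart

variable {m k : ℕ} {H : Type*} [TopologicalSpace H] {I : ModelWithCorners ℝ (Euc m) H}
  {M : Type*} [TopologicalSpace M] [ChartedSpace H M] [IsManifold I ∞ M]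

/-- The coordinate vectors of the chart around `x₀` as vector fields on its domain. -/
def chartVec (I : ModelWithCorners ℝ (Euc m) H) {M : Type*} [TopologicalSpace M] [ChartedSpace H M]
    [IsManifold I ∞ M] (x₀ x : M) (α : Fin m) : TangentSpace I x :=
  haveI : IsManifold I 1 M := .of_le (n := ∞) (by simp)
  (trivializationAt (Euc m) (TangentSpace I) x₀).symmL ℝ x
    (EuclideanSpace.single α (1 : ℝ) : Euc m)

theorem coordVec_eq {x₀ : M} {z : Euc m} (hz : z ∈ (extChartAt I x₀).target) (α : Fin m) :
    coordVec I x₀ z α = chartVec I x₀ ((extChartAt I x₀).symm z) α := by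
  have : IsManifold I 1 M := .of_le (n := ∞) (by simp)
  have hx : (extChartAt I x₀).symm z ∈ (chartAt H x₀).source := by
    simpa using (extChartAt I x₀).map_target hz
  have h1 := TangentBundle.symmL_trivializationAt (I := I) (𝕜 := ℝ) hx
  rw [chartVec, coordVec, h1, (extChartAt I x₀).right_inv hz]
  rfl

theorem linearIndependent_chartVec {x₀ x : M} (hx : x ∈ (chartAt H x₀).source) :
    LinearIndependent ℝ (chartVec I x₀ x) := by
  have : IsManifold I 1 M := .of_le (n := ∞) (by simp)
  set e := trivializationAt (Euc m) (TangentSpace I) x₀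
  have hb : x ∈ e.baseSet := by simpa [e] using hx
  have h1 : LinearIndependent ℝ fun α : Fin m => (EuclideanSpace.single α (1 : ℝ) : Euc m) := by
    have h2 : (fun α : Fin m => (EuclideanSpace.single α (1 : ℝ) : Euc m)) =
        (EuclideanSpace.basisFun (Fin m) ℝ).toBasis := by
      ext1 α
      simp
    rw [h2]
    exact (EuclideanSpace.basisFun (Fin m) ℝ).toBasis.linearIndependent
  refine h1.map' (e.symmL ℝ x : Euc m →ₗ[ℝ] TangentSpace I x) ?_
  refine LinearMap.ker_eq_bot.2 fun v w hvw => ?_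
  have h2 := congrArg (e.continuousLinearMapAt ℝ x) hvw
  simpa [e.continuousLinearMapAt_symmL hb] using h2

theorem continuousOn_gram_chartVec (g : Metric I M) (x₀ : M) (i j : Fin m) :
    ContinuousOn (fun x => gram g x (chartVec I x₀ x) i j) (chartAt H x₀).source := by
  have : IsManifold I 1 M := .of_le (n := ∞) (by simp)
  have : ContMDiffVectorBundle ∞ (Euc m) (TangentSpace I : M → Type _) I := inferInstance
  set e := trivializationAt (Euc m) (TangentSpace I : M → Type _) x₀
  have hbase : e.baseSet = (chartAt H x₀).source := by simp [e]
  let b := (EuclideanSpace.basisFun (Fin m) ℝ).toBasis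
  have hfr : ∀ α, ContMDiffOn I (I.prod 𝓘(ℝ, Euc m)) ∞
      (fun x => Bundle.TotalSpace.mk' (Euc m) x (chartVec I x₀ x α)) e.baseSet := fun α => by
    refine (e.contMDiffOn_localFrame_baseSet (I := I) ∞ b α).congr fun x hx => ?_
    rw [e.localFrame_apply_of_mem_baseSet b hx]
    simp [chartVec, Bundle.Trivialization.basisAt, b, e]
    exact e.symmL_apply (R := ℝ) hx _
  have h1 : ContMDiffOn I (I.prod 𝓘(ℝ, ℝ)) ∞ (fun x => Bundle.TotalSpace.mk' ℝ
      (E := Bundle.Trivial M ℝ) x (g.inner x (chartVec I x₀ x i) (chartVec I x₀ x j)))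
      e.baseSet := by
    refine ContMDiffOn.clm_bundle_apply₂ (F₁ := Euc m) (F₂ := Euc m) ?_ (hfr i) (hfr j)
    exact g.contMDiff.contMDiffOn
  rw [← hbase]
  intro x hx
  have h2 := h1 x hx
  rw [Bundle.contMDiffWithinAt_totalSpace] at h2
  exact h2.2.continuousWithinAt

theorem dif_chartVec {w : M → Euc k} (hw : w ∈ smoothMaps I M k) {x₀ x : M}
    (hx : x ∈ (chartAt H x₀).source) (α : Fin m) :
    dif I w x (chartVec I x₀ x α) = fderivWithin ℝ (w ∘ (extChartAt I x₀).symm) (range I)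
      (extChartAt I x₀ x) (EuclideanSpace.single α (1 : ℝ)) := by
  have : IsManifold I 1 M := .of_le (n := ∞) (by simp)
  have hx' : x ∈ (extChartAt I x₀).source := by simpa using hx
  have hz : extChartAt I x₀ x ∈ (extChartAt I x₀).target := (extChartAt I x₀).map_source hx'
  have hzr : extChartAt I x₀ x ∈ range I := extChartAt_target_subset_range x₀ hz
  have hsymm : (extChartAt I x₀).symm (extChartAt I x₀ x) = x := (extChartAt I x₀).left_inv hx'
  have hw' : ContMDiff I 𝓘(ℝ, Euc k) ∞ w := hw
  have hwd : MDifferentiableAt I 𝓘(ℝ, Euc k) w ((extChartAt I x₀).symm (extChartAt I x₀ x)) :=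
    (hw'.contMDiffAt).mdifferentiableAt (by simp)
  have h1 := mfderiv_comp_mfderivWithin (extChartAt I x₀ x) hwd
    (mdifferentiableWithinAt_extChartAt_symm (I := I) hz) (I.uniqueMDiffOn _ hzr)
  rw [mfderivWithin_eq_fderivWithin] at h1
  rw [h1, chartVec, TangentBundle.symmL_trivializationAt (I := I) (𝕜 := ℝ) hx, dif]
  have key : ∀ y, y = x → ∀ v : Euc m, mfderiv I 𝓘(ℝ, Euc k) w x v =
      mfderiv I 𝓘(ℝ, Euc k) w y v := by
    rintro _ rfl _
    rfl
  exact key _ hsymm _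

theorem continuousOn_dif_chartVec {w : M → Euc k} (hw : w ∈ smoothMaps I M k) (x₀ : M)
    (α : Fin m) :
    ContinuousOn (fun x => dif I w x (chartVec I x₀ x α)) (chartAt H x₀).source := by
  have hw' : ContMDiff I 𝓘(ℝ, Euc k) ∞ w := hw
  have h1 : ContDiffOn ℝ ∞ (w ∘ (extChartAt I x₀).symm) (extChartAt I x₀).target :=
    contMDiffOn_iff_contDiffOn.1 (hw'.comp_contMDiffOn (contMDiffOn_extChartAt_symm x₀))
  have h2 : ContinuousOn (fderivWithin ℝ (w ∘ (extChartAt I x₀).symm) (extChartAt I x₀).target)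
      (extChartAt I x₀).target :=
    h1.continuousOn_fderivWithin (uniqueDiffOn_extChartAt_target x₀) (by simp)
  have h3 : ContinuousOn (fun x => fderivWithin ℝ (w ∘ (extChartAt I x₀).symm)
      (extChartAt I x₀).target (extChartAt I x₀ x)) (extChartAt I x₀).source :=
    h2.comp (continuousOn_extChartAt x₀) (extChartAt I x₀).mapsTo
  rw [extChartAt_source] at h3
  refine (h3.clm_apply (continuousOn_const (c := EuclideanSpace.single α (1 : ℝ)))).congr
    fun x hx => ?_
  rw [dif_chartVec hw hx]
  have hz : extChartAt I x₀ x ∈ (extChartAt I x₀).target :=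
    (extChartAt I x₀).map_source (by simpa using hx)
  congr 1
  exact (fderivWithin_of_mem_nhdsWithin (extChartAt_target_mem_nhdsWithin_of_mem hz)
    (I.uniqueDiffOn _ (extChartAt_target_subset_range x₀ hz))
    (h1.differentiableOn (by simp) _ hz))

theorem continuousOn_inv_gram_chartVec (g : Metric I M) (x₀ : M) (i j : Fin m) :
    ContinuousOn (fun x => (gram g x (chartVec I x₀ x))⁻¹ i j) (chartAt H x₀).source := by
  have h1 : ContinuousOn (fun x => gram g x (chartVec I x₀ x)) (chartAt H x₀).source :=
    continuousOn_pi.2 fun i => continuousOn_pi.2 fun j => continuousOn_gram_chartVec g x₀ i j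
  have hdet : ContinuousOn (fun x => (gram g x (chartVec I x₀ x)).det) (chartAt H x₀).source :=
    (continuous_id.matrix_det).comp_continuousOn h1
  have hadj : ContinuousOn (fun x => (gram g x (chartVec I x₀ x)).adjugate i j)
      (chartAt H x₀).source :=
    ((continuous_id.matrix_adjugate).matrix_elem i j).comp_continuousOn h1
  have hpos : ∀ x ∈ (chartAt H x₀).source, (gram g x (chartVec I x₀ x)).det ≠ 0 := fun x hx =>
    (gram_posDef g (linearIndependent_chartVec hx)).det_pos.ne'
  refine ((hdet.inv₀ hpos).mul hadj).congr fun x hx => ?_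
  simp [Matrix.inv_def, Ring.inverse_eq_inv']

/-- A continuous orthonormal frame on a chart domain. -/
theorem exists_local_frame (g : Metric I M) (x₀ : M) :
    ∃ E : ∀ x : M, Fin m → TangentSpace I x,
      (∀ x ∈ (chartAt H x₀).source, ∀ (k : ℕ) (D : TangentSpace I x →L[ℝ] Euc k),
        gnorm g x D = ‖(Fld.mk fun i => D (E x i) : Fld k m)‖) ∧
      ∀ (k : ℕ), ∀ w ∈ smoothMaps I M k,
        ContinuousOn (fun x => (Fld.mk fun i => dif I w x (E x i) : Fld k m))
          (chartAt H x₀).source := by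
  obtain ⟨L, hLc, hL⟩ := exists_continuousOn_cholesky (O := (chartAt H x₀).source)
    (fun x => (gram g x (chartVec I x₀ x))⁻¹) (continuousOn_inv_gram_chartVec g x₀)
    fun x hx => (gram_posDef g (linearIndependent_chartVec hx)).inv
  refine ⟨fun x i => ∑ α, L x α i • chartVec I x₀ x α, fun x hx k D => ?_, fun k w hw => ?_⟩
  · exact gnorm_eq_norm_mk g (linearIndependent_chartVec hx) (hL x hx) D
  · refine Fld.continuous_mk.comp_continuousOn (continuousOn_pi.2 fun i => ?_)
    simp only [map_sum, map_smul]
    exact continuousOn_finsetSum _ fun α _ => (hLc α i).smul (continuousOn_dif_chartVec hw x₀ α)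

theorem continuous_gnorm_dif (g : Metric I M) {w : M → Euc k} (hw : w ∈ smoothMaps I M k) :
    Continuous fun x => gnorm g x (dif I w x) := by
  refine continuous_iff_continuousAt.2 fun x₀ => ?_
  obtain ⟨E, hE, hEc⟩ := exists_local_frame g x₀
  have h1 : ContinuousOn (fun x => gnorm g x (dif I w x)) (chartAt H x₀).source :=
    (hEc k w hw).norm.congr fun x hx => hE x hx k _
  exact h1.continuousAt ((chartAt H x₀).open_source.mem_nhds (mem_chart_source H x₀))

/-- A measurable orthonormal frame on the whole manifold. -/
theorem exists_frame [SigmaCompactSpace M] [Nonempty M] [MeasurableSpace M] [BorelSpace M]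
    (g : Metric I M) :
    ∃ E : ∀ x : M, Fin m → TangentSpace I x,
      (∀ (x : M) (k : ℕ) (D : TangentSpace I x →L[ℝ] Euc k),
        gnorm g x D = ‖(Fld.mk fun i => D (E x i) : Fld k m)‖) ∧
      ∀ (k : ℕ), ∀ w ∈ smoothMaps I M k,
        StronglyMeasurable (fun x => (Fld.mk fun i => dif I w x (E x i) : Fld k m)) := by
  obtain ⟨s, hsc, hs⟩ := countable_cover_nhds_of_sigmaCompact (X := M)
    (f := fun x => (chartAt H x).source) fun x => (chartAt H x).open_source.mem_nhds
      (mem_chart_source H x)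
  have hsne : s.Nonempty := by
    rw [nonempty_iff_ne_empty]
    rintro rfl
    exact empty_ne_univ (by simpa using hs)
  obtain ⟨c, hc⟩ := hsc.exists_eq_range hsne
  have hcov : ∀ x, ∃ n, x ∈ (chartAt H (c n)).source := fun x => by
    have : x ∈ ⋃ x ∈ s, (chartAt H x).source := hs ▸ mem_univ x
    simpa [hc] using this
  choose E hE hEc using fun x₀ : M => exists_local_frame g x₀
  classical
  refine ⟨fun x => E (c (Nat.find (hcov x))) x, fun x k D =>
    hE _ x (Nat.find_spec (hcov x)) k D, fun k w hw => ?_⟩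
  borelize (Fld k m)
  let f : ℕ → M → Fld k m := fun n => ((chartAt H (c n)).source).piecewise
    (fun x => Fld.mk fun i => dif I w x (E (c n) x i)) 0
  have hf : ∀ n, Measurable (f n) := fun n =>
    (hEc (c n) k w hw).measurable_piecewise continuousOn_const
      (chartAt H (c n)).open_source.measurableSet
  have hfind : Measurable fun x => Nat.find (hcov x) :=
    measurable_find hcov fun n => (chartAt H (c n)).open_source.measurableSet
  have h1 : Measurable fun q : ℕ × M => f q.1 q.2 :=
    measurable_from_prod_countable_right hf
  have h2 := h1.comp (hfind.prodMk measurable_id)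
  have h3 : Measurable (fun x => (Fld.mk fun i => dif I w x (E (c (Nat.find (hcov x))) x i) :
      Fld k m)) := by
    convert h2 using 2 with x
    have h4 : f (Nat.find (hcov x)) x =
        Fld.mk fun i => dif I w x (E (c (Nat.find (hcov x))) x i) :=
      piecewise_eq_of_mem _ _ _ (Nat.find_spec (hcov x))
    exact h4.symm
  exact h3.stronglyMeasurable

end Chart

/-! ### Closability of partial derivatives -/

/-- The derivative is closable: if `v_j → 0` and `∂_e v_j → D` on an open set `Ω`, dominated by a
locally integrable function, then `D = 0`, since `∫ η D = lim ∫ η ∂_e v_j = - lim ∫ (∂_e η) v_j = 0`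
for all test functions `η`. -/
theorem ae_eq_zero_of_tendsto_fderiv {m k : ℕ} {Ω : Set (Euc m)} (hΩ : IsOpen Ω)
    {v : ℕ → Euc m → Euc k} (hv : ∀ j, ContDiffOn ℝ 1 (v j) Ω) {e : Euc m} {D : Euc m → Euc k}
    {q : Euc m → ℝ} (hq : LocallyIntegrableOn q Ω volume)
    (hlim : ∀ᵐ z, z ∈ Ω → (∀ j, ‖v j z‖ ≤ q z ∧ ‖fderiv ℝ (v j) z e - D z‖ ≤ q z) ∧
      Tendsto (fun j => v j z) atTop (𝓝 0) ∧
      Tendsto (fun j => fderiv ℝ (v j) z e) atTop (𝓝 (D z))) :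
    ∀ᵐ z, z ∈ Ω → D z = 0 := by
  have hdc : ∀ j, ContinuousOn (fun z => fderiv ℝ (v j) z e) Ω := fun j =>
    ((hv j).continuousOn_fderiv_of_isOpen hΩ le_rfl).clm_apply continuousOn_const
  have hlimK : ∀ K ⊆ Ω, MeasurableSet K → ∀ᵐ z ∂(volume.restrict K),
      (∀ j, ‖v j z‖ ≤ q z ∧ ‖fderiv ℝ (v j) z e - D z‖ ≤ q z) ∧
      Tendsto (fun j => v j z) atTop (𝓝 0) ∧
      Tendsto (fun j => fderiv ℝ (v j) z e) atTop (𝓝 (D z)) := fun K hK hKm => by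
    filter_upwards [ae_restrict_of_ae hlim, ae_restrict_mem hKm] with z h1 h2
    exact h1 (hK h2)
  have hdm : ∀ K ⊆ Ω, MeasurableSet K → ∀ j,
      AEStronglyMeasurable (fun z => fderiv ℝ (v j) z e) (volume.restrict K) :=
    fun K hK hKm j => ((hdc j).mono hK).aestronglyMeasurable hKm
  have hDm : ∀ K ⊆ Ω, MeasurableSet K → AEStronglyMeasurable D (volume.restrict K) :=
    fun K hK hKm => aestronglyMeasurable_of_tendsto_ae atTop (hdm K hK hKm)
      ((hlimK K hK hKm).mono fun z hz => hz.2.2)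
  have hqK : ∀ K ⊆ Ω, IsCompact K → IntegrableOn q K volume := fun K hK hKc =>
    hq.integrableOn_compact_subset hK hKc
  have hdK : ∀ K ⊆ Ω, IsCompact K → ∀ j, IntegrableOn (fun z => fderiv ℝ (v j) z e) K volume :=
    fun K hK hKc j => ((hdc j).mono hK).integrableOn_compact hKc
  have hDK : ∀ K ⊆ Ω, IsCompact K → IntegrableOn D K volume := fun K hK hKc => by
    refine ((hdK K hK hKc 0).norm.add (hqK K hK hKc)).mono' (hDm K hK hKc.measurableSet) ?_
    filter_upwards [hlimK K hK hKc.measurableSet] with z hz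
    have h1 := (hz.1 0).2
    have h2 : D z = fderiv ℝ (v 0) z e - (fderiv ℝ (v 0) z e - D z) := by abel
    rw [h2]
    exact (norm_sub_le _ _).trans (add_le_add le_rfl h1)
  have hDloc : LocallyIntegrableOn D Ω volume :=
    (locallyIntegrableOn_iff hΩ.isLocallyClosed).2 fun K hK hKc => hDK K hK hKc
  refine hΩ.ae_eq_zero_of_integral_contDiff_smul_eq_zero hDloc fun η hη hηc hηΩ => ?_
  set K := tsupport η
  have hK : IsCompact K := hηc
  have hKm : MeasurableSet K := hK.measurableSet
  have hη0 : ∀ z ∉ K, η z = 0 := fun z hz => image_eq_zero_of_notMem_tsupport hz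
  have hdη0 : ∀ z ∉ K, fderiv ℝ η z e = 0 := fun z hz => by
    have h1 : z ∉ tsupport (fderiv ℝ η) := fun h => hz (tsupport_fderiv_subset ℝ h)
    rw [image_eq_zero_of_notMem_tsupport h1]; rfl
  have hηcont : Continuous η := hη.continuous
  have hdηc : Continuous fun z => fderiv ℝ η z e :=
    (hη.continuous_fderiv (by simp)).clm_apply continuous_const
  obtain ⟨B, hB⟩ := hηc.exists_bound_of_continuous hηcont
  obtain ⟨B', hB'⟩ := (hηc.fderiv_apply (𝕜 := ℝ) (v := e)).exists_bound_of_continuous hdηc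
  have hconv1 : Tendsto (fun j => ∫ z in K, η z • fderiv ℝ (v j) z e) atTop
      (𝓝 (∫ z in K, η z • D z)) := by
    refine tendsto_integral_of_dominated_convergence
      (fun z => B * (‖fderiv ℝ (v 0) z e‖ + (q z + q z)))
      (fun j => hηcont.aestronglyMeasurable.smul (hdm K hηΩ hKm j))
      (((hdK K hηΩ hK 0).norm.add ((hqK K hηΩ hK).add (hqK K hηΩ hK))).const_mul B)
      (fun j => ?_) ?_
    · filter_upwards [hlimK K hηΩ hKm] with z hz
      rw [norm_smul]
      refine mul_le_mul (hB z) ?_ (norm_nonneg _) ((norm_nonneg _).trans (hB z))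
      have h2 : fderiv ℝ (v j) z e = fderiv ℝ (v 0) z e +
          ((fderiv ℝ (v j) z e - D z) - (fderiv ℝ (v 0) z e - D z)) := by abel
      calc ‖fderiv ℝ (v j) z e‖ ≤ ‖fderiv ℝ (v 0) z e‖ +
            ‖(fderiv ℝ (v j) z e - D z) - (fderiv ℝ (v 0) z e - D z)‖ := by
            conv_lhs => rw [h2]
            exact norm_add_le _ _
        _ ≤ _ := by
            gcongr
            exact (norm_sub_le _ _).trans (add_le_add (hz.1 j).2 (hz.1 0).2)
    · filter_upwards [hlimK K hηΩ hKm] with z hz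
      exact hz.2.2.const_smul _
  have hconv2 : Tendsto (fun j => ∫ z in K, fderiv ℝ η z e • v j z) atTop (𝓝 0) := by
    have h0 : (0 : Euc k) = ∫ z in K, fderiv ℝ η z e • (0 : Euc k) := by simp
    rw [h0]
    refine tendsto_integral_of_dominated_convergence (fun z => B' * q z)
      (fun j => hdηc.aestronglyMeasurable.smul
        (((hv j).continuousOn.mono hηΩ).aestronglyMeasurable hKm))
      ((hqK K hηΩ hK).const_mul B') (fun j => ?_) ?_
    · filter_upwards [hlimK K hηΩ hKm] with z hz
      rw [norm_smul]
      exact mul_le_mul (hB' z) (hz.1 j).1 (norm_nonneg _) ((norm_nonneg _).trans (hB' z))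
    · filter_upwards [hlimK K hηΩ hKm] with z hz
      exact hz.2.1.const_smul _
  have hfull : ∀ (f : Euc m → Euc k), (∀ z ∉ K, f z = 0) → ∫ z in K, f z = ∫ z, f z :=
    fun f hf => setIntegral_eq_integral_of_forall_compl_eq_zero hf
  have hint : ∀ (f : Euc m → Euc k), (∀ z ∉ K, f z = 0) → ContinuousOn f K →
      Integrable f volume := fun f hf hfc => by
    have h1 := hfc.integrableOn_compact (μ := volume) hK
    refine (integrableOn_iff_integrable_of_support_subset ?_).1 h1
    intro z hz
    by_contra h
    exact hz (hf z h)
  have hibp : ∀ j, ∫ z in K, η z • fderiv ℝ (v j) z e = - ∫ z in K, fderiv ℝ η z e • v j z := by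
    intro j
    rw [hfull _ fun z hz => by rw [hη0 z hz, zero_smul],
      hfull _ fun z hz => by rw [hdη0 z hz, zero_smul]]
    refine integral_smul_fderiv_eq_neg_fderiv_smul_of_integrable ?_ ?_ ?_ ?_ ?_
    · exact hint _ (fun z hz => by rw [hdη0 z hz, zero_smul])
        (hdηc.continuousOn.smul ((hv j).continuousOn.mono hηΩ))
    · exact hint _ (fun z hz => by rw [hη0 z hz, zero_smul])
        (hηcont.continuousOn.smul ((hdc j).mono hηΩ))
    · exact hint _ (fun z hz => by rw [hη0 z hz, zero_smul])
        (hηcont.continuousOn.smul ((hv j).continuousOn.mono hηΩ))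
    · exact fun z _ => hη.differentiable (by simp) z
    · exact fun z hz => ((hv j).contDiffAt (hΩ.mem_nhds (hηΩ hz))).differentiableAt (by simp)
  simp only [hibp] at hconv1
  have h1 := tendsto_nhds_unique hconv1 (by simpa using hconv2.neg)
  rw [← hfull _ fun z hz => by rw [hη0 z hz, zero_smul]]
  exact h1

/-! ### The Riemannian volume in charts -/

section Volume

variable {m k : ℕ} {H : Type*} [TopologicalSpace H] {I : ModelWithCorners ℝ (Euc m) H}
  {M : Type*} [TopologicalSpace M] [ChartedSpace H M]

theorem symm_mem_source {x₀ : M} {z : Euc m} (hz : z ∈ (extChartAt I x₀).target) :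
    (extChartAt I x₀).symm z ∈ (chartAt H x₀).source := by
  simpa using (extChartAt I x₀).map_target hz

theorem measurableSet_extChartAt_target (x₀ : M) :
    MeasurableSet (extChartAt I x₀).target := by
  rw [extChartAt_target]
  exact ((chartAt H x₀).open_target.preimage I.continuous_symm).measurableSet.inter
    I.isClosed_range.measurableSet

/-- The boundary of `M` is a null set in every chart, since the range of the model is convex. -/
theorem ae_mem_interior_extChartAt_target (i : M) :
    ∀ᵐ z, z ∈ (extChartAt I i).target → z ∈ interior (extChartAt I i).target := by
  have h1 : volume (frontier (range I)) = 0 := I.convex_range.addHaar_frontier volume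
  have h2 : ∀ᵐ z, z ∉ frontier (range I) := measure_eq_zero_iff_ae_notMem.1 h1
  filter_upwards [h2] with z hz hzT
  have h3 : z ∈ interior (range I) := by
    by_contra h
    exact hz ⟨subset_closure (extChartAt_target_subset_range i hzT), h⟩
  rw [mem_interior_iff_mem_nhds]
  have h4 := extChartAt_target_mem_nhdsWithin_of_mem hzT
  rwa [nhdsWithin_eq_nhds.2 (mem_interior_iff_mem_nhds.1 h3)] at h4

theorem aemeasurable_extChartAt_symm [MeasurableSpace M] [BorelSpace M] (i : M) :
    AEMeasurable (extChartAt I i).symm (volume.restrict (extChartAt I i).target) :=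
  (continuousOn_extChartAt_symm i).aemeasurable (measurableSet_extChartAt_target i)

variable [IsManifold I ∞ M]

/-- The density `√det(g_{αβ})` of the Riemannian volume in the chart around `x₀`. -/
def chartDensity (g : Metric I M) (x₀ : M) (z : Euc m) : ℝ :=
  √(gram g ((extChartAt I x₀).symm z) (coordVec I x₀ z)).det

theorem gram_coordVec (g : Metric I M) {x₀ : M} {z : Euc m} (hz : z ∈ (extChartAt I x₀).target) :
    gram g ((extChartAt I x₀).symm z) (coordVec I x₀ z) =
      gram g ((extChartAt I x₀).symm z) (chartVec I x₀ ((extChartAt I x₀).symm z)) := by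
  rw [show coordVec I x₀ z = chartVec I x₀ ((extChartAt I x₀).symm z) from
    funext fun α => coordVec_eq hz α]

theorem continuousOn_chartDensity (g : Metric I M) (x₀ : M) :
    ContinuousOn (chartDensity g x₀) (extChartAt I x₀).target := by
  have h1 : ContinuousOn (fun x => (gram g x (chartVec I x₀ x)).det) (chartAt H x₀).source :=
    (continuous_id.matrix_det).comp_continuousOn
      (continuousOn_pi.2 fun i => continuousOn_pi.2 fun j => continuousOn_gram_chartVec g x₀ i j)
  have h2 := (h1.comp (continuousOn_extChartAt_symm (I := I) x₀) fun z hz => symm_mem_source (I := I) hz).sqrt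
  refine h2.congr fun z hz => ?_
  rw [chartDensity, gram_coordVec g hz]
  rfl

theorem chartDensity_pos (g : Metric I M) {x₀ : M} {z : Euc m}
    (hz : z ∈ (extChartAt I x₀).target) : 0 < chartDensity g x₀ z := by
  rw [chartDensity, gram_coordVec g hz]
  exact Real.sqrt_pos.2 (gram_posDef g (linearIndependent_chartVec (symm_mem_source hz))).det_pos

variable [T2Space M] [SigmaCompactSpace M] [MeasurableSpace M] [BorelSpace M]

theorem lintegral_chart (g : Metric I M) (i : M) {f : M → ℝ≥0∞} (hf : Measurable f) :
    ∫⁻ x, f x ∂((chartVolume g i).withDensity fun x => ENNReal.ofReal (chartPartition I M i x)) =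
      ∫⁻ z in (extChartAt I i).target, ENNReal.ofReal (chartDensity g i z) *
        (ENNReal.ofReal (chartPartition I M i ((extChartAt I i).symm z)) *
          f ((extChartAt I i).symm z)) := by
  have hT := measurableSet_extChartAt_target (I := I) i
  have hρ : Measurable fun x => ENNReal.ofReal (chartPartition I M i x) :=
    (chartPartition I M i).contMDiff.continuous.measurable.ennreal_ofReal
  have hd : AEMeasurable (fun z => ENNReal.ofReal (chartDensity g i z))
      (volume.restrict (extChartAt I i).target) :=
    ((continuousOn_chartDensity g i).aemeasurable hT).ennreal_ofReal
  have hs : AEMeasurable (extChartAt I i).symm (volume.restrict (extChartAt I i).target) :=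
    (continuousOn_extChartAt_symm i).aemeasurable hT
  rw [lintegral_withDensity_eq_lintegral_mul _ hρ hf, chartVolume]
  rw [lintegral_map' (hρ.mul hf).aemeasurable
    (hs.mono_ac (withDensity_absolutelyContinuous _ _))]
  exact lintegral_withDensity_eq_lintegral_mul₀ hd ((hρ.mul hf).comp_aemeasurable hs)

theorem lintegral_vol (g : Metric I M) {f : M → ℝ≥0∞} (hf : Measurable f) :
    ∫⁻ x, f x ∂(vol g) = ∑' i : M, ∫⁻ z in (extChartAt I i).target,
      ENNReal.ofReal (chartDensity g i z) *
        (ENNReal.ofReal (chartPartition I M i ((extChartAt I i).symm z)) *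
          f ((extChartAt I i).symm z)) := by
  rw [vol, lintegral_sum_measure]
  exact tsum_congr fun i => lintegral_chart g i hf

/-- The volume of a compact manifold is finite: only finitely many functions of the partition of
unity do not vanish, and the density is bounded on their supports. -/
theorem vol_univ_lt_top [CompactSpace M] (g : Metric I M) : vol g univ < ⊤ := by
  have h1 := lintegral_vol g (f := fun _ => 1) measurable_const
  rw [lintegral_one] at h1
  rw [h1]
  have hfin : {i : M | (Function.support (chartPartition I M i)).Nonempty}.Finite :=
    (chartPartition I M).locallyFinite.finite_nonempty_of_compact
  rw [tsum_eq_sum (s := hfin.toFinset) fun i hi => ?_]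
  · refine ENNReal.sum_lt_top.2 fun i _ => ?_
    have hsub : tsupport (chartPartition I M i) ⊆ (extChartAt I i).source := by
      rw [extChartAt_source]
      exact Classical.choose_spec
        (SmoothPartitionOfUnity.exists_isSubordinate_chartAt_source I M) i
    set K : Set (Euc m) := extChartAt I i '' tsupport (chartPartition I M i)
    have hK : IsCompact K :=
      (isClosed_tsupport _).isCompact.image_of_continuousOn ((continuousOn_extChartAt i).mono hsub)
    have hKT : K ⊆ (extChartAt I i).target := by
      rintro _ ⟨x, hx, rfl⟩
      exact (extChartAt I i).map_source (hsub hx)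
    obtain ⟨C, hC⟩ := hK.exists_bound_of_continuousOn ((continuousOn_chartDensity g i).mono hKT)
    calc _ ≤ ∫⁻ z in (extChartAt I i).target, K.indicator (fun _ => ENNReal.ofReal C) z := by
          refine setLIntegral_mono' (measurableSet_extChartAt_target i) fun z hz => ?_
          by_cases hzK : z ∈ K
          · rw [indicator_of_mem hzK, mul_one]
            calc _ ≤ ENNReal.ofReal C * 1 := by
                  refine mul_le_mul' (ENNReal.ofReal_le_ofReal
                    ((le_abs_self _).trans (hC z hzK))) ?_
                  exact ENNReal.ofReal_le_one.2 ((chartPartition I M).le_one i _)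
              _ = _ := mul_one _
          · have : chartPartition I M i ((extChartAt I i).symm z) = 0 := by
              refine image_eq_zero_of_notMem_tsupport fun h => hzK ?_
              exact ⟨_, h, (extChartAt I i).right_inv hz⟩
            rw [this]
            simp
      _ ≤ ∫⁻ z, K.indicator (fun _ => ENNReal.ofReal C) z := lintegral_mono' Measure.restrict_le_self
          le_rfl
      _ = ENNReal.ofReal C * volume K := lintegral_indicator_const hK.measurableSet _
      _ < ⊤ := ENNReal.mul_lt_top ENNReal.ofReal_lt_top hK.measure_lt_top
  · have : chartPartition I M i = 0 := by
      ext x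
      by_contra hx
      exact hi (hfin.mem_toFinset.2 ⟨x, hx⟩)
    simp [this]

instance isFiniteMeasure_vol [CompactSpace M] (g : Metric I M) : IsFiniteMeasure (vol g) :=
  ⟨vol_univ_lt_top g⟩

end Volume

/-! ### Uniqueness of the weak differential -/

section Uniqueness

variable {m k : ℕ} {H : Type*} [TopologicalSpace H] {I : ModelWithCorners ℝ (Euc m) H}
  {M : Type*} [TopologicalSpace M] [ChartedSpace H M] [IsManifold I ∞ M]

/-- Coordinate vectors are controlled by the metric, locally uniformly. -/
theorem exists_norm_apply_chartVec_le (g : Metric I M) (x₀ : M) :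
    ∃ C : M → ℝ, ContinuousOn C (chartAt H x₀).source ∧ (∀ x, 0 ≤ C x) ∧
      ∀ x ∈ (chartAt H x₀).source, ∀ (k : ℕ) (D : TangentSpace I x →L[ℝ] Euc k) (α : Fin m),
        ‖D (chartVec I x₀ x α)‖ ≤ C x * gnorm g x D := by
  obtain ⟨L, hLc, hL⟩ := exists_continuousOn_cholesky (O := (chartAt H x₀).source)
    (fun x => (gram g x (chartVec I x₀ x))⁻¹) (continuousOn_inv_gram_chartVec g x₀)
    fun x hx => (gram_posDef g (linearIndependent_chartVec hx)).inv
  -- `c x i α` are the components of the coordinate vectors in the orthonormal frame `L x`.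
  let c : M → Fin m → Fin m → ℝ := fun x i α => ∑ β, L x β i * gram g x (chartVec I x₀ x) β α
  have hcc : ∀ i α, ContinuousOn (fun x => c x i α) (chartAt H x₀).source := fun i α =>
    continuousOn_finsetSum _ fun β _ => (hLc β i).mul (continuousOn_gram_chartVec g x₀ β α)
  refine ⟨fun x => ∑ i, ∑ α, |c x i α|, continuousOn_finsetSum _ fun i _ =>
    continuousOn_finsetSum _ fun α _ => (hcc i α).abs, fun x => by positivity,
    fun x hx k D α => ?_⟩
  have hdet : IsUnit (gram g x (chartVec I x₀ x)).det :=
    (gram_posDef g (linearIndependent_chartVec hx)).det_pos.ne'.isUnit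
  have hexp : ∑ i, c x i α • ∑ γ, L x γ i • chartVec I x₀ x γ = chartVec I x₀ x α := by
    have h1 : ∀ γ, ∑ i, c x i α * L x γ i = if γ = α then 1 else 0 := fun γ => by
      have h2 : ∑ β, (gram g x (chartVec I x₀ x))⁻¹ γ β * gram g x (chartVec I x₀ x) β α =
          if γ = α then 1 else 0 := by
        have h3 := congrFun (congrFun (Matrix.nonsing_inv_mul _ hdet) γ) α
        rwa [Matrix.mul_apply, Matrix.one_apply] at h3
      rw [← h2]
      simp only [c, Finset.sum_mul]
      rw [Finset.sum_comm]
      refine Finset.sum_congr rfl fun β _ => ?_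
      rw [← hL x hx γ β, Finset.sum_mul]
      exact Finset.sum_congr rfl fun i _ => by ring
    simp only [Finset.smul_sum, smul_smul]
    rw [Finset.sum_comm]
    simp only [← Finset.sum_smul, h1]
    simp
  have hn := gnorm_eq_norm_mk g (linearIndependent_chartVec hx) (hL x hx) D
  calc ‖D (chartVec I x₀ x α)‖ = ‖∑ i, c x i α • D (∑ γ, L x γ i • chartVec I x₀ x γ)‖ := by
        conv_lhs => rw [← hexp]
        rw [map_sum]
        simp only [map_smul]
    _ ≤ ∑ i, |c x i α| * gnorm g x D := by
        refine (norm_sum_le _ _).trans (Finset.sum_le_sum fun i _ => ?_)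
        rw [norm_smul, Real.norm_eq_abs, hn]
        refine mul_le_mul_of_nonneg_left ?_ (abs_nonneg _)
        exact PiLp.norm_apply_le (p := 2) (β := fun _ : Fin m => Euc k)
          (WithLp.toLp 2 fun i => D (∑ α, L x α i • chartVec I x₀ x α)) i
    _ ≤ (∑ i, ∑ α, |c x i α|) * gnorm g x D := by
        rw [Finset.sum_mul]
        refine Finset.sum_le_sum fun i _ => mul_le_mul_of_nonneg_right ?_ (by rw [hn]; positivity)
        exact Finset.single_le_sum (f := fun α => |c x i α|) (fun _ _ => abs_nonneg _)
          (Finset.mem_univ α)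

variable [T2Space M] [SigmaCompactSpace M]

/-- The coordinates of the interior points of `M` at which the `i`-th function of the partition of
unity is positive. -/
def chartSupport (I : ModelWithCorners ℝ (Euc m) H) {M : Type*} [TopologicalSpace M]
    [ChartedSpace H M] [IsManifold I ∞ M] [T2Space M] [SigmaCompactSpace M] (i : M) : Set (Euc m) :=
  interior (extChartAt I i).target ∩
    (extChartAt I i).symm ⁻¹' {x | 0 < chartPartition I M i x}

theorem chartSupport_subset (i : M) : chartSupport I i ⊆ (extChartAt I i).target :=
  fun _ hz => interior_subset hz.1

theorem isOpen_chartSupport (i : M) : IsOpen (chartSupport I i) :=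
  ((continuousOn_extChartAt_symm i).mono interior_subset).isOpen_inter_preimage isOpen_interior
    (isOpen_lt continuous_const (chartPartition I M i).contMDiff.continuous)

variable [MeasurableSpace M] [BorelSpace M]

theorem aemeasurable_chart_integrand (g : Metric I M) (i : M) {f : M → ℝ≥0∞} (hf : Measurable f) :
    AEMeasurable (fun z => ENNReal.ofReal (chartDensity g i z) *
      (ENNReal.ofReal (chartPartition I M i ((extChartAt I i).symm z)) *
          f ((extChartAt I i).symm z))) (volume.restrict (extChartAt I i).target) := by
  have hρ : Measurable fun x => ENNReal.ofReal (chartPartition I M i x) :=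
    (chartPartition I M i).contMDiff.continuous.measurable.ennreal_ofReal
  exact ((continuousOn_chartDensity g i).aemeasurable
    (measurableSet_extChartAt_target i)).ennreal_ofReal.mul
      ((hρ.mul hf).comp_aemeasurable (aemeasurable_extChartAt_symm i))

theorem ae_chartSupport_of_ae (g : Metric I M) {P : M → Prop} (hP : ∀ᵐ x ∂(vol g), P x) (i : M) :
    ∀ᵐ z, z ∈ chartSupport I i → P ((extChartAt I i).symm z) := by
  obtain ⟨N, hN, hNm, hN0⟩ := exists_measurable_superset_of_null hP
  have hf : Measurable (N.indicator fun _ => (1 : ℝ≥0∞)) := measurable_const.indicator hNm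
  have h1 := lintegral_vol g hf
  rw [lintegral_indicator_const hNm, hN0, mul_zero, eq_comm, ENNReal.tsum_eq_zero] at h1
  have h2 := (lintegral_eq_zero_iff' (aemeasurable_chart_integrand g i hf)).1 (h1 i)
  filter_upwards [(ae_restrict_iff' (measurableSet_extChartAt_target i)).1 h2] with z hz hzΩ
  have hzT := chartSupport_subset i hzΩ
  have h3 := hz hzT
  by_contra hc
  simp only [Pi.zero_apply, mul_eq_zero, ENNReal.ofReal_eq_zero] at h3
  rcases h3 with h3 | h3 | h3
  · exact (chartDensity_pos g hzT).not_ge h3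
  · exact (show 0 < chartPartition I M i _ from hzΩ.2).not_ge h3
  · rw [indicator_of_mem (hN hc)] at h3
    exact one_ne_zero h3

theorem ae_eq_zero_of_forall_chartSupport (g : Metric I M) {f : M → ℝ≥0∞} (hf : Measurable f)
    (h : ∀ i, ∀ᵐ z, z ∈ chartSupport I i → f ((extChartAt I i).symm z) = 0) :
    ∀ᵐ x ∂(vol g), f x = 0 := by
  refine (lintegral_eq_zero_iff hf).1 ?_
  rw [lintegral_vol g hf, ENNReal.tsum_eq_zero]
  intro i
  refine (lintegral_eq_zero_iff' (aemeasurable_chart_integrand g i hf)).2 ?_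
  refine (ae_restrict_iff' (measurableSet_extChartAt_target i)).2 ?_
  filter_upwards [h i, ae_mem_interior_extChartAt_target (I := I) i] with z h1 h2 hzT
  by_cases hρ : 0 < chartPartition I M i ((extChartAt I i).symm z)
  · rw [h1 ⟨h2 hzT, hρ⟩]
    simp
  · rw [ENNReal.ofReal_eq_zero.2 (not_lt.1 hρ)]
    simp

theorem locallyIntegrableOn_chartSupport (g : Metric I M) {h : M → ℝ} (hm : Measurable h)
    (hint : Integrable h (vol g)) (i : M) :
    LocallyIntegrableOn (fun z => h ((extChartAt I i).symm z)) (chartSupport I i) volume := by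
  have hΩ := isOpen_chartSupport (I := I) i
  have hT := measurableSet_extChartAt_target (I := I) i
  set θ : Euc m → ℝ := fun z => chartDensity g i z * chartPartition I M i ((extChartAt I i).symm z)
  have hθc : ContinuousOn θ (extChartAt I i).target := (continuousOn_chartDensity g i).mul
    ((chartPartition I M i).contMDiff.continuous.comp_continuousOn (continuousOn_extChartAt_symm i))
  have hθpos : ∀ z ∈ chartSupport I i, 0 < θ z := fun z hz =>
    mul_pos (chartDensity_pos g (chartSupport_subset i hz)) hz.2
  have h1 : IntegrableOn (fun z => θ z * h ((extChartAt I i).symm z)) (extChartAt I i).target := by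
    refine ⟨(hθc.aestronglyMeasurable hT).mul
      (hm.comp_aemeasurable (aemeasurable_extChartAt_symm i)).aestronglyMeasurable, ?_⟩
    refine lt_of_le_of_lt ?_ hint.2
    rw [lintegral_vol g hm.enorm]
    refine le_trans (le_of_eq ?_) (ENNReal.le_tsum i)
    refine setLIntegral_congr_fun hT fun z hz => ?_
    simp only [θ, enorm_mul, mul_assoc]
    rw [Real.enorm_of_nonneg (chartDensity_pos g hz).le,
      Real.enorm_of_nonneg ((chartPartition I M).nonneg i _)]
  have h2 : LocallyIntegrableOn (fun z => θ z * h ((extChartAt I i).symm z)) (chartSupport I i) :=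
    (h1.mono_set (chartSupport_subset i)).locallyIntegrableOn
  have h3 := h2.continuousOn_mul (g := fun z => (θ z)⁻¹)
    ((hθc.mono (chartSupport_subset i)).inv₀ fun z hz => (hθpos z hz).ne') hΩ.isLocallyClosed
  refine (locallyIntegrableOn_iff hΩ.isLocallyClosed).2 fun K hK hKc => ?_
  refine (h3.integrableOn_compact_subset hK hKc).congr_fun (fun z hz => ?_) hKc.measurableSet
  have := (hθpos z (hK hz)).ne'
  simp only
  field_simp

/-- The differential is closable: if smooth maps `w_j` tend to `0` and `dw_j` tends to `D`, dominated
by an integrable function, then `D = 0` almost everywhere. -/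
theorem ae_gnorm_eq_zero (g : Metric I M) {w : ℕ → M → Euc k} (hw : ∀ j, w j ∈ smoothMaps I M k)
    {D : ∀ x : M, TangentSpace I x →L[ℝ] Euc k} {h : M → ℝ} (hm : Measurable h)
    (hint : Integrable h (vol g)) (hDm : AEMeasurable (fun x => gnorm g x (D x)) (vol g))
    (hlim : ∀ᵐ x ∂(vol g), (∀ j, ‖w j x‖ ≤ h x ∧ gnorm g x (dif I (w j) x - D x) ≤ h x) ∧
      Tendsto (fun j => w j x) atTop (𝓝 0) ∧
      Tendsto (fun j => gnorm g x (dif I (w j) x - D x)) atTop (𝓝 0)) :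
    ∀ᵐ x ∂(vol g), gnorm g x (D x) = 0 := by
  have hchart : ∀ i, ∀ᵐ z, z ∈ chartSupport I i →
      gnorm g ((extChartAt I i).symm z) (D ((extChartAt I i).symm z)) = 0 := by
    intro i
    have hΩ := isOpen_chartSupport (I := I) i
    obtain ⟨C, hCc, hC0, hC⟩ := exists_norm_apply_chartVec_le g i
    have hcoord : ∀ α : Fin m, ∀ᵐ z, z ∈ chartSupport I i →
        D ((extChartAt I i).symm z) (coordVec I i z α) = 0 := by
      intro α
      have hq : LocallyIntegrableOn
          (fun z => (1 + C ((extChartAt I i).symm z)) * h ((extChartAt I i).symm z))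
          (chartSupport I i) volume := by
        refine (locallyIntegrableOn_chartSupport g hm hint i).continuousOn_mul
          (g := fun z => 1 + C ((extChartAt I i).symm z)) ?_ hΩ.isLocallyClosed
        exact continuousOn_const.add (hCc.comp ((continuousOn_extChartAt_symm (I := I) i).mono
          (chartSupport_subset i)) fun z hz => symm_mem_source (chartSupport_subset i hz))
      refine ae_eq_zero_of_tendsto_fderiv hΩ (v := fun j => w j ∘ (extChartAt I i).symm)
        (e := EuclideanSpace.single α (1 : ℝ)) (fun j => ?_) hq ?_
      · have hwj : ContMDiff I 𝓘(ℝ, Euc k) ∞ (w j) := hw j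
        have h1 : ContDiffOn ℝ ∞ (w j ∘ (extChartAt I i).symm) (extChartAt I i).target :=
          contMDiffOn_iff_contDiffOn.1 (hwj.comp_contMDiffOn (contMDiffOn_extChartAt_symm i))
        exact (h1.mono (chartSupport_subset i)).of_le (by simp)
      · filter_upwards [ae_chartSupport_of_ae g hlim i] with z hz hzΩ
        obtain ⟨hb, hl1, hl2⟩ := hz hzΩ
        have hzT := chartSupport_subset i hzΩ
        set x := (extChartAt I i).symm z
        have hx : x ∈ (chartAt H i).source := symm_mem_source hzT
        have hfd : ∀ j, fderiv ℝ (w j ∘ (extChartAt I i).symm) z (EuclideanSpace.single α (1 : ℝ)) -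
            D x (coordVec I i z α) = (dif I (w j) x - D x) (chartVec I i x α) := fun j => by
          have h1 := dif_chartVec (hw j) hx α
          have h2 : extChartAt I i x = z := (extChartAt I i).right_inv hzT
          have h3 : range I ∈ 𝓝 z := mem_of_superset (mem_interior_iff_mem_nhds.1 hzΩ.1)
            (extChartAt_target_subset_range i)
          rw [h2, fderivWithin_of_mem_nhds h3] at h1
          rw [coordVec_eq hzT, ← h1]
          rfl
        have hle : ∀ j, ‖fderiv ℝ (w j ∘ (extChartAt I i).symm) z
            (EuclideanSpace.single α (1 : ℝ)) - D x (coordVec I i z α)‖ ≤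
            C x * gnorm g x (dif I (w j) x - D x) := fun j => by
          rw [hfd]
          exact hC x hx k _ α
        have hh0 : 0 ≤ h x := (norm_nonneg _).trans (hb 0).1
        refine ⟨fun j => ⟨?_, (hle j).trans ?_⟩, hl1, ?_⟩
        · refine (hb j).1.trans ?_
          nlinarith [mul_nonneg (hC0 x) hh0]
        · nlinarith [mul_le_mul_of_nonneg_left (hb j).2 (hC0 x)]
        · rw [tendsto_iff_norm_sub_tendsto_zero]
          refine squeeze_zero (fun _ => norm_nonneg _) hle ?_
          simpa using hl2.const_mul (C x)
    filter_upwards [ae_all_iff.2 hcoord] with z hz hzΩ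
    have hzT := chartSupport_subset i hzΩ
    have h1 : ∀ α, D ((extChartAt I i).symm z) (chartVec I i ((extChartAt I i).symm z) α) = 0 :=
      fun α => by rw [← coordVec_eq hzT]; exact hz α hzΩ
    rw [gnorm_eq g (linearIndependent_chartVec (symm_mem_source hzT))]
    simp only [h1, inner_zero_left, mul_zero, Finset.sum_const_zero, Real.sqrt_zero]
  have hmk := hDm.ae_eq_mk
  have h1 : ∀ᵐ x ∂(vol g), ‖hDm.mk _ x‖ₑ = 0 := by
    refine ae_eq_zero_of_forall_chartSupport g hDm.measurable_mk.enorm fun i => ?_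
    filter_upwards [hchart i, ae_chartSupport_of_ae g hmk i] with z hz1 hz2 hzΩ
    rw [← hz2 hzΩ, hz1 hzΩ, enorm_zero]
  filter_upwards [hmk, h1] with x hx1 hx2
  rw [hx1]
  simpa using hx2

end Uniqueness

/-! ### Differential calculus of maps into Euclidean spaces -/

section Calculus

variable {m k : ℕ} {H : Type*} [TopologicalSpace H] {I : ModelWithCorners ℝ (Euc m) H}
  {M : Type*} [TopologicalSpace M] [ChartedSpace H M]

theorem comp_prodMk_mem_smoothMaps {G : Euc k × Euc k → Euc k} (hG : ContDiff ℝ ∞ G)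
    {f₁ f₂ : M → Euc k} (h₁ : f₁ ∈ smoothMaps I M k) (h₂ : f₂ ∈ smoothMaps I M k) :
    (fun x => G (f₁ x, f₂ x)) ∈ smoothMaps I M k :=
  hG.contMDiff.comp (ContMDiff.prodMk_space h₁ h₂)

theorem dif_comp_prodMk {G : Euc k × Euc k → Euc k} (hG : ContDiff ℝ ∞ G)
    {f₁ f₂ : M → Euc k} (h₁ : f₁ ∈ smoothMaps I M k) (h₂ : f₂ ∈ smoothMaps I M k) (x : M)
    (v : TangentSpace I x) :
    dif I (fun x => G (f₁ x, f₂ x)) x v =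
      fderiv ℝ G (f₁ x, f₂ x) (dif I f₁ x v, dif I f₂ x v) := by
  have hd : ∀ f ∈ smoothMaps I M k, HasMFDerivAt I 𝓘(ℝ, Euc k) f x (dif I f x) := fun f hf =>
    ((show ContMDiff I 𝓘(ℝ, Euc k) ∞ f from hf) x).mdifferentiableAt (by simp) |>.hasMFDerivAt
  have hx : (extChartAt I x).symm (extChartAt I x x) = x := extChartAt_to_inv x
  have h3 : HasFDerivAt G (fderiv ℝ G (f₁ x, f₂ x))
      ((writtenInExtChartAt I 𝓘(ℝ, Euc k) x f₁ (extChartAt I x x)),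
        (writtenInExtChartAt I 𝓘(ℝ, Euc k) x f₂ (extChartAt I x x))) := by
    have h4 : ∀ f : M → Euc k, writtenInExtChartAt I 𝓘(ℝ, Euc k) x f (extChartAt I x x) = f x :=
      fun f => by
        simp only [writtenInExtChartAt, extChartAt_model_space_eq_id, Function.comp, hx]
        rfl
    rw [h4, h4]
    exact (hG.differentiable (by simp) _).hasFDerivAt
  have h5 := h3.comp_hasFDerivWithinAt (extChartAt I x x) ((hd f₁ h₁).2.prodMk (hd f₂ h₂).2)
  have h6 : HasMFDerivAt I 𝓘(ℝ, Euc k) (fun x => G (f₁ x, f₂ x)) x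
      ((fderiv ℝ G (f₁ x, f₂ x)).comp ((dif I f₁ x).prod (dif I f₂ x))) :=
    ⟨(hG.continuous.continuousAt).comp ((hd f₁ h₁).1.prodMk (hd f₂ h₂).1), h5⟩
  rw [dif, h6.mfderiv]
  rfl

end Calculus

/-! ### Dominated limits -/

section DominatedLimit

variable {X : Type*} [MeasurableSpace X] {μ : Measure X} {k m : ℕ}

/-- The pairs `(w_j, W_j)` tend to `(u, U)` almost everywhere, and the differences are dominated by a
function in `Lᵖ`. Every sequence that converges in `W^{1,p}` has such a subsequence, and dominated
limits survive the nonlinear operations of the argument. -/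
def IsDominatedLimit (μ : Measure X) (p : ℝ) (w : ℕ → X → Euc k) (W : ℕ → X → Fld k m)
    (u : X → Euc k) (U : X → Fld k m) : Prop :=
  ∃ h : X → ℝ, (∀ x, 0 ≤ h x) ∧ MemLp h (ENNReal.ofReal p) μ ∧ ∀ᵐ x ∂μ,
    (∀ j, ‖w j x - u x‖ ≤ h x ∧ ‖W j x - U x‖ ≤ h x) ∧
    Tendsto (fun j => w j x) atTop (𝓝 (u x)) ∧ Tendsto (fun j => W j x) atTop (𝓝 (U x))

variable {p : ℝ} {w w' : ℕ → X → Euc k} {W W' : ℕ → X → Fld k m} {u u' : X → Euc k}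
  {U U' : X → Fld k m}

theorem IsDominatedLimit.aestronglyMeasurable_left (hd : IsDominatedLimit μ p w W u U)
    (hw : ∀ j, AEStronglyMeasurable (w j) μ) : AEStronglyMeasurable u μ := by
  obtain ⟨h, -, -, hl⟩ := hd
  exact aestronglyMeasurable_of_tendsto_ae atTop hw (hl.mono fun x hx => hx.2.1)

theorem IsDominatedLimit.aestronglyMeasurable_right (hd : IsDominatedLimit μ p w W u U)
    (hW : ∀ j, AEStronglyMeasurable (W j) μ) : AEStronglyMeasurable U μ := by
  obtain ⟨h, -, -, hl⟩ := hd
  exact aestronglyMeasurable_of_tendsto_ae atTop hW (hl.mono fun x hx => hx.2.2)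

theorem IsDominatedLimit.memLp (hd : IsDominatedLimit μ p w W u U)
    (hW : ∀ j, MemLp (W j) (ENNReal.ofReal p) μ) : MemLp U (ENNReal.ofReal p) μ := by
  have hU := hd.aestronglyMeasurable_right fun j => (hW j).1
  obtain ⟨h, -, hh, hl⟩ := hd
  have h1 : MemLp (fun x => W 0 x - U x) (ENNReal.ofReal p) μ := by
    refine hh.mono' ((hW 0).1.sub hU) ?_
    filter_upwards [hl] with x hx
    exact (hx.1 0).2
  refine ((hW 0).sub h1).ae_eq (.of_forall fun x => ?_)
  simp

theorem IsDominatedLimit.congr (hd : IsDominatedLimit μ p w W u U) (hu : u =ᵐ[μ] u')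
    (hU : U =ᵐ[μ] U') : IsDominatedLimit μ p w W u' U' := by
  obtain ⟨h, h0, hh, hl⟩ := hd
  refine ⟨h, h0, hh, ?_⟩
  filter_upwards [hl, hu, hU] with x hx h1 h2
  rwa [← h1, ← h2]

theorem IsDominatedLimit.add_const (hd : IsDominatedLimit μ p w W u U) (ψ : X → Euc k)
    (Ψ : X → Fld k m) : IsDominatedLimit μ p (fun j x => w j x + ψ x) (fun j x => W j x + Ψ x)
      (fun x => u x + ψ x) (fun x => U x + Ψ x) := by
  obtain ⟨h, h0, hh, hl⟩ := hd
  refine ⟨h, h0, hh, ?_⟩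
  filter_upwards [hl] with x hx
  simp only [add_sub_add_right_eq_sub]
  exact ⟨hx.1, hx.2.1.add_const _, hx.2.2.add_const _⟩

theorem tendsto_lift {F : Euc k → Euc k} (hF : ContDiff ℝ ∞ F) {w : ℕ → Euc k} {W : ℕ → Fld k m}
    {u : Euc k} {U : Fld k m} (hw : Tendsto w atTop (𝓝 u)) (hW : Tendsto W atTop (𝓝 U)) :
    Tendsto (fun j => lift (fderiv ℝ F (w j)) (W j)) atTop (𝓝 (lift (fderiv ℝ F u) U)) := by
  have hdF : Continuous (fderiv ℝ F) := hF.continuous_fderiv (by simp)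
  have h1 : Tendsto (fun j => (lift : _ →L[ℝ] Fld k m →L[ℝ] Fld k m) (fderiv ℝ F (w j))) atTop
      (𝓝 (lift (fderiv ℝ F u))) := ((lift.continuous.comp hdF).tendsto u).comp hw
  exact ((isBoundedBilinearMap_apply (𝕜 := ℝ)).continuous.tendsto (lift (fderiv ℝ F u), U)).comp
    (h1.prodMk_nhds hW)

/-- The chain rule for dominated limits. -/
theorem IsDominatedLimit.comp (hd : IsDominatedLimit μ p w W u U) {F : Euc k → Euc k}
    (hF : ContDiff ℝ ∞ F) {K : ℝ} (hK : ∀ z, ‖fderiv ℝ F z‖ ≤ K)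
    (hU : MemLp U (ENNReal.ofReal p) μ) :
    IsDominatedLimit μ p (fun j x => F (w j x)) (fun j x => lift (fderiv ℝ F (w j x)) (W j x))
      (fun x => F (u x)) (fun x => lift (fderiv ℝ F (u x)) (U x)) := by
  obtain ⟨h, h0, hh, hl⟩ := hd
  have hK0 : 0 ≤ K := (norm_nonneg _).trans (hK 0)
  refine ⟨fun x => K * (h x + 2 * ‖U x‖), fun x => mul_nonneg hK0
    (add_nonneg (h0 x) (by positivity)), (hh.add (hU.norm.const_mul 2)).const_mul K, ?_⟩
  filter_upwards [hl] with x hx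
  refine ⟨fun j => ⟨?_, ?_⟩, (hF.continuous.tendsto _).comp hx.2.1, tendsto_lift hF hx.2.1 hx.2.2⟩
  · have h1 := Convex.norm_image_sub_le_of_norm_fderiv_le (𝕜 := ℝ) (f := F) (s := univ)
      (fun z _ => hF.differentiable (by simp) z) (fun z _ => hK z) convex_univ (mem_univ (u x))
      (mem_univ (w j x))
    refine h1.trans (mul_le_mul_of_nonneg_left ?_ hK0)
    linarith [(hx.1 j).1, norm_nonneg (U x)]
  · have h1 : ‖W j x‖ ≤ h x + ‖U x‖ := by
      have h2 := norm_add_le (W j x - U x) (U x)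
      rw [sub_add_cancel] at h2
      linarith [(hx.1 j).2]
    have h2 : ∀ (z : Euc k) (A : Fld k m), ‖lift (fderiv ℝ F z) A‖ ≤ K * ‖A‖ := fun z A =>
      (norm_lift_le _ _).trans (mul_le_mul_of_nonneg_right (hK z) (norm_nonneg _))
    calc _ ≤ K * ‖W j x‖ + K * ‖U x‖ := (norm_sub_le _ _).trans (add_le_add (h2 _ _) (h2 _ _))
      _ ≤ K * (h x + ‖U x‖) + K * ‖U x‖ := by gcongr
      _ = _ := by ring

theorem IsDominatedLimit.sub (hd : IsDominatedLimit μ p w W u U)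
    (hd' : IsDominatedLimit μ p w' W' u' U') :
    IsDominatedLimit μ p (fun j x => w j x - w' j x) (fun j x => W j x - W' j x)
      (fun x => u x - u' x) (fun x => U x - U' x) := by
  obtain ⟨h, h0, hh, hl⟩ := hd
  obtain ⟨h', h0', hh', hl'⟩ := hd'
  refine ⟨fun x => h x + h' x, fun x => add_nonneg (h0 x) (h0' x), hh.add hh', ?_⟩
  filter_upwards [hl, hl'] with x hx hx'
  refine ⟨fun j => ⟨?_, ?_⟩, hx.2.1.sub hx'.2.1, hx.2.2.sub hx'.2.2⟩
  · rw [sub_sub_sub_comm]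
    exact (norm_sub_le _ _).trans (add_le_add (hx.1 j).1 (hx'.1 j).1)
  · rw [sub_sub_sub_comm]
    exact (norm_sub_le _ _).trans (add_le_add (hx.1 j).2 (hx'.1 j).2)

theorem tendsto_eLpNorm_of_dominated {F : Type*} [NormedAddCommGroup F] (hp : 0 < p)
    {f : ℕ → X → F} (hf : ∀ j, AEStronglyMeasurable (f j) μ) {h : X → ℝ}
    (hh : MemLp h (ENNReal.ofReal p) μ)
    (hl : ∀ᵐ x ∂μ, (∀ j, ‖f j x‖ ≤ h x) ∧ Tendsto (fun j => f j x) atTop (𝓝 0)) :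
    Tendsto (fun j => eLpNorm (f j) (ENNReal.ofReal p) μ) atTop (𝓝 0) := by
  have hp0 : ENNReal.ofReal p ≠ 0 := by simpa using hp
  have hpr : (ENNReal.ofReal p).toReal = p := ENNReal.toReal_ofReal hp.le
  have h1 : Tendsto (fun j => ∫⁻ x, ‖f j x‖ₑ ^ p ∂μ) atTop (𝓝 (∫⁻ _, 0 ∂μ)) := by
    refine tendsto_lintegral_of_dominated_convergence' (fun x => ‖h x‖ₑ ^ p)
      (fun j => (hf j).enorm.pow_const p) (fun j => ?_) ?_ ?_
    · filter_upwards [hl] with x hx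
      refine ENNReal.rpow_le_rpow ?_ hp.le
      rw [← ofReal_norm, ← ofReal_norm]
      exact ENNReal.ofReal_le_ofReal ((hx.1 j).trans (le_abs_self _))
    · have := lintegral_rpow_enorm_lt_top_of_eLpNorm_lt_top hp0 ENNReal.ofReal_ne_top hh.2
      rw [hpr] at this
      exact this.ne
    · filter_upwards [hl] with x hx
      have h2 := hx.2.enorm
      rw [enorm_zero] at h2
      have h3 := (ENNReal.continuous_rpow_const (y := p)).tendsto 0 |>.comp h2
      rwa [ENNReal.zero_rpow_of_pos hp] at h3
  simp only [lintegral_zero] at h1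
  simp only [eLpNorm_eq_lintegral_rpow_enorm_toReal hp0 ENNReal.ofReal_ne_top, hpr]
  have h2 := (ENNReal.continuous_rpow_const (y := 1 / p)).tendsto 0 |>.comp h1
  rwa [ENNReal.zero_rpow_of_pos (by positivity)] at h2

end DominatedLimit

/-! ### Sobolev limits in an orthonormal frame -/

section SobolevLimit

variable {m k : ℕ} {H : Type*} [TopologicalSpace H] {I : ModelWithCorners ℝ (Euc m) H}
  {M : Type*} [TopologicalSpace M] [ChartedSpace H M]

/-- The components in the family `E` of a field `D` of linear maps `T_x M → ℝᵏ`. -/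
def fld (E : ∀ x : M, Fin m → TangentSpace I x) (D : ∀ x : M, TangentSpace I x →L[ℝ] Euc k)
    (x : M) : Fld k m :=
  Fld.mk fun i => D x (E x i)

@[simp] theorem comp_fld (E : ∀ x : M, Fin m → TangentSpace I x)
    (D : ∀ x : M, TangentSpace I x →L[ℝ] Euc k) (x : M) (i : Fin m) :
    (fld E D x).comp i = D x (E x i) := rfl

theorem continuous_of_mem_smoothMaps {w : M → Euc k} (hw : w ∈ smoothMaps I M k) : Continuous w :=
  ContMDiff.continuous hw

theorem aestronglyMeasurable_of_mem_smoothMaps [MeasurableSpace M] [BorelSpace M] {μ : Measure M}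
    {w : M → Euc k} (hw : w ∈ smoothMaps I M k) : AEStronglyMeasurable w μ :=
  (continuous_of_mem_smoothMaps hw).aestronglyMeasurable

variable [IsManifold I ∞ M] [MeasurableSpace M]

/-- `E` is a measurable orthonormal frame, as far as this is seen by the norms of linear maps and by
the differentials of smooth maps. -/
structure IsFrame (g : Metric I M) (E : ∀ x : M, Fin m → TangentSpace I x) : Prop where
  gnorm_eq : ∀ (x : M) (k : ℕ) (D : TangentSpace I x →L[ℝ] Euc k),
    gnorm g x D = ‖(Fld.mk fun i => D (E x i) : Fld k m)‖
  stronglyMeasurable : ∀ (k : ℕ), ∀ w ∈ smoothMaps I M k, StronglyMeasurable (fld E (dif I w))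

theorem exists_isFrame [SigmaCompactSpace M] [BorelSpace M] (g : Metric I M) :
    ∃ E : ∀ x : M, Fin m → TangentSpace I x, IsFrame g E := by
  rcases isEmpty_or_nonempty M with hM | hM
  · exact ⟨fun x => isEmptyElim x, fun x => isEmptyElim x, fun k w _ =>
      (Subsingleton.elim (fun _ => 0) (fld _ (dif I w))) ▸ stronglyMeasurable_const⟩
  · obtain ⟨E, h1, h2⟩ := exists_frame g
    exact ⟨E, h1, h2⟩

variable {g : Metric I M} {E : ∀ x : M, Fin m → TangentSpace I x}

theorem IsFrame.gnorm_eq_norm_fld (hE : IsFrame g E)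
    (D : ∀ x : M, TangentSpace I x →L[ℝ] Euc k) (x : M) : gnorm g x (D x) = ‖fld E D x‖ :=
  hE.gnorm_eq x k (D x)

theorem IsFrame.gnorm_sub (hE : IsFrame g E) (D D' : ∀ x : M, TangentSpace I x →L[ℝ] Euc k)
    (x : M) : gnorm g x (D x - D' x) = ‖fld E D x - fld E D' x‖ :=
  hE.gnorm_eq x k (D x - D' x)

theorem IsFrame.exists_bound [CompactSpace M] (hE : IsFrame g E) {w : M → Euc k}
    (hw : w ∈ smoothMaps I M k) : ∃ c, ∀ x, ‖w x‖ ≤ c ∧ ‖fld E (dif I w) x‖ ≤ c := by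
  obtain ⟨c, hc⟩ := isCompact_univ.exists_bound_of_continuousOn
    (continuous_of_mem_smoothMaps hw).continuousOn
  obtain ⟨c', hc'⟩ := isCompact_univ.exists_bound_of_continuousOn
    (continuous_gnorm_dif g hw).continuousOn
  refine ⟨max c c', fun x => ⟨(hc x trivial).trans (le_max_left _ _), ?_⟩⟩
  rw [← hE.gnorm_eq_norm_fld]
  exact (le_abs_self _).trans ((hc' x trivial).trans (le_max_right _ _))

theorem IsFrame.memLp_fld_dif [CompactSpace M] (hE : IsFrame g E) {μ : Measure M}
    [IsFiniteMeasure μ] {q : ℝ≥0∞} {w : M → Euc k} (hw : w ∈ smoothMaps I M k) :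
    MemLp (fld E (dif I w)) q μ := by
  obtain ⟨c, hc⟩ := hE.exists_bound hw
  exact .of_bound (hE.stronglyMeasurable k w hw).aestronglyMeasurable c
    (.of_forall fun x => (hc x).2)

variable [T2Space M]

section Sigma

variable [SigmaCompactSpace M] {p : ℝ} {A : Set (M → Euc k)} {u : M → Euc k}
  {D : ∀ x : M, TangentSpace I x →L[ℝ] Euc k}

/-- The frame norm of the difference of differentials and the distance of the maps are added before
passing to a subsequence, so that one subsequence and one dominating function serve both. -/
theorem IsSobolevLimit.exists_isDominatedLimit (hE : IsFrame g E) (hp : 1 ≤ p)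
    (h : IsSobolevLimit g p A u D) :
    ∃ w : ℕ → M → Euc k, (∀ j, w j ∈ A) ∧
      IsDominatedLimit (vol g) p w (fun j => fld E (dif I (w j))) u (fld E D) := by
  obtain ⟨w, hwA, hw1, hw2, hl1, hl2⟩ := h
  have hsum : Tendsto (fun j => eLpNorm (fun x => ‖w j x - u x‖ +
      gnorm g x (dif I (w j) x - D x)) (ENNReal.ofReal p) (vol g)) atTop (𝓝 0) := by
    refine tendsto_of_tendsto_of_tendsto_of_le_of_le tendsto_const_nhds
      (by simpa using hl1.add hl2) (fun _ => zero_le) fun j => ?_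
    refine (eLpNorm_add_le (hw1 j).1.norm (hw2 j).1 (by simpa using hp)).trans ?_
    rw [eLpNorm_norm]
  have hg0 : ∀ x (D : TangentSpace I x →L[ℝ] Euc k), 0 ≤ gnorm g x D := fun x D =>
    Real.sqrt_nonneg _
  obtain ⟨ns, -, h, h0, hh, hl⟩ := exists_dominated_subseq (by linarith)
    (fun j x => add_nonneg (norm_nonneg (w j x - u x)) (hg0 x (dif I (w j) x - D x)))
    (fun j => (hw1 j).1.norm.add (hw2 j).1) hsum
  refine ⟨fun j => w (ns j), fun j => hwA _, h, h0, hh, ?_⟩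
  filter_upwards [hl] with x hx
  simp only [hE.gnorm_sub] at hx
  refine ⟨fun j => ⟨?_, ?_⟩, ?_, ?_⟩
  · exact (le_add_of_nonneg_right (norm_nonneg _)).trans (hx.1 j)
  · exact (le_add_of_nonneg_left (norm_nonneg _)).trans (hx.1 j)
  · rw [tendsto_iff_norm_sub_tendsto_zero]
    exact squeeze_zero (fun _ => norm_nonneg _) (fun j => le_add_of_nonneg_right (norm_nonneg _))
      hx.2
  · rw [tendsto_iff_norm_sub_tendsto_zero]
    exact squeeze_zero (fun _ => norm_nonneg _) (fun j => le_add_of_nonneg_left (norm_nonneg _))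
      hx.2

variable [BorelSpace M]

theorem IsDominatedLimit.isSobolevLimit (hE : IsFrame g E) (hp : 0 < p) {w : ℕ → M → Euc k}
    (hA : A ⊆ smoothMaps I M k) (hwA : ∀ j, w j ∈ A)
    (hd : IsDominatedLimit (vol g) p w (fun j => fld E (dif I (w j))) u (fld E D)) :
    IsSobolevLimit g p A u D := by
  have hum := hd.aestronglyMeasurable_left fun j =>
    aestronglyMeasurable_of_mem_smoothMaps (hA (hwA j))
  have hDm := hd.aestronglyMeasurable_right fun j =>
    (hE.stronglyMeasurable k (w j) (hA (hwA j))).aestronglyMeasurable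
  have h1m : ∀ j, AEStronglyMeasurable (fun x => w j x - u x) (vol g) := fun j =>
    (aestronglyMeasurable_of_mem_smoothMaps (hA (hwA j))).sub hum
  have h2m : ∀ j, AEStronglyMeasurable (fun x => ‖fld E (dif I (w j)) x - fld E D x‖) (vol g) :=
    fun j => ((hE.stronglyMeasurable k (w j) (hA (hwA j))).aestronglyMeasurable.sub hDm).norm
  obtain ⟨h, h0, hh, hl⟩ := hd
  refine ⟨w, hwA, ?_⟩
  simp only [hE.gnorm_sub]
  refine ⟨fun j => hh.mono' (h1m j) (hl.mono fun x hx => (hx.1 j).1),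
    fun j => hh.mono' (h2m j) (hl.mono fun x hx => ?_),
    tendsto_eLpNorm_of_dominated hp h1m hh (hl.mono fun x hx => ⟨fun j => (hx.1 j).1, ?_⟩),
    tendsto_eLpNorm_of_dominated hp h2m hh (hl.mono fun x hx => ⟨fun j => ?_, ?_⟩)⟩
  · rw [norm_norm]
    exact (hx.1 j).2
  · simpa using hx.2.1.sub_const (u x)
  · rw [norm_norm]
    exact (hx.1 j).2
  · simpa using (hx.2.2.sub_const (fld E D x)).norm

end Sigma

variable [CompactSpace M] [BorelSpace M] {p : ℝ} {u : M → Euc k}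

/-- The weak differential is unique up to null sets. -/
theorem IsDominatedLimit.ae_eq (hE : IsFrame g E) (hp : 1 ≤ p) {w w' : ℕ → M → Euc k}
    (hw : ∀ j, w j ∈ smoothMaps I M k) (hw' : ∀ j, w' j ∈ smoothMaps I M k)
    {D D' : ∀ x : M, TangentSpace I x →L[ℝ] Euc k}
    (hd : IsDominatedLimit (vol g) p w (fun j => fld E (dif I (w j))) u (fld E D))
    (hd' : IsDominatedLimit (vol g) p w' (fun j => fld E (dif I (w' j))) u (fld E D')) :
    ∀ᵐ x ∂(vol g), fld E D x = fld E D' x := by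
  have hG : ContDiff ℝ ∞ fun q : Euc k × Euc k => q.1 - q.2 := contDiff_fst.sub contDiff_snd
  have hsm : ∀ j, (fun x => w j x - w' j x) ∈ smoothMaps I M k := fun j =>
    comp_prodMk_mem_smoothMaps hG (hw j) (hw' j)
  have hdif : ∀ j x, dif I (fun x => w j x - w' j x) x = dif I (w j) x - dif I (w' j) x :=
    fun j x => by
      ext1 v
      have hG' : HasFDerivAt (fun q : Euc k × Euc k => q.1 - q.2)
        (ContinuousLinearMap.fst ℝ (Euc k) (Euc k) - ContinuousLinearMap.snd ℝ (Euc k) (Euc k))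
        (w j x, w' j x) := hasFDerivAt_fst.sub hasFDerivAt_snd
      rw [dif_comp_prodMk (G := fun q => q.1 - q.2) hG (hw j) (hw' j) x v, hG'.fderiv]
      rfl
  have hmeas : AEStronglyMeasurable (fun x => fld E D x - fld E D' x) (vol g) :=
    (hd.aestronglyMeasurable_right fun j =>
      (hE.stronglyMeasurable k (w j) (hw j)).aestronglyMeasurable).sub
    (hd'.aestronglyMeasurable_right fun j =>
      (hE.stronglyMeasurable k (w' j) (hw' j)).aestronglyMeasurable)
  obtain ⟨h, h0, hh, hl⟩ := hd.sub hd'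
  have hint : Integrable h (vol g) := hh.integrable (by simpa using hp)
  have hsub : ∀ x, gnorm g x (D x - D' x) = ‖fld E D x - fld E D' x‖ := hE.gnorm_sub D D'
  have key := ae_gnorm_eq_zero g hsm (D := fun x => D x - D' x)
    (h := hint.1.mk h) hint.1.stronglyMeasurable_mk.measurable
    (hint.congr hint.1.ae_eq_mk) (by simpa only [hsub] using hmeas.norm.aemeasurable) ?_
  · filter_upwards [key] with x hx
    rw [hsub, norm_eq_zero, sub_eq_zero] at hx
    exact hx
  · filter_upwards [hl, hint.1.ae_eq_mk] with x hx hhx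
    have heq : ∀ j, gnorm g x (dif I (fun x => w j x - w' j x) x - (D x - D' x)) =
        ‖(fld E (dif I (w j)) x - fld E (dif I (w' j)) x) - (fld E D x - fld E D' x)‖ :=
      fun j => by
        rw [hdif]
        exact hE.gnorm_eq x k _
    simp only [heq]
    rw [← hhx]
    simp only [sub_self, sub_zero] at hx
    refine ⟨hx.1, hx.2.1, ?_⟩
    simpa using (hx.2.2.sub_const (fld E D x - fld E D' x)).norm

end SobolevLimit

/-! ### The Euler–Lagrange equation and the energy estimate -/

section Equation

variable {m k : ℕ} {H : Type*} [TopologicalSpace H] {I : ModelWithCorners ℝ (Euc m) H}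
  {M : Type*} [TopologicalSpace M] [ChartedSpace H M]

theorem fld_dif_comp_add_smul {F : Euc k → Euc k} (hF : ContDiff ℝ ∞ F) {w ψ : M → Euc k}
    (hw : w ∈ smoothMaps I M k) (hψ : ψ ∈ smoothMaps I M k)
    (E : ∀ x : M, Fin m → TangentSpace I x) (t : ℝ) :
    (fun x => F (w x + t • ψ x)) ∈ smoothMaps I M k ∧
    fld E (dif I fun x => F (w x + t • ψ x)) = fun x =>
      lift (fderiv ℝ F (w x + t • ψ x)) (fld E (dif I w) x + t • fld E (dif I ψ) x) := by
  have hG : ContDiff ℝ ∞ fun q : Euc k × Euc k => F (q.1 + t • q.2) :=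
    hF.comp (contDiff_fst.add (contDiff_snd.const_smul t))
  refine ⟨comp_prodMk_mem_smoothMaps hG hw hψ, funext fun x => Fld.ext fun i => ?_⟩
  have h1 : HasFDerivAt (fun q : Euc k × Euc k => q.1 + t • q.2)
      (ContinuousLinearMap.fst ℝ (Euc k) (Euc k) + t • ContinuousLinearMap.snd ℝ (Euc k) (Euc k))
      (w x, ψ x) := hasFDerivAt_fst.add (hasFDerivAt_snd.const_smul t)
  have h2 : HasFDerivAt (fun q : Euc k × Euc k => F (q.1 + t • q.2)) _ (w x, ψ x) :=
    HasFDerivAt.comp (w x, ψ x) (hF.differentiable (by simp) (w x + t • ψ x)).hasFDerivAt h1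
  rw [comp_fld, dif_comp_prodMk (G := fun q => F (q.1 + t • q.2)) hG hw hψ x (E x i), h2.fderiv]
  rfl

theorem fld_dif_normSq_smul {F : Euc k → Euc k} (hF : ContDiff ℝ ∞ F) {w φ : M → Euc k}
    (hw : w ∈ smoothMaps I M k) (hφ : φ ∈ smoothMaps I M k) (P : Euc k)
    (E : ∀ x : M, Fin m → TangentSpace I x) :
    (fun x => ‖φ x‖ ^ 2 • (F (w x) - P)) ∈ smoothMaps I M k ∧
    fld E (dif I fun x => ‖φ x‖ ^ 2 • (F (w x) - P)) = fun x =>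
      ‖φ x‖ ^ 2 • lift (fderiv ℝ F (w x)) (fld E (dif I w) x) +
        (2 : ℝ) • tensor (φ x) (fld E (dif I φ) x) (F (w x) - P) := by
  have hG : ContDiff ℝ ∞ fun q : Euc k × Euc k => ‖q.1‖ ^ 2 • (F q.2 - P) :=
    (contDiff_fst.norm_sq ℝ).smul ((hF.comp contDiff_snd).sub contDiff_const)
  refine ⟨comp_prodMk_mem_smoothMaps hG hφ hw, funext fun x => Fld.ext fun i => ?_⟩
  have h1 : HasFDerivAt (fun q : Euc k × Euc k => F q.2)
      ((fderiv ℝ F (w x)).comp (ContinuousLinearMap.snd ℝ (Euc k) (Euc k))) (φ x, w x) :=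
    HasFDerivAt.comp (φ x, w x) (hF.differentiable (by simp) (w x)).hasFDerivAt hasFDerivAt_snd
  have h2 := (hasFDerivAt_fst (𝕜 := ℝ) (E := Euc k) (F := Euc k) (p := (φ x, w x))).norm_sq.smul
    (h1.sub_const P)
  rw [comp_fld, dif_comp_prodMk (G := fun q => ‖q.1‖ ^ 2 • (F q.2 - P)) hG hφ hw x (E x i)]
  erw [h2.fderiv]
  simp [two_smul, add_smul]

theorem tendsto_tensor (z : Euc k) (A : Fld k m) {v : ℕ → Euc k} {v' : Euc k}
    (hv : Tendsto v atTop (𝓝 v')) :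
    Tendsto (fun j => tensor z A (v j)) atTop (𝓝 (tensor z A v')) := by
  have h : Continuous fun v : Euc k => tensor z A v :=
    continuous_tensor.comp (continuous_const.prodMk (continuous_const.prodMk continuous_id))
  exact (h.tendsto v').comp hv

theorem normSq_smul_mem_testMaps {φ v : M → Euc k} (hφ : φ ∈ testMaps I M k)
    (h : (fun x => ‖φ x‖ ^ 2 • v x) ∈ smoothMaps I M k) :
    (fun x => ‖φ x‖ ^ 2 • v x) ∈ testMaps I M k := by
  have hsub : Function.support (fun x => ‖φ x‖ ^ 2 • v x) ⊆ Function.support φ := fun x hx h0 =>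
    hx (by simp [h0])
  exact ⟨h, hφ.2.1.mono hsub, (closure_mono hsub).trans hφ.2.2⟩

theorem testMaps_subset_smoothMaps : testMaps I M k ⊆ smoothMaps I M k := fun _ h => h.1

theorem exists_bound_fderiv {V W : Type*} [NormedAddCommGroup V] [NormedSpace ℝ V]
    [NormedAddCommGroup W] [NormedSpace ℝ W] {F : V → W} (hF : ContDiff ℝ ∞ F)
    (hFc : HasCompactSupport F) : ∃ K, ∀ z, ‖fderiv ℝ F z‖ ≤ K :=
  (hFc.fderiv ℝ).exists_bound_of_continuous (hF.fderiv_right (m := ∞) (by simp)).continuous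

variable [IsManifold I ∞ M] [T2Space M] [CompactSpace M] [MeasurableSpace M] [BorelSpace M]
  {g : Metric I M} {E : ∀ x : M, Fin m → TangentSpace I x} {p K δ : ℝ} {S : Set (Euc k)}
  {u : M → Euc k} {Du : ∀ x : M, TangentSpace I x →L[ℝ] Euc k} {F : Euc k → Euc k}

/-- The Euler–Lagrange equation of a `p`-harmonic map, where `F` is a smooth extension of the nearest
point projection. -/
theorem IsPHarmonic.integral_elDensity_eq_zero (hE : IsFrame g E) (hp : 2 ≤ p)
    (hu : IsPHarmonic g p S u) (hDu : IsW1p g p u Du) (hF : ContDiff ℝ ∞ F)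
    (hK1 : ∀ z, ‖fderiv ℝ F z‖ ≤ K) (hK2 : ∀ z, ‖fderiv ℝ (fderiv ℝ F) z‖ ≤ K) (hδ : 0 < δ)
    (hFn : ∀ y ∈ S, ∀ z, ‖z - y‖ < δ → F z = nearestPoint S z) {ψ : M → Euc k}
    (hψ : ψ ∈ testMaps I M k) :
    ∫ x, elDensity p F (u x) (fld E Du x) (ψ x) (fld E (dif I ψ) x) ∂(vol g) = 0 := by
  obtain ⟨w, hw, hd⟩ := hDu.exists_isDominatedLimit hE (by linarith)
  have hψs := testMaps_subset_smoothMaps hψ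
  have hum := hd.aestronglyMeasurable_left fun j => aestronglyMeasurable_of_mem_smoothMaps (hw j)
  have hU : MemLp (fld E Du) (ENNReal.ofReal p) (vol g) :=
    hd.memLp fun j => hE.memLp_fld_dif (hw j)
  obtain ⟨c, hc⟩ := hE.exists_bound hψs
  have hder := hasDerivAt_integral_norm_rpow (μ := vol g) hF hK1 hK2 hp hum
    (aestronglyMeasurable_of_mem_smoothMaps hψs)
    (hE.stronglyMeasurable k ψ hψs).aestronglyMeasurable hU (fun x => (hc x).1) fun x => (hc x).2
  have hnear : ∀ᶠ t : ℝ in 𝓝 0, ∀ x, ‖t • ψ x‖ < δ := by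
    have h1 : Tendsto (fun t : ℝ => |t| * |c|) (𝓝 0) (𝓝 0) := by
      have : Continuous fun t : ℝ => |t| * |c| := by fun_prop
      simpa using this.tendsto 0
    filter_upwards [h1.eventually_lt_const hδ] with t ht x
    rw [norm_smul, Real.norm_eq_abs]
    exact lt_of_le_of_lt (mul_le_mul_of_nonneg_left ((hc x).1.trans (le_abs_self c))
      (abs_nonneg t)) ht
  -- For small `t`, `F(u + tψ)` is the nearest point projection of `u + tψ`, and its weak differential
  -- is given by the chain rule.
  have hzero := hu.2.2 ψ hψ (fun t => 1 / p * ∫ x, ‖lift (fderiv ℝ F (u x + t • ψ x))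
    (fld E Du x + t • fld E (dif I ψ) x)‖ ^ p ∂(vol g)) (by
      filter_upwards [hnear] with t ht
      have hdt := (hd.add_const (fun x => t • ψ x) fun x => t • fld E (dif I ψ) x).comp hF hK1
        (hU.add ((hE.memLp_fld_dif hψs).const_smul t))
      have hue : (fun x => F (u x + t • ψ x)) =ᵐ[vol g]
          fun x => nearestPoint S (u x + t • ψ x) := by
        filter_upwards [hu.2.1] with x hx
        exact hFn _ hx _ (by simpa using ht x)
      refine ⟨fun x => (fderiv ℝ F (u x + t • ψ x)).comp (Du x + t • dif I ψ x), ?_, ?_⟩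
      · refine IsDominatedLimit.isSobolevLimit (w := fun j x => F (w j x + t • ψ x)) hE
          (by linarith) subset_rfl (fun j => (fld_dif_comp_add_smul hF (hw j) hψs E t).1) ?_
        simp only [(fld_dif_comp_add_smul hF (hw _) hψs E t).2]
        exact hdt.congr hue .rfl
      · refine congrArg (1 / p * ·) (integral_congr_ae (.of_forall fun x => ?_))
        exact congrArg (· ^ p) (hE.gnorm_eq_norm_fld (fun x =>
          (fderiv ℝ F (u x + t • ψ x)).comp (Du x + t • dif I ψ x)) x).symm)
  have hder' := hder.const_mul (1 / p)
  have h0 := hder'.unique hzero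
  rw [integral_const_mul, ← mul_assoc, one_div, inv_mul_cancel₀ (by linarith), one_mul] at h0
  exact h0

/-- The differential of a map into `S` is tangent to `S`. -/
theorem ae_lift_fderiv_eq_self (hE : IsFrame g E) (hp : 1 ≤ p) (hDu : IsW1p g p u Du)
    (hF : ContDiff ℝ ∞ F) (hK1 : ∀ z, ‖fderiv ℝ F z‖ ≤ K) (hFu : ∀ᵐ x ∂(vol g), F (u x) = u x) :
    ∀ᵐ x ∂(vol g), lift (fderiv ℝ F (u x)) (fld E Du x) = fld E Du x := by
  obtain ⟨w, hw, hd⟩ := hDu.exists_isDominatedLimit hE hp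
  have hU : MemLp (fld E Du) (ENNReal.ofReal p) (vol g) :=
    hd.memLp fun j => hE.memLp_fld_dif (hw j)
  have hdF := (hd.comp hF hK1 hU).congr hFu .rfl
  -- The chain rule for `F ∘ w` is the case `ψ = 0` of `fld_dif_comp_add_smul`.
  have h0 : (fun _ => 0 : M → Euc k) ∈ smoothMaps I M k := contMDiff_const
  have hs := fun j => fld_dif_comp_add_smul hF (hw j) h0 E 0
  simp only [smul_zero, zero_smul, add_zero] at hs
  refine IsDominatedLimit.ae_eq (D := fun x => (fderiv ℝ F (u x)).comp (Du x)) hE hp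
    (fun j => (hs j).1) hw ?_ hd
  simp only [(hs _).2]
  exact hdF

/-- The Euler–Lagrange equation in the direction `|φ|² (u - P)`, obtained from the test maps
`|φ|² (F(w_j) - P)` with smooth `w_j` tending to `u`. -/
theorem IsPHarmonic.integral_elDensity_normSq_smul_eq_zero (hE : IsFrame g E) (hS : IsCompact S)
    (hp : 2 ≤ p) (hu : IsPHarmonic g p S u) (hDu : IsW1p g p u Du) (hF : ContDiff ℝ ∞ F)
    (hFc : HasCompactSupport F)
    (hK1 : ∀ z, ‖fderiv ℝ F z‖ ≤ K) (hK2 : ∀ z, ‖fderiv ℝ (fderiv ℝ F) z‖ ≤ K) (hδ : 0 < δ)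
    (hFn : ∀ y ∈ S, ∀ z, ‖z - y‖ < δ → F z = nearestPoint S z) (P : Euc k) {φ : M → Euc k}
    (hφ : φ ∈ testMaps I M k) :
    ∫ x, elDensity p F (u x) (fld E Du x) (‖φ x‖ ^ 2 • (u x - P))
      (‖φ x‖ ^ 2 • fld E Du x + (2 : ℝ) • tensor (φ x) (fld E (dif I φ) x) (u x - P)) ∂(vol g)
      = 0 := by
  have hφs := testMaps_subset_smoothMaps hφ
  have hFu : ∀ᵐ x ∂(vol g), F (u x) = u x := hu.2.1.mono fun x hx => eq_self_of_mem hS hδ hFn hx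
  have hFU := ae_lift_fderiv_eq_self hE (by linarith) hDu hF hK1 hFu
  obtain ⟨w, hw, hd⟩ := hDu.exists_isDominatedLimit hE (by linarith)
  have hum := hd.aestronglyMeasurable_left fun j => aestronglyMeasurable_of_mem_smoothMaps (hw j)
  have hU : MemLp (fld E Du) (ENNReal.ofReal p) (vol g) :=
    hd.memLp fun j => hE.memLp_fld_dif (hw j)
  obtain ⟨c, hc⟩ := hE.exists_bound hφs
  obtain ⟨B, hB⟩ := hFc.exists_bound_of_continuous hF.continuous
  have hs := fun j => fld_dif_normSq_smul hF (hw j) hφs P E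
  have hEL := fun j => hu.integral_elDensity_eq_zero hE hp hDu hF hK1 hK2 hδ hFn
    (normSq_smul_mem_testMaps hφ (hs j).1)
  simp only [(hs _).2] at hEL
  obtain ⟨h, h0, hh, hl⟩ := (hd.comp hF hK1 hU).congr hFu hFU
  have hFP : ∀ z, ‖F z - P‖ ≤ B + ‖P‖ := fun z =>
    (norm_sub_le _ _).trans (add_le_add (hB z) le_rfl)
  have hlim := tendsto_integral_elDensity (c := c ^ 2 * (B + ‖P‖)) hp hF hK1 hK2 hum hU hFU
    (h := fun x => c ^ 2 * (h x + ‖fld E Du x‖) + 2 * (c * c * (B + ‖P‖)))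
    (ψ := fun j x => ‖φ x‖ ^ 2 • (F (w j x) - P))
    (Ψ := fun j x => ‖φ x‖ ^ 2 • lift (fderiv ℝ F (w j x)) (fld E (dif I (w j)) x) +
        (2 : ℝ) • tensor (φ x) (fld E (dif I φ) x) (F (w j x) - P))
    (ψ' := fun x => ‖φ x‖ ^ 2 • (u x - P))
    (Ψ' := fun x => ‖φ x‖ ^ 2 • fld E Du x +
      (2 : ℝ) • tensor (φ x) (fld E (dif I φ) x) (u x - P)) ?_ ?_ ?_ ?_ ?_ ?_
  · simp only [hEL] at hlim
    exact (tendsto_nhds_unique hlim tendsto_const_nhds)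
  · intro x
    have h1 := (norm_nonneg _).trans (hFP 0)
    have h2 := h0 x
    have h3 := (norm_nonneg _).trans (hc x).1
    positivity
  · exact ((hh.add hU.norm).const_mul (c ^ 2)).add (memLp_const _)
  · exact fun j => aestronglyMeasurable_of_mem_smoothMaps (hs j).1
  · intro j
    have h1 := (hE.stronglyMeasurable k _ (hs j).1).aestronglyMeasurable (μ := vol g)
    rwa [(hs j).2] at h1
  · filter_upwards [hl] with x hx j
    have hc0 := (norm_nonneg _).trans (hc x).1
    have h1 : ‖lift (fderiv ℝ F (w j x)) (fld E (dif I (w j)) x)‖ ≤ h x + ‖fld E Du x‖ := by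
      have h2 := norm_add_le (lift (fderiv ℝ F (w j x)) (fld E (dif I (w j)) x) - fld E Du x)
        (fld E Du x)
      rw [sub_add_cancel] at h2
      linarith [(hx.1 j).2]
    have h2 : ‖φ x‖ ^ 2 ≤ c ^ 2 := pow_le_pow_left₀ (norm_nonneg _) (hc x).1 2
    refine ⟨?_, (norm_add_le _ _).trans (add_le_add ?_ ?_)⟩
    · rw [norm_smul, norm_pow, norm_norm]
      exact mul_le_mul h2 (hFP _) (norm_nonneg _) (by positivity)
    · rw [norm_smul, norm_pow, norm_norm]
      exact mul_le_mul h2 h1 (norm_nonneg _) (by positivity)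
    · rw [norm_smul, Real.norm_ofNat]
      refine mul_le_mul_of_nonneg_left ((norm_tensor_le _ _ _).trans ?_) (by norm_num)
      exact mul_le_mul (mul_le_mul (hc x).1 (hc x).2 (norm_nonneg _) hc0) (hFP _) (norm_nonneg _)
        (by positivity)
  · filter_upwards [hl] with x hx
    exact ⟨(hx.2.1.sub_const P).const_smul _, (hx.2.2.const_smul _).add
      ((tendsto_tensor (φ x) (fld E (dif I φ) x) (hx.2.1.sub_const P)).const_smul _)⟩

/-- The energy estimate for `p`-harmonic maps into a small ball around `P`. -/
theorem IsPHarmonic.integral_le (hE : IsFrame g E) (hS : IsCompact S) (hp : 2 ≤ p)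
    (hu : IsPHarmonic g p S u) (hDu : IsW1p g p u Du) (hF : ContDiff ℝ ∞ F)
    (hFc : HasCompactSupport F)
    (hK1 : ∀ z, ‖fderiv ℝ F z‖ ≤ K) (hK2 : ∀ z, ‖fderiv ℝ (fderiv ℝ F) z‖ ≤ K) (hδ : 0 < δ)
    (hFn : ∀ y ∈ S, ∀ z, ‖z - y‖ < δ → F z = nearestPoint S z) {P : Euc k} {r : ℝ}
    (hKr : K * r ≤ 1 / 2) (hur : ∀ᵐ x ∂(vol g), ‖u x - P‖ ≤ r) {φ : M → Euc k}
    {Dφ : ∀ x : M, TangentSpace I x →L[ℝ] Euc k} (hφ : IsW1pZero g p φ Dφ) :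
    Integrable (fun x => ‖fld E Du x‖ ^ p * ‖φ x‖ ^ 2) (vol g) ∧
    Integrable (fun x => ‖fld E Du x‖ ^ (p - 2) * ‖fld E Dφ x‖ ^ 2) (vol g) ∧
    ∫ x, ‖fld E Du x‖ ^ p * ‖φ x‖ ^ 2 ∂(vol g) ≤
      16 * r ^ 2 * ∫ x, ‖fld E Du x‖ ^ (p - 2) * ‖fld E Dφ x‖ ^ 2 ∂(vol g) := by
  have hFU := ae_lift_fderiv_eq_self hE (by linarith) hDu hF hK1
    (hu.2.1.mono fun x hx => eq_self_of_mem hS hδ hFn hx)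
  obtain ⟨w, hw, hd⟩ := hDu.exists_isDominatedLimit hE (by linarith)
  have hum := hd.aestronglyMeasurable_left fun j => aestronglyMeasurable_of_mem_smoothMaps (hw j)
  have hU : MemLp (fld E Du) (ENNReal.ofReal p) (vol g) :=
    hd.memLp fun j => hE.memLp_fld_dif (hw j)
  obtain ⟨ψ, hψ, hdψ⟩ := hφ.exists_isDominatedLimit hE (by linarith)
  have hψs := fun j => testMaps_subset_smoothMaps (hψ j)
  have hΦ : MemLp (fld E Dφ) (ENNReal.ofReal p) (vol g) :=
    hdψ.memLp fun j => hE.memLp_fld_dif (hψs j)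
  have hψm : ∀ j, AEStronglyMeasurable (ψ j) (vol g) := fun j =>
    aestronglyMeasurable_of_mem_smoothMaps (hψs j)
  have hΨm : ∀ j, AEStronglyMeasurable (fld E (dif I (ψ j))) (vol g) := fun j =>
    (hE.stronglyMeasurable k _ (hψs j)).aestronglyMeasurable
  obtain ⟨b, hb0, hb, hl⟩ := hdψ
  refine integral_le_of_tendsto hp hU (h := fun x => b x + ‖fld E Dφ x‖)
    (fun x => add_nonneg (hb0 x) (norm_nonneg _)) (hb.add hΦ.norm) hψm hΨm ?_
    (hl.mono fun x hx => hx.2) fun j => ?_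
  · filter_upwards [hl] with x hx j
    have h1 := norm_add_le (fld E (dif I (ψ j)) x - fld E Dφ x) (fld E Dφ x)
    rw [sub_add_cancel] at h1
    linarith [(hx.1 j).2]
  · obtain ⟨c, hc⟩ := hE.exists_bound (hψs j)
    exact integral_norm_rpow_mul_sq_le hp hF hK1 hK2 hum hU hFU
      (hu.2.1.mono fun x hx => inner_fderiv_comm hS hF hδ hFn hx) hKr hur (hψm j) (hΨm j)
      (fun x => (hc x).1) (fun x => (hc x).2)
      (hu.integral_elDensity_normSq_smul_eq_zero hE hS hp hDu hF hFc hK1 hK2 hδ hFn P (hψ j))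

end Equation

end

end PHarmonic

theorem proposition2p1 {n k : ℕ} {N : Type*} [TopologicalSpace N]
    [ChartedSpace (PHarmonic.Euc n) N] [IsManifold (𝓡 n) ∞ N] [CompactSpace N]
    (h : PHarmonic.Metric (𝓡 n) N) (ι : N → PHarmonic.Euc k)
    (hι : PHarmonic.IsIsometricEmbedding h ι) :
    ∃ C : ℝ, 0 < C ∧
      ∀ {m : ℕ} {H : Type*} [TopologicalSpace H]
        (I : ModelWithCorners ℝ (PHarmonic.Euc m) H)
        (M : Type*) [TopologicalSpace M] [ChartedSpace H M] [IsManifold I ∞ M]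
        [CompactSpace M] [T2Space M] [MeasurableSpace M] [BorelSpace M]
        (g : PHarmonic.Metric I M) (p : ℝ) (_hp : 2 ≤ p)
        (u : M → PHarmonic.Euc k) (_hu : PHarmonic.IsPHarmonic g p (range ι) u)
        (P₀ : N) (r : ℝ) (_hr : 0 < r) (_hrC : r < C)
        (_hur : ∀ᵐ x ∂(PHarmonic.vol g), u x ∈ Metric.ball (ι P₀) r)
        (Du : ∀ x : M, TangentSpace I x →L[ℝ] PHarmonic.Euc k) (_hDu : PHarmonic.IsW1p g p u Du)
        (φ : M → PHarmonic.Euc k) (Dφ : ∀ x : M, TangentSpace I x →L[ℝ] PHarmonic.Euc k)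
        (_hφ : PHarmonic.IsW1pZero g p φ Dφ),
        Integrable (fun x => PHarmonic.gnorm g x (Du x) ^ p * ‖φ x‖ ^ 2) (PHarmonic.vol g) ∧
        Integrable (fun x => PHarmonic.gnorm g x (Du x) ^ (p - 2) * PHarmonic.gnorm g x (Dφ x) ^ 2)
          (PHarmonic.vol g) ∧
        ∫ x, PHarmonic.gnorm g x (Du x) ^ p * ‖φ x‖ ^ 2 ∂(PHarmonic.vol g) ≤
          16 * r ^ 2 *
            ∫ x, PHarmonic.gnorm g x (Du x) ^ (p - 2) * PHarmonic.gnorm g x (Dφ x) ^ 2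
              ∂(PHarmonic.vol g) := by
  have hS : IsCompact (range ι) := isCompact_range hι.isEmbedding.continuous
  obtain ⟨F, hF, hFc, δ, hδ, hFn⟩ := PHarmonic.exists_smooth_extension_nearestPoint hS (by
    rintro _ ⟨q, rfl⟩
    exact hι.eventually_contDiffAt_nearestPoint q)
  obtain ⟨K₁, hK₁⟩ := PHarmonic.exists_bound_fderiv hF hFc
  obtain ⟨K₂, hK₂⟩ := PHarmonic.exists_bound_fderiv (F := fderiv ℝ F)
    (hF.fderiv_right (m := ∞) (by simp)) (hFc.fderiv ℝ)
  set K := max K₁ K₂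
  have hK0 : 0 ≤ K := ((norm_nonneg _).trans (hK₁ 0)).trans (le_max_left _ _)
  -- `K + 1` avoids a division by zero when `F` is locally constant.
  refine ⟨1 / (2 * (K + 1)), by positivity, ?_⟩
  intro m H _ I M _ _ _ _ _ _ _ g p hp u hu P₀ r hr hrC hur Du hDu φ Dφ hφ
  have hKr : K * r ≤ 1 / 2 := by
    rw [lt_div_iff₀ (by positivity)] at hrC
    nlinarith
  obtain ⟨E, hE⟩ := PHarmonic.exists_isFrame g
  have hur' : ∀ᵐ x ∂(PHarmonic.vol g), ‖u x - ι P₀‖ ≤ r :=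
    hur.mono fun x hx => (mem_ball_iff_norm.1 hx).le
  have hle := hu.integral_le hE hS hp hDu hF hFc (fun z => (hK₁ z).trans (le_max_left _ _))
    (fun z => (hK₂ z).trans (le_max_right _ _)) hδ hFn hKr hur' hφ
  simpa only [hE.gnorm_eq_norm_fld] using hle
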